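/- **Terms.** The terms of the value substitution kernel $\lambda_{vker}$ are, up to $\alpha$-equivalence, $t,s,u ::= v \mid v\,s \mid t[x/u]$ with values $v ::= x \mid \lambda x.t$; here $t[x/u]$ (an explicit substitution) binds $x$ in $t$. The reductions $\to_{\mathsf m}$ and $\to_{\mathsf e}$ are the closures under all contexts of $(\lambda x.t)u \mapsto_{\mathsf m} t[x/u]$ and $t[x/vL]\mapsto_{\mathsf e} t\{x/v\}L$, where $L$ is a possibly empty list $[x_1/u_1]\dots[x_k/u_k]$ and $\{x/v\}$ is capture-avoiding substitution. **Nets.** A net is a directed hypergraph with exponential nodes ($e$-nodes), multiplicative nodes ($m$-nodes) and links of five kinds: $!$ (source an $e$-node, target an $m$-node), $\mathsf d$ (source $m$, target $e$), $\mathsf w$ (no source, target $e$), $\otimes$ (source $e$, targets an $m$-node and an $e$-node), $\parr$ (sources an $m$-node and an $e$-node $x$, its variable; target an $e$-node $b$), together with a root and, for each $\parr$-link, a sub-hypergraph called its box. The free variables are the nodes without outgoing links and carry variable names; a node is internal if it has both incoming and outgoing links. It is required that: the root is an $e$-node without incoming links; free variables are $e$-nodes and are targets of $\mathsf d$- and $\mathsf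 w$-links only; every $m$-node has exactly one incoming and one outgoing link; every $e$-node is incident to some link, has at most one outgoing link, and if it has several incoming links they are all $\mathsf d$-links; the box of a $\parr$-link is a net (its $\parr$-links having the same boxes) with root $b$ and with $x$ among its free variables, and no free variable of the box other than $x$ is the target of a weakening ($\mathsf w$-link) of the box; if two boxes intersect and neither contains the other, then all common nodes are free variables of both; every link whose target is an internal $e$-node of a box is in that box. Nets are considered up to renaming of links and of the nodes that are not free variables. **Translation.** For a set $X$ of variables, $⟦t⟧_X$ is $⟦t⟧$ plus a $\mathsf w$-link on each $y\in X\setminus \mathrm{fv}(t)$. The translation $⟦t⟧$ is defined by recursion; free variables with the same name are always identified. For an $m$-node $a$ and a value $v$, let $C_a(v)$ be a $\mathsf d$-link from $a$ to $x$ if $v=x$, and a $\parr$-link with $m$-source $a$, variable $x$ and box $⟦t⟧_{\{x\}}$ if $v=\lambda x.t$. Then $⟦v⟧$ is a $!$-link from the root to a fresh $a$ together with $C_a(v)$; $⟦v\,s⟧$ is a $\otimes$-link from the root to a fresh $a$ and to the root of $⟦s⟧$, together with $C_a(v)$ and $⟦s⟧$; $⟦t[x/u]⟧$ is the union of $⟦t⟧_{\{x\}}$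 and $⟦u⟧$ with $x$ identified with the root of $⟦u⟧$ (its root is that of $⟦t⟧$). **Cut-elimination.** $\to_{\mathsf m}$: if an $m$-node is the target of a $\otimes$-link (with $e$-source $r$ and $e$-target $y$) and the source of a $\parr$-link (with variable $x$ and target $b$), both links and the $m$-node are removed, the box is opened, $b$ is identified with $r$ and $x$ with $y$. $\to_{\mathsf e}$: let an $e$-node $x$ be the source of a $!$-link with target $a$, and let $H$ be the $\mathsf d$-link with source $a$, or the $\parr$-link with source $a$ together with its box. (i) If the incoming links of $x$ are $k\ge 1$ $\mathsf d$-links, then these links, the $!$-link and $x$ are removed and $H$ is replaced by $k$ copies, the $i$-th having the source of the $i$-th $\mathsf d$-link in place of $a$ and belonging to all boxes that contained that $\mathsf d$-link; the free variables of $H$ are shared by the copies and all other nodes of $H$ are copied. (ii) If $x$ is the target of a $\mathsf w$-link, then this link, the $!$-link, $x$ and $H$ are removed, and each free variable $z$ of $H$ that is not the target of a remaining link becomes the target of a new $\mathsf w$-link; it belongs to those boxes containing the removed $!$-link of which $z$ is not a free variable or of which $z$ is the variable. **Theorem (strong bisimulation).** Let $t$ be a $\lambda_{vker}$-term and $X\supseteq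 \mathrm{fv}(t)$ a set of variables. Then $⟦t⟧_X$ is a net, and the translation is a strong bisimulation between $t$ and $⟦t⟧_X$; that is, for $a\in\{\mathsf m,\mathsf e\}$: 1. if $t\to_a t'$ then $⟦t⟧_X\to_a ⟦t'⟧_X$; 2. if $⟦t⟧_X\to_a G$ then there is a term $t'$ such that $t\to_a t'$ and $G=⟦t'⟧_X$. -/

import Mathlib

namespace VKer

/-! ### The value substitution kernel

Terms are taken up to α-equivalence in de Bruijn style.  The variable names are the natural
numbers; each binder binds index `0` of its scope and shifts the other variables by one. -/

mutual
/-- Values `v ::= x | λx.t`. -/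
inductive Val : Type
  | var (n : ℕ)
  | lam (t : Tm)
/-- Terms `t ::= v | v s | t[x/u]`; in `sub t u` the index `0` of `t` is bound. -/
inductive Tm : Type
  | val (v : Val)
  | app (v : Val) (s : Tm)
  | sub (t u : Tm)
end

mutual
/-- Free variables of a value. -/
def Val.fv : Val → Set ℕ
  | .var n => {n}
  | .lam t => {n | n + 1 ∈ t.fv}
/-- Free variables of a term. -/
def Tm.fv : Tm → Set ℕ
  | .val v => v.fv
  | .app v s => v.fv ∪ s.fv
  | .sub t u => {n | n + 1 ∈ t.fv} ∪ u.fv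
end

/-- A renaming pushed under a binder. -/
def liftRen (ρ : ℕ → ℕ) : ℕ → ℕ
  | 0 => 0
  | n + 1 => ρ n + 1

mutual
/-- Renaming of free variables in a value. -/
def Val.rename (ρ : ℕ → ℕ) : Val → Val
  | .var n => .var (ρ n)
  | .lam t => .lam (t.rename (liftRen ρ))
/-- Renaming of free variables in a term. -/
def Tm.rename (ρ : ℕ → ℕ) : Tm → Tm
  | .val v => .val (v.rename ρ)
  | .app v s => .app (v.rename ρ) (s.rename ρ)
  | .sub t u => .sub (t.rename (liftRen ρ)) (u.rename ρ)
end

/-- A substitution of values pushed under a binder. -/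
def liftSubst (σ : ℕ → Val) : ℕ → Val
  | 0 => .var 0
  | n + 1 => (σ n).rename (· + 1)

mutual
/-- Capture-avoiding simultaneous substitution of values for variables in a value. -/
def Val.subst (σ : ℕ → Val) : Val → Val
  | .var n => σ n
  | .lam t => .lam (t.subst (liftSubst σ))
/-- Capture-avoiding simultaneous substitution of values for variables in a term. -/
def Tm.subst (σ : ℕ → Val) : Tm → Tm
  | .val v => .val (v.subst σ)
  | .app v s => .app (v.subst σ) (s.subst σ)
  | .sub t u => .sub (t.subst (liftSubst σ)) (u.subst σ)
end

/-- `t.plug [u₁, …, u_k]` is `t[x₁/u₁]…[x_k/u_k]`. -/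
def Tm.plug : Tm → List Tm → Tm
  | t, [] => t
  | t, u :: L => (Tm.sub t u).plug L

/-- The substitution that takes a term `t` in the scope of the binder of `x` only to `t{x/v}` in the
scope of `k` other binders: `x`, that is `0`, is replaced by `v` and every other variable keeps its
identity. -/
def instSubst (v : Val) (k : ℕ) : ℕ → Val
  | 0 => v
  | n + 1 => .var (n + k)

/-- The two kinds of steps: multiplicative and exponential. -/
inductive Mode : Type
  | m
  | e

/-- The reduction `t →ₐ t'`: the closure under all contexts of
`(λx.t)u ↦ₘ t[x/u]` and `t[x/vL] ↦ₑ t{x/v}L`. -/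
inductive Tm.Step : Mode → Tm → Tm → Prop
  | mult (t u : Tm) : Tm.Step .m (.app (.lam t) u) (.sub t u)
  | exp (t : Tm) (v : Val) (L : List Tm) :
      Tm.Step .e (.sub t ((Tm.val v).plug L)) ((t.subst (instSubst v L.length)).plug L)
  | lam {a : Mode} {t t' : Tm} : Tm.Step a t t' → Tm.Step a (.val (.lam t)) (.val (.lam t'))
  | appFun {a : Mode} {t t' : Tm} (s : Tm) :
      Tm.Step a t t' → Tm.Step a (.app (.lam t) s) (.app (.lam t') s)
  | appArg {a : Mode} {s s' : Tm} (v : Val) :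
      Tm.Step a s s' → Tm.Step a (.app v s) (.app v s')
  | subBody {a : Mode} {t t' : Tm} (u : Tm) :
      Tm.Step a t t' → Tm.Step a (.sub t u) (.sub t' u)
  | subArg {a : Mode} {u u' : Tm} (t : Tm) :
      Tm.Step a u u' → Tm.Step a (.sub t u) (.sub t u')

/-! ### Hypergraphs with boxes and nets -/

/-- The label of a link together with its sources and targets; `E` are the exponential nodes and
`M` the multiplicative ones.  A `⅋`-link has the `m`-node `s` and its variable `x` as sources, and
the root `b` of its box as target. -/
inductive Shape (E M : Type) : Type
  | bang (s : E) (t : M)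
  | der (s : M) (t : E)
  | weak (t : E)
  | par (s : M) (x b : E)
  | tensor (s : E) (f : M) (y : E)

namespace Shape

variable {E M E' M' : Type}

/-- Relabelling of nodes. -/
def map (f : E → E') (g : M → M') : Shape E M → Shape E' M'
  | bang s t => bang (f s) (g t)
  | der s t => der (g s) (f t)
  | weak t => weak (f t)
  | par s x b => par (g s) (f x) (f b)
  | tensor s a y => tensor (f s) (g a) (f y)

/-- The exponential sources of a link. -/
def eSources : Shape E M → Set E
  | bang s _ => {s}
  | der _ _ => ∅
  | weak _ => ∅
  | par _ x _ => {x}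
  | tensor s _ _ => {s}

/-- The exponential targets of a link. -/
def eTargets : Shape E M → Set E
  | bang _ _ => ∅
  | der _ t => {t}
  | weak t => {t}
  | par _ _ b => {b}
  | tensor _ _ y => {y}

/-- The multiplicative sources of a link. -/
def mSources : Shape E M → Set M
  | bang _ _ => ∅
  | der s _ => {s}
  | weak _ => ∅
  | par s _ _ => {s}
  | tensor _ _ _ => ∅

/-- The multiplicative targets of a link. -/
def mTargets : Shape E M → Set M
  | bang _ t => {t}
  | der _ _ => ∅
  | weak _ => ∅
  | par _ _ _ => ∅
  | tensor _ a _ => {a}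

/-- The link is a dereliction. -/
def IsDer (c : Shape E M) : Prop := ∃ s t, c = der s t

/-- The link is a weakening. -/
def IsWeak (c : Shape E M) : Prop := ∃ t, c = weak t

/-- The link is a `⅋`-link. -/
def IsPar (c : Shape E M) : Prop := ∃ s x b, c = par s x b

end Shape

/-- Rooted directed labelled hypergraphs with boxes.  Variable names are exponential nodes, and the
free variables are the nodes `Sum.inl n`; `E` and `M` supply the other nodes.  Since nets have no
isolated nodes, only the nodes that are incident to a link count as nodes of the hypergraph.
For the same reason a box is given by its set of links; `box l` is meaningful for `⅋`-links `l`. -/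
structure Net : Type 1 where
  E : Type
  M : Type
  Link : Type
  shape : Link → Shape (ℕ ⊕ E) M
  box : Link → Set Link
  root : E

namespace Net

/-- The exponential nodes of the subhypergraph with links `S`. -/
def eNodes (G : Net) (S : Set G.Link) : Set (ℕ ⊕ G.E) :=
  {x | ∃ l ∈ S, x ∈ (G.shape l).eSources ∨ x ∈ (G.shape l).eTargets}

/-- The multiplicative nodes of the subhypergraph with links `S`. -/
def mNodes (G : Net) (S : Set G.Link) : Set G.M :=
  {a | ∃ l ∈ S, a ∈ (G.shape l).mSources ∨ a ∈ (G.shape l).mTargets}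

/-- The free variables of the subhypergraph with links `S`: its exponential nodes without outgoing
links. -/
def freeVars (G : Net) (S : Set G.Link) : Set (ℕ ⊕ G.E) :=
  {x | x ∈ G.eNodes S ∧ ∀ l ∈ S, x ∉ (G.shape l).eSources}

/-- The exponential nodes of the subhypergraph with links `S` with both an incoming and an outgoing
link. -/
def internal (G : Net) (S : Set G.Link) : Set (ℕ ⊕ G.E) :=
  {x | (∃ l ∈ S, x ∈ (G.shape l).eSources) ∧ ∃ l ∈ S, x ∈ (G.shape l).eTargets}

/-- The conditions on root, conclusions, and multiplicative and exponential nodes that a net has to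
satisfy, for the subhypergraph with links `S` and root `r`; its `⅋`-links have their boxes in it. -/
structure IsNetOn (G : Net) (S : Set G.Link) (r : ℕ ⊕ G.E) : Prop where
  root_mem : r ∈ G.eNodes S
  root_source : ∀ l ∈ S, r ∉ (G.shape l).eTargets
  conclusions : ∀ x ∈ G.freeVars S, ∀ l ∈ S, x ∈ (G.shape l).eTargets →
    (G.shape l).IsDer ∨ (G.shape l).IsWeak
  mult_in : ∀ a ∈ G.mNodes S, ∃! l, l ∈ S ∧ a ∈ (G.shape l).mTargets
  mult_out : ∀ a ∈ G.mNodes S, ∃! l, l ∈ S ∧ a ∈ (G.shape l).mSources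
  exp_out : ∀ x, ∀ l ∈ S, ∀ l' ∈ S,
    x ∈ (G.shape l).eSources → x ∈ (G.shape l').eSources → l = l'
  exp_in : ∀ x, ∀ l ∈ S, ∀ l' ∈ S, x ∈ (G.shape l).eTargets → x ∈ (G.shape l').eTargets →
    l ≠ l' → (G.shape l).IsDer ∧ (G.shape l').IsDer
  box_subset : ∀ l ∈ S, (G.shape l).IsPar → G.box l ⊆ S

/-- The definition of a net.  The first two conditions say that the nodes `Sum.inl n` of the net are
exactly its free variables. -/
structure IsNet (G : Net) : Prop where
  names_free : ∀ n l, Sum.inl n ∉ (G.shape l).eSources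
  free_named : ∀ e, Sum.inr e ∉ G.freeVars Set.univ
  whole : G.IsNetOn Set.univ (Sum.inr G.root)
  box_isNet : ∀ l a x b, G.shape l = .par a x b → G.IsNetOn (G.box l) b
  border_var : ∀ l a x b, G.shape l = .par a x b → x ∈ G.freeVars (G.box l)
  border_weak : ∀ l a x b, G.shape l = .par a x b → ∀ y ∈ G.freeVars (G.box l), y ≠ x →
    ∀ w ∈ G.box l, G.shape w ≠ .weak y
  nesting : ∀ l₁ l₂, (G.shape l₁).IsPar → (G.shape l₂).IsPar →
    ¬ G.box l₁ ⊆ G.box l₂ → ¬ G.box l₂ ⊆ G.box l₁ →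
    G.eNodes (G.box l₁) ∩ G.eNodes (G.box l₂) ⊆
      G.freeVars (G.box l₁) ∩ G.freeVars (G.box l₂) ∧
    G.mNodes (G.box l₁) ∩ G.mNodes (G.box l₂) = ∅
  internal_closure : ∀ l, (G.shape l).IsPar → ∀ x ∈ G.internal (G.box l),
    ∀ l', x ∈ (G.shape l').eTargets → l' ∈ G.box l

/-- Equality of nets up to the choice of the links and of the nodes that are not free variables. -/
def Iso (G G' : Net) : Prop :=
  ∃ (φ : G.Link ≃ G'.Link) (ε : G.E → G'.E) (μ : G.M → G'.M),
    Set.InjOn ε {e | Sum.inr e ∈ G.eNodes Set.univ} ∧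
    Set.InjOn μ (G.mNodes Set.univ) ∧
    (∀ l, G'.shape (φ l) = (G.shape l).map (Sum.map id ε) μ) ∧
    (∀ l, (G.shape l).IsPar → G'.box (φ l) = φ '' G.box l) ∧
    G'.root = ε G.root

end Net

/-! ### The translation -/

/-- What lies below the root link of the translation of a value or of an application of it: a
dereliction, or a `⅋`-link with its box.  The node `none` is the `m`-node on which it hangs. -/
structure Content : Type 1 where
  E : Type
  M : Type
  Link : Type
  shape : Link → Shape (ℕ ⊕ E) (Option M)
  box : Link → Set Link

/-- Adds a weakening for each name in `W`. -/
def Net.addWeak (G : Net) (W : Set ℕ) : Net where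
  E := G.E
  M := G.M
  Link := G.Link ⊕ W
  shape := Sum.elim G.shape (fun n => .weak (Sum.inl n.1))
  box := Sum.elim (fun l => Sum.inl '' G.box l) (fun _ => ∅)
  root := G.root

/-- Binding the name `0` to the node `x`; the other names are shifted back. -/
def bindNode {E E' : Type} (x : E') (f : E → E') : ℕ ⊕ E → ℕ ⊕ E'
  | .inl 0 => .inr x
  | .inl (n + 1) => .inl n
  | .inr e => .inr (f e)

/-- A dereliction on the variable `n`. -/
def Content.ofVar (n : ℕ) : Content where
  E := Empty
  M := Empty
  Link := Unit
  shape := fun _ => .der none (Sum.inl n)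
  box := fun _ => ∅

/-- A `⅋`-link with box `B`, whose variable is the node named `0` of `B`.  The link is `none`, and
the node `none` is the variable. -/
def Content.ofBox (B : Net) : Content where
  E := Option B.E
  M := B.M
  Link := Option B.Link
  shape
    | none => .par none (Sum.inr none) (Sum.inr (some B.root))
    | some l => (B.shape l).map (bindNode none some) some
  box
    | none => Set.range some
    | some l => some '' B.box l

/-- A `!`-link on `H`; the link is `none`, and its source `none` is the root. -/
def Net.ofBang (H : Content) : Net where
  E := Option H.E
  M := Option H.M
  Link := Option H.Link
  shape
    | none => .bang (Sum.inr none) none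
    | some l => (H.shape l).map (Sum.map id some) id
  box
    | none => ∅
    | some l => some '' H.box l
  root := none

/-- A `⊗`-link on `H` and on the root of `G`; the link is `none`, and its source `none` is the root.
Free variables of `H` and `G` with the same name are contracted. -/
def Net.ofTensor (H : Content) (G : Net) : Net where
  E := Option (H.E ⊕ G.E)
  M := Option H.M ⊕ G.M
  Link := Option (H.Link ⊕ G.Link)
  shape
    | none => .tensor (Sum.inr none) (Sum.inl none) (Sum.inr (some (Sum.inr G.root)))
    | some (.inl l) => (H.shape l).map (Sum.map id (some ∘ Sum.inl)) Sum.inl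
    | some (.inr l) => (G.shape l).map (Sum.map id (some ∘ Sum.inr)) Sum.inr
  box
    | none => ∅
    | some (.inl l) => (some ∘ Sum.inl) '' H.box l
    | some (.inr l) => (some ∘ Sum.inr) '' G.box l
  root := none

/-- The node named `0` of `G` is identified with the root of `K`.  Other free variables of `G` and
`K` with the same name are contracted. -/
def Net.ofSub (G K : Net) : Net where
  E := G.E ⊕ K.E
  M := G.M ⊕ K.M
  Link := G.Link ⊕ K.Link
  shape
    | .inl l => (G.shape l).map (bindNode (Sum.inr K.root) Sum.inl) Sum.inl
    | .inr l => (K.shape l).map (Sum.map id Sum.inr) Sum.inr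
  box
    | .inl l => Sum.inl '' G.box l
    | .inr l => Sum.inr '' K.box l
  root := Sum.inl G.root

mutual
/-- The translation of a value, without its root link. -/
def Val.content : Val → Content
  | .var n => Content.ofVar n
  | .lam t => Content.ofBox (t.net.addWeak ({0} \ t.fv))
/-- The translation `⟦t⟧` of a term. -/
def Tm.net : Tm → Net
  | .val v => Net.ofBang v.content
  | .app v s => Net.ofTensor v.content s.net
  | .sub t u => Net.ofSub (t.net.addWeak ({0} \ t.fv)) u.net
end

/-- The translation `⟦t⟧_X`, with a weakening for every variable in `X` that is not free in `t`. -/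
def Tm.netOn (t : Tm) (X : Set ℕ) : Net := t.net.addWeak (X \ t.fv)

/-! ### Cut-elimination -/

namespace Net

/-- The dereliction, or the `⅋`-link with its box, below the `m`-node `a`. -/
def below (G : Net) (a : G.M) : Set G.Link :=
  {l | a ∈ (G.shape l).mSources ∨
    ∃ p x b, G.shape p = .par a x b ∧ l ∈ G.box p}

open Classical in
/-- The multiplicative rule on a `⊗`-link `t` with source `r` and `e`-target `y` and a `⅋`-link `p`
with variable `x` and box root `b`, cut on their `m`-node: both links are removed, so that the box
of `p` is opened, `b` is merged with `r`, and `x` with `y`. -/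
noncomputable def multReduct (G : Net) (t p : G.Link) (r y x b : ℕ ⊕ G.E) : Net where
  E := G.E
  M := G.M
  Link := {l : G.Link // l ≠ t ∧ l ≠ p}
  shape := fun l =>
    (G.shape l.1).map (fun z => if z = b then r else if z = x then y else z) id
  box := fun l => {l' | l'.1 ∈ G.box l.1}
  root := G.root

/-- The derelictions on the node `x`, with their sources. -/
abbrev DersOn (G : Net) (x : ℕ ⊕ G.E) : Type :=
  {q : G.Link × G.M // G.shape q.1 = .der q.2 x}

/-- The links that are not touched when the `!`-link `c` from `x` to `a` is cut with derelictions. -/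
abbrev DerKept (G : Net) (c : G.Link) (x : ℕ ⊕ G.E) (a : G.M) : Type :=
  {l : G.Link // l ≠ c ∧ l ∉ G.below a ∧ ∀ s, G.shape l ≠ .der s x}

open Classical in
/-- The `e`-nodes of the copy for `d` of `G.below a`: the targets of `G.below a` are shared and the
other nodes are copied. -/
noncomputable def copyE (G : Net) (x : ℕ ⊕ G.E) (a : G.M) (d : G.DersOn x) :
    ℕ ⊕ G.E → ℕ ⊕ (G.E ⊕ G.DersOn x × G.E)
  | .inl n => .inl n
  | .inr e =>
    if ∃ h ∈ G.below a, Sum.inr e ∈ (G.shape h).eSources then .inr (.inr (d, e))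
    else .inr (.inl e)

open Classical in
/-- The `m`-nodes of the copy for `d` of `G.below a`: the node `a` becomes the source of `d` and the
other nodes are copied. -/
noncomputable def copyM (G : Net) (x : ℕ ⊕ G.E) (a : G.M) (d : G.DersOn x) :
    G.M → G.M ⊕ G.DersOn x × G.M :=
  fun n => if n = a then .inl d.1.2 else .inr (d, n)

/-- The exponential rule on a `!`-link `c` from `x` to `a` cut with derelictions: there is one copy
of `G.below a` for each dereliction `d` on `x`, which takes the place of `d` and enters the boxes
that contain `d`. -/
noncomputable def derReduct (G : Net) (c : G.Link) (x : ℕ ⊕ G.E) (a : G.M) : Net where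
  E := G.E ⊕ G.DersOn x × G.E
  M := G.M ⊕ G.DersOn x × G.M
  Link := G.DerKept c x a ⊕ G.DersOn x × G.below a
  shape
    | .inl l => (G.shape l.1).map (Sum.map id Sum.inl) Sum.inl
    | .inr (d, h) => (G.shape h.1).map (G.copyE x a d) (G.copyM x a d)
  box
    | .inl l => {k | (∃ l' : G.DerKept c x a, k = .inl l' ∧ l'.1 ∈ G.box l.1) ∨
        ∃ (d : G.DersOn x) (h : G.below a), k = .inr (d, h) ∧ d.1.1 ∈ G.box l.1}
    | .inr (d, h) => {k | ∃ h' : G.below a, k = .inr (d, h') ∧ h'.1 ∈ G.box h.1}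
  root := .inl G.root

/-- The links that are not touched when the `!`-link `c` to `a` is cut with the weakening `w`. -/
abbrev WeakKept (G : Net) (c w : G.Link) (a : G.M) : Type :=
  {l : G.Link // l ≠ c ∧ l ≠ w ∧ l ∉ G.below a}

/-- The targets of `G.below a` that get a weakening when the `!`-link `c` to `a` is cut with the
weakening `w`: those on which no other link is left. -/
abbrev NewWeak (G : Net) (c w : G.Link) (a : G.M) : Type :=
  {y : ℕ ⊕ G.E // y ∈ G.freeVars (G.below a) ∧
    ∀ l : G.WeakKept c w a, y ∉ (G.shape l.1).eTargets}

/-- The exponential rule on a `!`-link `c` to `a` cut with a weakening `w`: `G.below a` is erased and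
replaced by weakenings on its targets.  These are in the boxes that contain `c`, except for the
boxes that close on the target, that is, have it as a free variable that is not the variable of
their `⅋`-link: the weakening is pushed out of those. -/
noncomputable def weakReduct (G : Net) (c w : G.Link) (a : G.M) : Net where
  E := G.E
  M := G.M
  Link := G.WeakKept c w a ⊕ G.NewWeak c w a
  shape
    | .inl l => G.shape l.1
    | .inr y => .weak y.1
  box
    | .inl l => {k | (∃ l' : G.WeakKept c w a, k = .inl l' ∧ l'.1 ∈ G.box l.1) ∨
        ∃ y : G.NewWeak c w a, k = .inr y ∧ c ∈ G.box l.1 ∧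
          (y.1 ∈ G.freeVars (G.box l.1) → y.1 ∈ (G.shape l.1).eSources)}
    | .inr _ => ∅
  root := G.root

/-- The cut-elimination rules. -/
inductive Rule : Mode → Net → Net → Prop
  | mult (G : Net) (t p : G.Link) (r : ℕ ⊕ G.E) (a : G.M) (y x b : ℕ ⊕ G.E) :
      G.shape t = .tensor r a y → G.shape p = .par a x b → Rule .m G (G.multReduct t p r y x b)
  | der (G : Net) (c d : G.Link) (x : ℕ ⊕ G.E) (a s : G.M) :
      G.shape c = .bang x a → G.shape d = .der s x → Rule .e G (G.derReduct c x a)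
  | weak (G : Net) (c w : G.Link) (x : ℕ ⊕ G.E) (a : G.M) :
      G.shape c = .bang x a → G.shape w = .weak x → Rule .e G (G.weakReduct c w a)

/-- The reduction `G →ₐ G'` on nets, which are considered up to isomorphism. -/
def Step (i : Mode) (G G' : Net) : Prop :=
  ∃ K K', G.Iso K ∧ Rule i K K' ∧ K'.Iso G'

end Net

end VKer

/-!
A net that comes from a term is determined by its links other than weakenings: a weakening is on
exactly those nodes that need an incoming link and have no other, and it is in exactly those boxes
that bind its target or contain an outgoing link of it.  Therefore the proof works with a predicate
on arbitrary nets, `VKer.Net.Denotes G t X`, saying that `G` is the translation of `t` up to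
isomorphism.  It has two parts.  The first, `VKer.Tm.Rep`, is a recursion on `t` that reads `t` back
from the links of `G` that are not weakenings.  The second, `VKer.Tidy`, collects global conditions:
uniqueness of incoming and outgoing links, existence of them, and the position of weakenings in
boxes.

Five facts about `Denotes` give the theorem.  The translation of `t` satisfies it
(`VKer.Tm.denotes_netOn`, by induction on `t`).  It implies that `G` is a net
(`VKer.Net.Denotes.isNet`).  It is invariant under isomorphism (`VKer.Net.Denotes.of_iso`).  Two nets
that represent the same term are isomorphic (`VKer.Net.Denotes.iso`: the readings of `t` match the
links that are not weakenings, and these determine the rest).  Finally, steps correspond: every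
cut-elimination step of `G` leads to a net that represents a reduct of `t`
(`VKer.Net.Denotes.exists_step`), and every step of `t` arises in this way
(`VKer.Net.Denotes.exists_rule`).

For the correspondence of steps, a rule is described by a simulation `VKer.Sim`, which sends each
link of the net to a set of links of the reduct: a kept link to itself, an erased one to the empty
set, and a dereliction on the cut node of an exponential step to its copy of the content of the
value.  Under a simulation, a reading of a term becomes a reading of a substitution instance of it
(`VKer.Tm.Rep.subst`), so that the two exponential rules are a single argument, with `k ≥ 0`
derelictions on the cut node.  The occurrences `VKer.Tm.Occ` of subterms, which are connected with
the rest of the net only through their roots and free variables, locate each cut at a redex of `t`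
and show that the step does not affect the context of the redex.
-/

namespace VKer

/-! ### Links under relabelling -/

namespace Shape

variable {E M E' M' : Type} (s : Shape E M) (f : E → E') (g : M → M')

@[simp] theorem mem_eSources_map {z : E'} :
    z ∈ (s.map f g).eSources ↔ ∃ y ∈ s.eSources, f y = z := by
  cases s <;> simp [map, eSources, eq_comm]

@[simp] theorem mem_eTargets_map {z : E'} :
    z ∈ (s.map f g).eTargets ↔ ∃ y ∈ s.eTargets, f y = z := by
  cases s <;> simp [map, eTargets, eq_comm]

@[simp] theorem mem_mSources_map {z : M'} :
    z ∈ (s.map f g).mSources ↔ ∃ y ∈ s.mSources, g y = z := by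
  cases s <;> simp [map, mSources, eq_comm]

@[simp] theorem mem_mTargets_map {z : M'} :
    z ∈ (s.map f g).mTargets ↔ ∃ y ∈ s.mTargets, g y = z := by
  cases s <;> simp [map, mTargets, eq_comm]

@[simp] theorem isDer_map : (s.map f g).IsDer ↔ s.IsDer := by
  cases s <;> simp [map, IsDer]

@[simp] theorem isWeak_map : (s.map f g).IsWeak ↔ s.IsWeak := by
  cases s <;> simp [map, IsWeak]

@[simp] theorem isPar_map : (s.map f g).IsPar ↔ s.IsPar := by
  cases s <;> simp [map, IsPar]

theorem map_map {E'' M'' : Type} (f' : E' → E'') (g' : M' → M'') :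
    (s.map f g).map f' g' = s.map (f' ∘ f) (g' ∘ g) := by
  cases s <;> rfl

@[simp] theorem map_id : s.map id id = s := by
  cases s <;> rfl

variable {s}

theorem eSources_unique {z z' : E} (h : z ∈ s.eSources) (h' : z' ∈ s.eSources) : z = z' := by
  cases s <;> simp_all [eSources]

theorem eTargets_unique {z z' : E} (h : z ∈ s.eTargets) (h' : z' ∈ s.eTargets) : z = z' := by
  cases s <;> simp_all [eTargets]

theorem mSources_unique {z z' : M} (h : z ∈ s.mSources) (h' : z' ∈ s.mSources) : z = z' := by
  cases s <;> simp_all [mSources]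

theorem not_isWeak_of_eSource {z : E} (h : z ∈ s.eSources) : ¬ s.IsWeak := by
  rintro ⟨t, rfl⟩; exact h

theorem not_isWeak_of_mSource {a : M} (h : a ∈ s.mSources) : ¬ s.IsWeak := by
  rintro ⟨t, rfl⟩; exact h

theorem not_isWeak_of_mTarget {a : M} (h : a ∈ s.mTargets) : ¬ s.IsWeak := by
  rintro ⟨t, rfl⟩; exact h

theorem IsDer.not_isWeak (h : s.IsDer) : ¬ s.IsWeak := by
  obtain ⟨a, t, rfl⟩ := h; simp [IsWeak]

theorem IsPar.not_isWeak (h : s.IsPar) : ¬ s.IsWeak := by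
  obtain ⟨a, x, b, rfl⟩ := h; simp [IsWeak]

theorem IsPar.not_isDer (h : s.IsPar) : ¬ s.IsDer := by
  obtain ⟨a, x, b, rfl⟩ := h; simp [IsDer]

end Shape

/-! ### Tidy hypergraphs -/

/-- The global conditions on the translation of a term, for a hypergraph given by its links and
boxes, where `R` is the set of its roots and `X` the set of names of its free variables.  All
nodes are nodes that are incident to a link.  The last condition determines in which boxes a
weakening is, and together with the conditions on the targets, the other links determine the
weakenings. -/
structure Tidy {E M L : Type} (shape : L → Shape (ℕ ⊕ E) M) (box : L → Set L)
    (R : Set (ℕ ⊕ E)) (X : Set ℕ) : Prop where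
  names : ∀ n l, Sum.inl n ∉ (shape l).eSources
  eout : ∀ {z l l'}, z ∈ (shape l).eSources → z ∈ (shape l').eSources → l = l'
  mout : ∀ {a l l'}, a ∈ (shape l).mSources → a ∈ (shape l').mSources → l = l'
  min : ∀ {a l l'}, a ∈ (shape l).mTargets → a ∈ (shape l').mTargets → l = l'
  ein : ∀ {z l l'}, z ∈ (shape l).eTargets → z ∈ (shape l').eTargets → l ≠ l' → (shape l).IsDer
  root_target : ∀ {z l}, z ∈ R → z ∉ (shape l).eTargets
  src_tgt : ∀ {z l}, z ∈ (shape l).eSources → z ∈ R ∨ ∃ l', z ∈ (shape l').eTargets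
  name_tgt : ∀ n ∈ X, ∃ l, Sum.inl n ∈ (shape l).eTargets
  tgt_src : ∀ {z l}, z ∈ (shape l).eTargets →
    (∃ l', z ∈ (shape l').eSources) ∨ ∃ n ∈ X, z = Sum.inl n
  weak_box : ∀ {p a x b w z}, shape p = .par a x b → shape w = .weak z →
    (w ∈ box p ↔ z = x ∨ ∃ l ∈ box p, z ∈ (shape l).eSources)

namespace Net

/-- The conditions `VKer.Tidy` for a net with its root. -/
abbrev IsTidy (G : Net) (X : Set ℕ) : Prop := Tidy G.shape G.box {Sum.inr G.root} X

/-- The links in `S` that are not weakenings. -/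
def nw (G : Net) (S : Set G.Link) : Set G.Link := {l ∈ S | ¬ (G.shape l).IsWeak}

/-- The exponential sources of the links in `S`. -/
def src (G : Net) (S : Set G.Link) : Set (ℕ ⊕ G.E) := {z | ∃ l ∈ S, z ∈ (G.shape l).eSources}

theorem src_mono (G : Net) {S T : Set G.Link} (h : S ⊆ T) : G.src S ⊆ G.src T :=
  fun _ ⟨l, hl, hz⟩ => ⟨l, h hl, hz⟩

theorem mem_src_nw {G : Net} {S : Set G.Link} {l : G.Link} {z : ℕ ⊕ G.E} (hl : l ∈ S)
    (hz : z ∈ (G.shape l).eSources) : z ∈ G.src (G.nw S) :=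
  ⟨l, ⟨hl, Shape.not_isWeak_of_eSource hz⟩, hz⟩

end Net

/-! ### Sets of links that represent a term -/

/-- Extension of an environment by a node for the variable `0`. -/
def cons {α : Type} (x : α) (ρ : ℕ → α) : ℕ → α
  | 0 => x
  | n + 1 => ρ n

theorem comp_cons {α β : Type} (f : α → β) (x : α) (ρ : ℕ → α) :
    f ∘ cons x ρ = cons (f x) (f ∘ ρ) := by
  funext n; cases n <;> rfl

theorem cons_comp_liftRen {α : Type} (x : α) (ρ : ℕ → α) (τ : ℕ → ℕ) :
    cons x ρ ∘ liftRen τ = cons x (ρ ∘ τ) := by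
  funext n; cases n <;> rfl

mutual
/-- The links `S`, none of which is a weakening, form the translation of the value `v` below the
`m`-node `a`, up to weakenings, where `ρ` gives the nodes of the free variables. -/
def Val.Rep (G : Net) : Val → (ℕ → ℕ ⊕ G.E) → G.M → Set G.Link → Prop
  | .var n, ρ, a, S => ∃ d, G.shape d = .der a (ρ n) ∧ S = {d}
  | .lam t, ρ, a, S => ∃ p x b, G.shape p = .par a x b ∧ p ∉ G.box p ∧
      S = insert p (G.nw (G.box p)) ∧ t.Rep G (cons x ρ) b (G.nw (G.box p))
/-- The links `S`, none of which is a weakening, form the translation of the term `t` with root `r`,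
up to weakenings, where `ρ` gives the nodes of the free variables. -/
def Tm.Rep (G : Net) : Tm → (ℕ → ℕ ⊕ G.E) → ℕ ⊕ G.E → Set G.Link → Prop
  | .val v, ρ, r, S => ∃ c a T, G.shape c = .bang r a ∧ c ∉ T ∧ S = insert c T ∧ v.Rep G ρ a T
  | .app v s, ρ, r, S => ∃ c a y T T', G.shape c = .tensor r a y ∧ c ∉ T ∧ c ∉ T' ∧
      Disjoint T T' ∧ S = insert c (T ∪ T') ∧ v.Rep G ρ a T ∧ s.Rep G ρ y T'
  | .sub t u, ρ, r, S => ∃ y T T', Disjoint T T' ∧ S = T ∪ T' ∧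
      t.Rep G (cons y ρ) r T ∧ u.Rep G ρ y T'
end

section Rep

variable {G : Net}

mutual
theorem Val.rep_rename {v : Val} {τ : ℕ → ℕ} {ρ a S} :
    (v.rename τ).Rep G ρ a S ↔ v.Rep G (ρ ∘ τ) a S := by
  cases v with
  | var n => simp [Val.rename, Val.Rep]
  | lam t => simp only [Val.rename, Val.Rep, Tm.rep_rename, cons_comp_liftRen]
theorem Tm.rep_rename {t : Tm} {τ : ℕ → ℕ} {ρ r S} :
    (t.rename τ).Rep G ρ r S ↔ t.Rep G (ρ ∘ τ) r S := by
  cases t with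
  | val v => simp only [Tm.rename, Tm.Rep, Val.rep_rename]
  | app v s => simp only [Tm.rename, Tm.Rep, Val.rep_rename, Tm.rep_rename]
  | sub t u => simp only [Tm.rename, Tm.Rep, Tm.rep_rename, cons_comp_liftRen]
end

/-- The root link of a term is a `!`- or a `⊗`-link. -/
theorem Tm.Rep.root {t : Tm} {ρ r S} (h : t.Rep G ρ r S) :
    ∃ l ∈ S, r ∈ (G.shape l).eSources ∧ ¬ (G.shape l).IsPar := by
  match t, h with
  | .val v, ⟨c, a, T, hc, _, hS, _⟩ =>
    exact ⟨c, by simp [hS], by simp [hc, Shape.eSources], by simp [hc, Shape.IsPar]⟩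
  | .app v s, ⟨c, a, y, T, T', hc, _, _, _, hS, _⟩ =>
    exact ⟨c, by simp [hS], by simp [hc, Shape.eSources], by simp [hc, Shape.IsPar]⟩
  | .sub t u, ⟨y, T, T', _, hS, ht, _⟩ =>
    obtain ⟨l, hl, h1, h2⟩ := ht.root
    exact ⟨l, by simp [hS, hl], h1, h2⟩

mutual
/-- A link in a representation of a value has its target in it, or it is a dereliction on the node
of a variable. -/
theorem Val.Rep.target {v : Val} {ρ a S} (h : v.Rep G ρ a S) {l z} (hl : l ∈ S)
    (hz : z ∈ (G.shape l).eTargets) :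
    ((G.shape l).IsDer ∧ ∃ n, z = ρ n) ∨ z ∈ G.src S := by
  match v, h with
  | .var n, ⟨d, hd, hS⟩ =>
    subst hS; obtain rfl := hl
    simp only [hd, Shape.eTargets, Set.mem_singleton_iff] at hz
    exact .inl ⟨⟨_, _, hd⟩, n, hz⟩
  | .lam t, ⟨p, x, b, hp, _, hS, ht⟩ =>
    subst hS
    rcases hl with rfl | hl
    · simp only [hp, Shape.eTargets, Set.mem_singleton_iff] at hz
      obtain ⟨k, hk, h1, _⟩ := ht.root
      exact .inr ⟨k, by simp [hk], hz ▸ h1⟩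
    · rcases ht.target hl hz with ⟨hd, n, hn⟩ | hz
      · cases n with
        | zero => exact .inr ⟨p, by simp, by simp [hp, Shape.eSources, hn, cons]⟩
        | succ n => exact .inl ⟨hd, n, hn⟩
      · exact .inr (G.src_mono (Set.subset_insert _ _) hz)
/-- A link in a representation of a term has its target in it, or it is a dereliction on the node
of a variable. -/
theorem Tm.Rep.target {t : Tm} {ρ r S} (h : t.Rep G ρ r S) {l z} (hl : l ∈ S)
    (hz : z ∈ (G.shape l).eTargets) :
    ((G.shape l).IsDer ∧ ∃ n, z = ρ n) ∨ z ∈ G.src S := by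
  match t, h with
  | .val v, ⟨c, a, T, hc, _, hS, hv⟩ =>
    subst hS
    rcases hl with rfl | hl
    · simp [hc, Shape.eTargets] at hz
    · exact (hv.target hl hz).imp_right fun h => G.src_mono (Set.subset_insert _ _) h
  | .app v s, ⟨c, a, y, T, T', hc, _, _, _, hS, hv, hs⟩ =>
    subst hS
    rcases hl with rfl | hl | hl
    · simp only [hc, Shape.eTargets, Set.mem_singleton_iff] at hz
      obtain ⟨k, hk, h1, _⟩ := hs.root
      exact .inr ⟨k, by simp [hk], hz ▸ h1⟩
    · exact (hv.target hl hz).imp_right fun h => G.src_mono (fun _ h => .inr (.inl h)) h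
    · exact (hs.target hl hz).imp_right fun h => G.src_mono (fun _ h => .inr (.inr h)) h
  | .sub t u, ⟨y, T, T', _, hS, ht, hu⟩ =>
    subst hS
    rcases hl with hl | hl
    · rcases ht.target hl hz with ⟨hd, n, hn⟩ | hz
      · cases n with
        | zero =>
          obtain ⟨k, hk, h1, _⟩ := hu.root
          exact .inr ⟨k, by simp [hk], by rw [hn]; exact h1⟩
        | succ n => exact .inl ⟨hd, n, hn⟩
      · exact .inr (G.src_mono Set.subset_union_left hz)
    · exact (hu.target hl hz).imp_right fun h => G.src_mono Set.subset_union_right h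
end

mutual
theorem Val.Rep.fv_target {v : Val} {ρ a S} (h : v.Rep G ρ a S) {n} (hn : n ∈ v.fv) :
    ∃ l ∈ S, ρ n ∈ (G.shape l).eTargets := by
  match v, h with
  | .var m, ⟨d, hd, hS⟩ =>
    obtain rfl : n = m := hn
    exact ⟨d, by simp [hS], by simp [hd, Shape.eTargets]⟩
  | .lam t, ⟨p, x, b, hp, _, hS, ht⟩ =>
    obtain ⟨l, hl, hz⟩ := ht.fv_target (n := n + 1) hn
    exact ⟨l, by rw [hS]; exact .inr hl, hz⟩
theorem Tm.Rep.fv_target {t : Tm} {ρ r S} (h : t.Rep G ρ r S) {n} (hn : n ∈ t.fv) :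
    ∃ l ∈ S, ρ n ∈ (G.shape l).eTargets := by
  match t, h with
  | .val v, ⟨c, a, T, hc, _, hS, hv⟩ =>
    obtain ⟨l, hl, hz⟩ := hv.fv_target hn
    exact ⟨l, by rw [hS]; exact .inr hl, hz⟩
  | .app v s, ⟨c, a, y, T, T', hc, _, _, _, hS, hv, hs⟩ =>
    rcases hn with hn | hn
    · obtain ⟨l, hl, hz⟩ := hv.fv_target hn
      exact ⟨l, by rw [hS]; exact .inr (.inl hl), hz⟩
    · obtain ⟨l, hl, hz⟩ := hs.fv_target hn
      exact ⟨l, by rw [hS]; exact .inr (.inr hl), hz⟩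
  | .sub t u, ⟨y, T, T', _, hS, ht, hu⟩ =>
    rcases hn with hn | hn
    · obtain ⟨l, hl, hz⟩ := ht.fv_target (n := n + 1) hn
      exact ⟨l, by rw [hS]; exact .inl hl, hz⟩
    · obtain ⟨l, hl, hz⟩ := hu.fv_target hn
      exact ⟨l, by rw [hS]; exact .inr hl, hz⟩
end

theorem Val.Rep.entry {v : Val} {ρ a S} (h : v.Rep G ρ a S) :
    ∃ l ∈ S, a ∈ (G.shape l).mSources := by
  match v, h with
  | .var m, ⟨d, hd, hS⟩ => exact ⟨d, by simp [hS], by simp [hd, Shape.mSources]⟩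
  | .lam t, ⟨p, x, b, hp, _, hS, ht⟩ => exact ⟨p, by simp [hS], by simp [hp, Shape.mSources]⟩

mutual
theorem Val.Rep.m_source {v : Val} {ρ a S} (h : v.Rep G ρ a S) {l m} (hl : l ∈ S)
    (hm : m ∈ (G.shape l).mTargets) : ∃ k ∈ S, m ∈ (G.shape k).mSources := by
  match v, h with
  | .var m, ⟨d, hd, hS⟩ =>
    subst hS; obtain rfl := hl; simp [hd, Shape.mTargets] at hm
  | .lam t, ⟨p, x, b, hp, _, hS, ht⟩ =>
    subst hS
    rcases hl with rfl | hl
    · simp [hp, Shape.mTargets] at hm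
    · obtain ⟨k, hk, h⟩ := ht.m_source hl hm
      exact ⟨k, .inr hk, h⟩
theorem Tm.Rep.m_source {t : Tm} {ρ r S} (h : t.Rep G ρ r S) {l m} (hl : l ∈ S)
    (hm : m ∈ (G.shape l).mTargets) : ∃ k ∈ S, m ∈ (G.shape k).mSources := by
  match t, h with
  | .val v, ⟨c, a, T, hc, _, hS, hv⟩ =>
    subst hS
    rcases hl with rfl | hl
    · obtain ⟨k, hk, h⟩ := hv.entry
      simp only [hc, Shape.mTargets, Set.mem_singleton_iff] at hm
      exact ⟨k, .inr hk, hm ▸ h⟩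
    · obtain ⟨k, hk, h⟩ := hv.m_source hl hm
      exact ⟨k, .inr hk, h⟩
  | .app v s, ⟨c, a, y, T, T', hc, _, _, _, hS, hv, hs⟩ =>
    subst hS
    rcases hl with rfl | hl | hl
    · obtain ⟨k, hk, h⟩ := hv.entry
      simp only [hc, Shape.mTargets, Set.mem_singleton_iff] at hm
      exact ⟨k, .inr (.inl hk), hm ▸ h⟩
    · obtain ⟨k, hk, h⟩ := hv.m_source hl hm
      exact ⟨k, .inr (.inl hk), h⟩
    · obtain ⟨k, hk, h⟩ := hs.m_source hl hm
      exact ⟨k, .inr (.inr hk), h⟩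
  | .sub t u, ⟨y, T, T', _, hS, ht, hu⟩ =>
    subst hS
    rcases hl with hl | hl
    · obtain ⟨k, hk, h⟩ := ht.m_source hl hm
      exact ⟨k, .inl hk, h⟩
    · obtain ⟨k, hk, h⟩ := hu.m_source hl hm
      exact ⟨k, .inr hk, h⟩
end

mutual
theorem Val.Rep.m_target {v : Val} {ρ a S} (h : v.Rep G ρ a S) {l m} (hl : l ∈ S)
    (hm : m ∈ (G.shape l).mSources) : m = a ∨ ∃ k ∈ S, m ∈ (G.shape k).mTargets := by
  match v, h with
  | .var m, ⟨d, hd, hS⟩ =>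
    subst hS; obtain rfl := hl; exact .inl (by simpa [hd, Shape.mSources] using hm)
  | .lam t, ⟨p, x, b, hp, _, hS, ht⟩ =>
    subst hS
    rcases hl with rfl | hl
    · exact .inl (by simpa [hp, Shape.mSources] using hm)
    · obtain ⟨k, hk, h⟩ := ht.m_target hl hm
      exact .inr ⟨k, .inr hk, h⟩
theorem Tm.Rep.m_target {t : Tm} {ρ r S} (h : t.Rep G ρ r S) {l m} (hl : l ∈ S)
    (hm : m ∈ (G.shape l).mSources) : ∃ k ∈ S, m ∈ (G.shape k).mTargets := by
  match t, h with
  | .val v, ⟨c, a, T, hc, _, hS, hv⟩ =>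
    subst hS
    rcases hl with rfl | hl
    · simp [hc, Shape.mSources] at hm
    · rcases hv.m_target hl hm with rfl | ⟨k, hk, h⟩
      · exact ⟨c, .inl rfl, by simp [hc, Shape.mTargets]⟩
      · exact ⟨k, .inr hk, h⟩
  | .app v s, ⟨c, a, y, T, T', hc, _, _, _, hS, hv, hs⟩ =>
    subst hS
    rcases hl with rfl | hl | hl
    · simp [hc, Shape.mSources] at hm
    · rcases hv.m_target hl hm with rfl | ⟨k, hk, h⟩
      · exact ⟨c, .inl rfl, by simp [hc, Shape.mTargets]⟩
      · exact ⟨k, .inr (.inl hk), h⟩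
    · obtain ⟨k, hk, h⟩ := hs.m_target hl hm
      exact ⟨k, .inr (.inr hk), h⟩
  | .sub t u, ⟨y, T, T', _, hS, ht, hu⟩ =>
    subst hS
    rcases hl with hl | hl
    · obtain ⟨k, hk, h⟩ := ht.m_target hl hm
      exact ⟨k, .inl hk, h⟩
    · obtain ⟨k, hk, h⟩ := hu.m_target hl hm
      exact ⟨k, .inr hk, h⟩
end

mutual
theorem Val.Rep.box_subset {v : Val} {ρ a S} (h : v.Rep G ρ a S) {p} (hl : p ∈ S)
    (hp : (G.shape p).IsPar) : G.nw (G.box p) ⊆ S := by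
  match v, h with
  | .var m, ⟨d, hd, hS⟩ =>
    subst hS; obtain rfl := hl; simp [hd, Shape.IsPar] at hp
  | .lam t, ⟨q, x, b, hq, _, hS, ht⟩ =>
    subst hS
    rcases hl with rfl | hl
    · exact Set.subset_insert _ _
    · exact (ht.box_subset hl hp).trans (Set.subset_insert _ _)
theorem Tm.Rep.box_subset {t : Tm} {ρ r S} (h : t.Rep G ρ r S) {p} (hl : p ∈ S)
    (hp : (G.shape p).IsPar) : G.nw (G.box p) ⊆ S := by
  match t, h with
  | .val v, ⟨c, a, T, hc, _, hS, hv⟩ =>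
    subst hS
    rcases hl with rfl | hl
    · simp [hc, Shape.IsPar] at hp
    · exact (hv.box_subset hl hp).trans (Set.subset_insert _ _)
  | .app v s, ⟨c, a, y, T, T', hc, _, _, _, hS, hv, hs⟩ =>
    subst hS
    rcases hl with rfl | hl | hl
    · simp [hc, Shape.IsPar] at hp
    · exact (hv.box_subset hl hp).trans fun _ h => .inr (.inl h)
    · exact (hs.box_subset hl hp).trans fun _ h => .inr (.inr h)
  | .sub t u, ⟨y, T, T', _, hS, ht, hu⟩ =>
    subst hS
    rcases hl with hl | hl
    · exact (ht.box_subset hl hp).trans Set.subset_union_left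
    · exact (hu.box_subset hl hp).trans Set.subset_union_right
end

mutual
/-- Two boxes in a representation are equal, nested or disjoint. -/
theorem Val.Rep.laminar {v : Val} {ρ a S} (h : v.Rep G ρ a S) {p q} (hpS : p ∈ S) (hqS : q ∈ S)
    (hp : (G.shape p).IsPar) (hq : (G.shape q).IsPar) :
    p = q ∨ p ∈ G.box q ∨ q ∈ G.box p ∨ Disjoint (G.nw (G.box p)) (G.nw (G.box q)) := by
  match v, h with
  | .var m, ⟨d, hd, hS⟩ =>
    subst hS; obtain rfl := hpS; simp [hd, Shape.IsPar] at hp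
  | .lam t, ⟨p', x, b, hp', _, hS, ht⟩ =>
    subst hS
    rcases hpS with rfl | hpS <;> rcases hqS with rfl | hqS
    · exact .inl rfl
    · exact .inr (.inr (.inl hqS.1))
    · exact .inr (.inl hpS.1)
    · exact ht.laminar hpS hqS hp hq
/-- Two boxes in a representation are equal, nested or disjoint. -/
theorem Tm.Rep.laminar {t : Tm} {ρ r S} (h : t.Rep G ρ r S) {p q} (hpS : p ∈ S) (hqS : q ∈ S)
    (hp : (G.shape p).IsPar) (hq : (G.shape q).IsPar) :
    p = q ∨ p ∈ G.box q ∨ q ∈ G.box p ∨ Disjoint (G.nw (G.box p)) (G.nw (G.box q)) := by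
  match t, h with
  | .val v, ⟨c, a, T, hc, _, hS, hv⟩ =>
    subst hS
    rcases hpS with rfl | hpS
    · simp [hc, Shape.IsPar] at hp
    rcases hqS with rfl | hqS
    · simp [hc, Shape.IsPar] at hq
    exact hv.laminar hpS hqS hp hq
  | .app v s, ⟨c, a, y, T, T', hc, _, _, hd, hS, hv, hs⟩ =>
    subst hS
    rcases hpS with rfl | hpS
    · simp [hc, Shape.IsPar] at hp
    rcases hqS with rfl | hqS
    · simp [hc, Shape.IsPar] at hq
    rcases hpS with hpS | hpS <;> rcases hqS with hqS | hqS
    · exact hv.laminar hpS hqS hp hq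
    · exact .inr (.inr (.inr (hd.mono (hv.box_subset hpS hp) (hs.box_subset hqS hq))))
    · exact .inr (.inr (.inr (hd.symm.mono (hs.box_subset hpS hp) (hv.box_subset hqS hq))))
    · exact hs.laminar hpS hqS hp hq
  | .sub t u, ⟨y, T, T', hd, hS, ht, hu⟩ =>
    subst hS
    rcases hpS with hpS | hpS <;> rcases hqS with hqS | hqS
    · exact ht.laminar hpS hqS hp hq
    · exact .inr (.inr (.inr (hd.mono (ht.box_subset hpS hp) (hu.box_subset hqS hq))))
    · exact .inr (.inr (.inr (hd.symm.mono (hu.box_subset hpS hp) (ht.box_subset hqS hq))))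
    · exact hu.laminar hpS hqS hp hq
end

end Rep

/-! ### Occurrences of subterms -/

/-- The node `z` is the root, or it is the target of a link outside `S` that is not a weakening. -/
def Net.Entered (G : Net) (S : Set G.Link) (z : ℕ ⊕ G.E) : Prop :=
  z = Sum.inr G.root ∨ ∃ l ∉ S, ¬ (G.shape l).IsWeak ∧ z ∈ (G.shape l).eTargets

/-- The links `S` represent the value `v`, and they are connected with the rest of the net only
through the node `a` and the nodes of the free variables. -/
structure Val.Occ (G : Net) (v : Val) (ρ : ℕ → ℕ ⊕ G.E) (a : G.M) (S : Set G.Link) : Prop where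
  rep : v.Rep G ρ a S
  env : ∀ n, ρ n ∉ G.src S
  outer : ∀ z ∈ G.src S, ¬ G.Entered S z

/-- The links `S` represent the term `t`, and they are connected with the rest of the net only
through the root `r` and the nodes of the free variables. -/
structure Tm.Occ (G : Net) (t : Tm) (ρ : ℕ → ℕ ⊕ G.E) (r : ℕ ⊕ G.E) (S : Set G.Link) :
    Prop where
  rep : t.Rep G ρ r S
  env : ∀ n, ρ n ∉ G.src S
  outer : ∀ z ∈ G.src S, G.Entered S z → z = r

section Occ

variable {G : Net} {X : Set ℕ}

theorem Net.IsTidy.src_disjoint (hG : G.IsTidy X) {S T : Set G.Link} (h : Disjoint S T) {z}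
    (hS : z ∈ G.src S) (hT : z ∈ G.src T) : False := by
  obtain ⟨l, hl, hz⟩ := hS
  obtain ⟨k, hk, hz'⟩ := hT
  obtain rfl := hG.eout hz hz'
  exact Set.disjoint_left.1 h hl hk

theorem Tm.Occ.val (hG : G.IsTidy X) {v : Val} {ρ r S} (h : (Tm.val v).Occ G ρ r S) :
    ∃ c a T, G.shape c = .bang r a ∧ c ∉ T ∧ S = insert c T ∧ v.Occ G ρ a T := by
  obtain ⟨⟨c, a, T, hc, hcT, rfl, hv⟩, henv, hout⟩ := h
  have hsub := G.src_mono (Set.subset_insert c T)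
  refine ⟨c, a, T, hc, hcT, rfl, hv, fun n hn => henv n (hsub hn), fun z hz he => ?_⟩
  have hzr : z ≠ r := by
    rintro rfl
    obtain ⟨l, hl, hzl⟩ := hz
    exact hcT (hG.eout (l := c) (by simp [hc, Shape.eSources]) hzl ▸ hl)
  refine hzr (hout z (hsub hz) ?_)
  rcases he with he | ⟨l, hl, hw, hzl⟩
  · exact .inl he
  · refine .inr ⟨l, ?_, hw, hzl⟩
    rintro (rfl | h)
    · simp [hc, Shape.eTargets] at hzl
    · exact hl h

theorem Tm.Occ.app (hG : G.IsTidy X) {v : Val} {s : Tm} {ρ r S} (h : (Tm.app v s).Occ G ρ r S) :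
    ∃ c a y T T', G.shape c = .tensor r a y ∧ c ∉ T ∧ c ∉ T' ∧ Disjoint T T' ∧
      S = insert c (T ∪ T') ∧ v.Occ G ρ a T ∧ s.Occ G ρ y T' := by
  obtain ⟨⟨c, a, y, T, T', hc, hcT, hcT', hd, rfl, hv, hs⟩, henv, hout⟩ := h
  have hsub : G.src T ⊆ G.src (insert c (T ∪ T')) := G.src_mono fun _ h => .inr (.inl h)
  have hsub' : G.src T' ⊆ G.src (insert c (T ∪ T')) := G.src_mono fun _ h => .inr (.inr h)
  have hr {U : Set G.Link} (hU : c ∉ U) : r ∉ G.src U := by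
    rintro ⟨l, hl, hzl⟩
    exact hU (hG.eout (l := c) (by simp [hc, Shape.eSources]) hzl ▸ hl)
  have hy : y ∈ G.src T' := by
    obtain ⟨k, hk, h1, _⟩ := hs.root
    exact ⟨k, hk, h1⟩
  refine ⟨c, a, y, T, T', hc, hcT, hcT', hd, rfl,
    ⟨hv, fun n hn => henv n (hsub hn), fun z hz he => ?_⟩,
    ⟨hs, fun n hn => henv n (hsub' hn), fun z hz he => ?_⟩⟩
  · have hzr : z ≠ r := fun h => hr hcT (h ▸ hz)
    refine hzr (hout z (hsub hz) ?_)
    rcases he with he | ⟨l, hl, hw, hzl⟩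
    · exact .inl he
    · refine .inr ⟨l, ?_, hw, hzl⟩
      rintro (rfl | h | h)
      · simp only [hc, Shape.eTargets, Set.mem_singleton_iff] at hzl
        exact hG.src_disjoint hd hz (hzl ▸ hy)
      · exact hl h
      · rcases hs.target h hzl with ⟨_, n, rfl⟩ | h
        · exact henv n (hsub hz)
        · exact hG.src_disjoint hd hz h
  · have hzr : z ≠ r := fun h => hr hcT' (h ▸ hz)
    by_contra hzy
    refine hzr (hout z (hsub' hz) ?_)
    rcases he with he | ⟨l, hl, hw, hzl⟩
    · exact .inl he
    · refine .inr ⟨l, ?_, hw, hzl⟩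
      rintro (rfl | h | h)
      · simp only [hc, Shape.eTargets, Set.mem_singleton_iff] at hzl
        exact hzy hzl
      · rcases hv.target h hzl with ⟨_, n, rfl⟩ | h
        · exact henv n (hsub' hz)
        · exact hG.src_disjoint hd h hz
      · exact hl h

theorem Tm.Occ.sub (hG : G.IsTidy X) {t u : Tm} {ρ r S} (h : (Tm.sub t u).Occ G ρ r S) :
    ∃ y T T', Disjoint T T' ∧ S = T ∪ T' ∧ t.Occ G (cons y ρ) r T ∧ u.Occ G ρ y T' := by
  obtain ⟨⟨y, T, T', hd, rfl, ht, hu⟩, henv, hout⟩ := h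
  have hsub : G.src T ⊆ G.src (T ∪ T') := G.src_mono Set.subset_union_left
  have hsub' : G.src T' ⊆ G.src (T ∪ T') := G.src_mono Set.subset_union_right
  have hy : y ∈ G.src T' := by
    obtain ⟨k, hk, h1, _⟩ := hu.root
    exact ⟨k, hk, h1⟩
  have hr : r ∈ G.src T := by
    obtain ⟨k, hk, h1, _⟩ := ht.root
    exact ⟨k, hk, h1⟩
  refine ⟨y, T, T', hd, rfl, ⟨ht, ?_, fun z hz he => ?_⟩,
    ⟨hu, fun n hn => henv n (hsub' hn), fun z hz he => ?_⟩⟩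
  · rintro (_ | n) hn
    · exact hG.src_disjoint hd hn hy
    · exact henv n (hsub hn)
  · refine hout z (hsub hz) ?_
    rcases he with he | ⟨l, hl, hw, hzl⟩
    · exact .inl he
    · refine .inr ⟨l, ?_, hw, hzl⟩
      rintro (h | h)
      · exact hl h
      · rcases hu.target h hzl with ⟨_, n, rfl⟩ | h
        · exact henv n (hsub hz)
        · exact hG.src_disjoint hd hz h
  · by_contra hzy
    have hzr : z ≠ r := fun h => hG.src_disjoint hd hr (h ▸ hz)
    refine hzr (hout z (hsub' hz) ?_)
    rcases he with he | ⟨l, hl, hw, hzl⟩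
    · exact .inl he
    · refine .inr ⟨l, ?_, hw, hzl⟩
      rintro (h | h)
      · rcases ht.target h hzl with ⟨_, n, rfl⟩ | h
        · cases n with
          | zero => exact hzy rfl
          | succ n => exact henv n (hsub' hz)
        · exact hG.src_disjoint hd h hz
      · exact hl h

/-- Besides the occurrence of the body, this says that the links on the variable of a box are in
the box. -/
theorem Val.Occ.lam (hG : G.IsTidy X) {t : Tm} {ρ a S} (h : (Val.lam t).Occ G ρ a S) :
    ∃ p x b, G.shape p = .par a x b ∧ p ∉ G.box p ∧ S = insert p (G.nw (G.box p)) ∧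
      t.Occ G (cons x ρ) b (G.nw (G.box p)) ∧
      ∀ l, ¬ (G.shape l).IsWeak → x ∈ (G.shape l).eTargets → l ∈ G.box p := by
  obtain ⟨⟨p, x, b, hp, hpp, rfl, ht⟩, henv, hout⟩ := h
  have hsub := G.src_mono (Set.subset_insert p (G.nw (G.box p)))
  have hx : x ∉ G.src (G.nw (G.box p)) := by
    rintro ⟨l, hl, hzl⟩
    exact hpp (hG.eout (l := p) (by simp [hp, Shape.eSources]) hzl ▸ hl.1)
  have hb : b ∈ G.src (G.nw (G.box p)) := by
    obtain ⟨k, hk, h1, _⟩ := ht.root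
    exact ⟨k, hk, h1⟩
  refine ⟨p, x, b, hp, hpp, rfl, ⟨ht, ?_, fun z hz he => ?_⟩, fun l hw hl => ?_⟩
  · rintro (_ | n) hn
    · exact hx hn
    · exact henv n (hsub hn)
  · by_contra hzb
    refine hout z (hsub hz) ?_
    rcases he with he | ⟨l, hl, hw, hzl⟩
    · exact .inl he
    · refine .inr ⟨l, ?_, hw, hzl⟩
      rintro (rfl | h)
      · simp only [hp, Shape.eTargets, Set.mem_singleton_iff] at hzl
        exact hzb hzl
      · exact hl h
  · by_contra hlp
    refine hout x ⟨p, .inl rfl, by simp [hp, Shape.eSources]⟩ (.inr ⟨l, ?_, hw, hl⟩)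
    rintro (rfl | h)
    · simp only [hp, Shape.eTargets, Set.mem_singleton_iff] at hl
      exact hx (hl ▸ hb)
    · exact hlp h.1

mutual
/-- The occurrence of an abstraction that belongs to a `⅋`-link. -/
theorem Val.Occ.par (hG : G.IsTidy X) {v : Val} {ρ a S} (h : v.Occ G ρ a S) {p a' x b}
    (hpS : p ∈ S) (hp : G.shape p = .par a' x b) :
    ∃ s ρ', (Val.lam s).Occ G ρ' a' (insert p (G.nw (G.box p))) := by
  match v, h with
  | .var n, ⟨⟨d, hd, hS⟩, _, _⟩ => subst hS; obtain rfl := hpS; simp [hp] at hd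
  | .lam t, h =>
    obtain ⟨q, x', b', hq, _, hS, ht, _⟩ := h.lam hG
    rw [hS] at hpS
    rcases hpS with rfl | hpS
    · obtain ⟨rfl, -, -⟩ : a' = a ∧ x = x' ∧ b = b' := by simpa [hp] using hq
      exact ⟨t, ρ, hS ▸ h⟩
    · exact ht.par hG hpS hp
/-- The occurrence of an abstraction that belongs to a `⅋`-link. -/
theorem Tm.Occ.par (hG : G.IsTidy X) {t : Tm} {ρ r S} (h : t.Occ G ρ r S) {p a' x b}
    (hpS : p ∈ S) (hp : G.shape p = .par a' x b) :
    ∃ s ρ', (Val.lam s).Occ G ρ' a' (insert p (G.nw (G.box p))) := by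
  match t, h with
  | .val v, h =>
    obtain ⟨c, a, T, hc, _, hS, hv⟩ := h.val hG
    rw [hS] at hpS
    rcases hpS with rfl | hpS
    · simp [hp] at hc
    · exact hv.par hG hpS hp
  | .app v s, h =>
    obtain ⟨c, a, y, T, T', hc, _, _, _, hS, hv, hs⟩ := h.app hG
    rw [hS] at hpS
    rcases hpS with rfl | hpS | hpS
    · simp [hp] at hc
    · exact hv.par hG hpS hp
    · exact hs.par hG hpS hp
  | .sub t u, h =>
    obtain ⟨y, T, T', _, hS, ht, hu⟩ := h.sub hG
    rw [hS] at hpS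
    rcases hpS with hpS | hpS
    · exact ht.par hG hpS hp
    · exact hu.par hG hpS hp
end

mutual
/-- The occurrence of a value that belongs to a `!`-link. -/
theorem Val.Occ.bang (hG : G.IsTidy X) {v : Val} {ρ a S} (h : v.Occ G ρ a S) {c x a'}
    (hcS : c ∈ S) (hc : G.shape c = .bang x a') :
    ∃ (v' : Val) (ρ' : ℕ → ℕ ⊕ G.E) (T : Set G.Link), v'.Occ G ρ' a' T ∧ x ∉ G.src T ∧ c ∉ T ∧ ∀ n, ρ' n ≠ x := by
  match v, h with
  | .var n, ⟨⟨d, hd, hS⟩, _, _⟩ => subst hS; obtain rfl := hcS; simp [hc] at hd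
  | .lam t, h =>
    obtain ⟨q, x', b', hq, _, hS, ht, _⟩ := h.lam hG
    rw [hS] at hcS
    rcases hcS with rfl | hcS
    · simp [hc] at hq
    · exact ht.bang hG hcS hc
/-- The occurrence of a value that belongs to a `!`-link. -/
theorem Tm.Occ.bang (hG : G.IsTidy X) {t : Tm} {ρ r S} (h : t.Occ G ρ r S) {c x a'}
    (hcS : c ∈ S) (hc : G.shape c = .bang x a') :
    ∃ (v' : Val) (ρ' : ℕ → ℕ ⊕ G.E) (T : Set G.Link), v'.Occ G ρ' a' T ∧ x ∉ G.src T ∧ c ∉ T ∧ ∀ n, ρ' n ≠ x := by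
  match t, h with
  | .val v, h =>
    obtain ⟨d, a, T, hd, hdT, hS, hv⟩ := h.val hG
    rw [hS] at hcS
    rcases hcS with rfl | hcS
    · obtain ⟨rfl, rfl⟩ : x = r ∧ a' = a := by simpa [hc] using hd
      refine ⟨v, ρ, T, hv, ?_, hdT, fun n hn => ?_⟩
      · rintro ⟨l, hl, hz⟩
        exact hdT (hG.eout (l := c) (by simp [hc, Shape.eSources]) hz ▸ hl)
      · exact h.env n ⟨c, by simp [hS], by simp [hc, Shape.eSources, hn]⟩
    · exact hv.bang hG hcS hc
  | .app v s, h =>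
    obtain ⟨d, a, y, T, T', hd, _, _, _, hS, hv, hs⟩ := h.app hG
    rw [hS] at hcS
    rcases hcS with rfl | hcS | hcS
    · simp [hc] at hd
    · exact hv.bang hG hcS hc
    · exact hs.bang hG hcS hc
  | .sub t u, h =>
    obtain ⟨y, T, T', _, hS, ht, hu⟩ := h.sub hG
    rw [hS] at hcS
    rcases hcS with hcS | hcS
    · exact ht.bang hG hcS hc
    · exact hu.bang hG hcS hc
end

/-- What hangs below an `m`-node is determined by the node. -/
theorem Val.Rep.eq_below (hG : G.IsTidy X) {v : Val} {ρ a S} (h : v.Rep G ρ a S) :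
    S = G.nw (G.below a) := by
  match v, h with
  | .var n, ⟨d, hd, hS⟩ =>
    subst hS
    have hda : a ∈ (G.shape d).mSources := by simp [hd, Shape.mSources]
    ext l
    constructor
    · rintro rfl
      exact ⟨.inl hda, Shape.not_isWeak_of_mSource hda⟩
    · rintro ⟨hl | ⟨p, x, b, hp, -⟩, -⟩
      · exact hG.mout hl hda
      · obtain rfl := hG.mout (l := p) (by simp [hp, Shape.mSources]) hda
        simp [hp] at hd
  | .lam t, ⟨p, x, b, hp, _, hS, ht⟩ =>
    subst hS
    have hpa : a ∈ (G.shape p).mSources := by simp [hp, Shape.mSources]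
    ext l
    constructor
    · rintro (rfl | h)
      · exact ⟨.inl hpa, Shape.not_isWeak_of_mSource hpa⟩
      · exact ⟨.inr ⟨p, x, b, hp, h.1⟩, h.2⟩
    · rintro ⟨hl | ⟨q, x', b', hq, hl⟩, hw⟩
      · exact .inl (hG.mout hl hpa)
      · obtain rfl := hG.mout (l := q) (by simp [hq, Shape.mSources]) hpa
        exact .inr ⟨hl, hw⟩

/-! ### Terms under a list of substitutions -/

/-- The links `T` represent the substitutions `L` in the environment `ρ`, and `ρ₀` is the
environment in their scope. -/
def PlugRep (G : Net) (ρ : ℕ → ℕ ⊕ G.E) : List Tm → (ℕ → ℕ ⊕ G.E) → Set G.Link → Prop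
  | [], ρ₀, T => ρ₀ = ρ ∧ T = ∅
  | u :: L, ρ₀, T => ∃ y ρ₁ T₁ T₂, Disjoint T₁ T₂ ∧ T = T₁ ∪ T₂ ∧ ρ₀ = cons y ρ₁ ∧
      u.Rep G ρ₁ y T₁ ∧ PlugRep G ρ L ρ₁ T₂

theorem PlugRep.env {ρ : ℕ → ℕ ⊕ G.E} {L : List Tm} {ρ₀ T} (h : PlugRep G ρ L ρ₀ T) (n : ℕ) :
    ρ₀ (n + L.length) = ρ n := by
  induction L generalizing ρ₀ T with
  | nil => rw [h.1]; rfl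
  | cons u L ih =>
    obtain ⟨y, ρ₁, T₁, T₂, _, _, rfl, _, h⟩ := h
    exact ih h

theorem Tm.Occ.plug (hG : G.IsTidy X) {L : List Tm} {t : Tm} {ρ r S}
    (h : (t.plug L).Occ G ρ r S) :
    ∃ ρ₀ S₀ T, Disjoint S₀ T ∧ S = S₀ ∪ T ∧ t.Occ G ρ₀ r S₀ ∧ PlugRep G ρ L ρ₀ T := by
  induction L generalizing t with
  | nil => exact ⟨ρ, S, ∅, by simp, by simp, h, rfl, rfl⟩
  | cons u L ih =>
    obtain ⟨ρ₁, S₁, T, hd, rfl, ht, hL⟩ := ih h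
    obtain ⟨y, S₀, T', hd', rfl, ht', hu⟩ := ht.sub hG
    rw [Set.disjoint_union_left] at hd
    refine ⟨cons y ρ₁, S₀, T' ∪ T, Set.disjoint_union_right.2 ⟨hd', hd.1⟩, Set.union_assoc _ _ _,
      ht', y, ρ₁, T', T, hd.2, rfl, rfl, hu.rep, hL⟩

theorem Tm.Rep.plug {L : List Tm} {t : Tm} {ρ ρ₀ r S₀ T} (ht : t.Rep G ρ₀ r S₀)
    (hL : PlugRep G ρ L ρ₀ T) (hd : Disjoint S₀ T) : (t.plug L).Rep G ρ r (S₀ ∪ T) := by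
  induction L generalizing t ρ₀ S₀ T with
  | nil =>
    obtain ⟨rfl, rfl⟩ := hL
    simpa [Tm.plug] using ht
  | cons u L ih =>
    obtain ⟨y, ρ₁, T₁, T₂, hd', rfl, rfl, hu, hL⟩ := hL
    rw [Set.disjoint_union_right] at hd
    rw [← Set.union_assoc]
    exact ih (t := .sub t u) ⟨y, S₀, T₁, hd.1, rfl, ht, hu⟩ hL
      (Set.disjoint_union_left.2 ⟨hd.2, hd'⟩)

theorem Tm.plug_append (t : Tm) (L L' : List Tm) : t.plug (L ++ L') = (t.plug L).plug L' := by
  induction L generalizing t with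
  | nil => rfl
  | cons u L ih => exact ih _

/-- A term whose root link is a `!`-link is a value under a list of substitutions. -/
theorem Tm.Occ.exists_plug (hG : G.IsTidy X) {t : Tm} {ρ r S} (h : t.Occ G ρ r S) {c a}
    (hc : G.shape c = .bang r a) : ∃ v L, t = (Tm.val v).plug L := by
  match t, h with
  | .val v, _ => exact ⟨v, [], rfl⟩
  | .app v s, h =>
    obtain ⟨d, a, y, T, T', hd, _⟩ := h.app hG
    obtain rfl := hG.eout (z := r) (l := c) (l' := d) (by simp [hc, Shape.eSources])
      (by simp [hd, Shape.eSources])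
    simp [hd] at hc
  | .sub t u, h =>
    obtain ⟨y, T, T', _, hS, ht, hu⟩ := h.sub hG
    obtain ⟨v, L, rfl⟩ := ht.exists_plug hG hc
    exact ⟨v, L ++ [u], by rw [Tm.plug_append]; rfl⟩

end Occ

/-! ### Simulations of nets and substitution -/

/-- Each link `l` of `G` corresponds to a set `h l` of links of `H`.  For the links outside `T` this
is a single link of the same shape up to the maps `f` and `g` on nodes. -/
structure Sim (G H : Net) (h : G.Link → Set H.Link) (f : ℕ ⊕ G.E → ℕ ⊕ H.E) (g : G.M → H.M)
    (T : Set G.Link) : Prop where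
  disj : ∀ {l l'}, l ≠ l' → Disjoint (h l) (h l')
  keep : ∀ l ∉ T, ¬ (G.shape l).IsWeak → ∃ l', h l = {l'} ∧
    H.shape l' = (G.shape l).map f g ∧
    ((G.shape l).IsPar → H.nw (H.box l') = ⋃ k ∈ G.nw (G.box l), h k)

section Sim

variable {G H : Net} {h : G.Link → Set H.Link} {f : ℕ ⊕ G.E → ℕ ⊕ H.E} {g : G.M → H.M}
  {T : Set G.Link}

theorem Sim.disjoint (hs : Sim G H h f g T) {S S' : Set G.Link} (hd : Disjoint S S') :
    Disjoint (⋃ l ∈ S, h l) (⋃ l ∈ S', h l) := by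
  simp only [Set.disjoint_iUnion_left, Set.disjoint_iUnion_right]
  intro l' hl' l hl
  exact hs.disj (by rintro rfl; exact Set.disjoint_left.1 hd hl hl')

theorem Sim.disjoint_singleton (hs : Sim G H h f g T) {S : Set G.Link} {l l'} (hl : l ∉ S)
    (hl' : h l = {l'}) : l' ∉ ⋃ k ∈ S, h k := by
  have := hs.disjoint (Set.disjoint_singleton_left.2 hl)
  simpa [hl'] using this

mutual
/-- Substitution lemma: under a simulation in which the touched derelictions on free variables are
replaced by the contents of the substituted values, a representation of a value becomes a
representation of its substitution instance. -/
theorem Val.Rep.subst (hs : Sim G H h f g T) {D : Set G.Link}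
    (hT : ∀ l ∈ D, l ∈ T → ∃ s z, G.shape l = .der s z ∧ z ∉ G.src D)
    {v : Val} {σ : ℕ → Val} {ρ ρ' a S} (hv : v.Rep G ρ a S) (hS : S ⊆ D)
    (hσ : ∀ n, ∀ d ∈ D, ∀ s, G.shape d = .der s (ρ n) → (σ n).Rep H ρ' (g s) (h d)) :
    (v.subst σ).Rep H ρ' (g a) (⋃ l ∈ S, h l) := by
  match v, hv with
  | .var n, ⟨d, hd, hS'⟩ =>
    subst hS'
    simpa [Val.subst] using hσ n d (hS rfl) a hd
  | .lam t, ⟨p, x, b, hp, hpp, hS', ht⟩ =>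
    subst hS'
    have hpD : p ∈ D := hS (.inl rfl)
    have hpT : p ∉ T := fun hpT => by
      obtain ⟨s, z, h1, _⟩ := hT p hpD hpT
      simp [hp] at h1
    obtain ⟨p', hp', hsh, hbox⟩ := hs.keep p hpT (by simp [hp, Shape.IsWeak])
    have hbox := hbox ⟨_, _, _, hp⟩
    rw [hp, Shape.map] at hsh
    have hn : p' ∉ ⋃ k ∈ G.nw (G.box p), h k := hs.disjoint_singleton (fun h => hpp h.1) hp'
    refine ⟨p', f x, f b, hsh, fun hmem => hn ?_, ?_, ?_⟩
    · rw [← hbox]; exact ⟨hmem, by simp [hsh, Shape.IsWeak]⟩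
    · rw [hbox, Set.biUnion_insert, hp']; rfl
    · rw [hbox]
      refine Tm.Rep.subst hs hT ht ((Set.subset_insert _ _).trans hS) ?_
      rintro (_ | n) d hd s hds
      · have hdT : d ∉ T := fun hdT => by
          obtain ⟨s', z, h1, h2⟩ := hT d hd hdT
          obtain ⟨-, rfl⟩ : s = s' ∧ x = z := by simpa [hds, cons] using h1
          exact h2 ⟨p, hpD, by simp [hp, Shape.eSources]⟩
        obtain ⟨d', hd', hsh, -⟩ := hs.keep d hdT (by simp [hds, Shape.IsWeak])
        exact ⟨d', by simp [hsh, hds, Shape.map, cons], hd'⟩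
      · exact Val.rep_rename.2 (hσ n d hd s hds)
/-- Substitution lemma: under a simulation in which the touched derelictions on free variables are
replaced by the contents of the substituted values, a representation of a term becomes a
representation of its substitution instance. -/
theorem Tm.Rep.subst (hs : Sim G H h f g T) {D : Set G.Link}
    (hT : ∀ l ∈ D, l ∈ T → ∃ s z, G.shape l = .der s z ∧ z ∉ G.src D)
    {t : Tm} {σ : ℕ → Val} {ρ ρ' r S} (ht : t.Rep G ρ r S) (hS : S ⊆ D)
    (hσ : ∀ n, ∀ d ∈ D, ∀ s, G.shape d = .der s (ρ n) → (σ n).Rep H ρ' (g s) (h d)) :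
    (t.subst σ).Rep H ρ' (f r) (⋃ l ∈ S, h l) := by
  match t, ht with
  | .val v, ⟨c, a, U, hc, hcU, hS', hv⟩ =>
    subst hS'
    have hcD : c ∈ D := hS (.inl rfl)
    have hcT : c ∉ T := fun hcT => by
      obtain ⟨s, z, h1, _⟩ := hT c hcD hcT
      simp [hc] at h1
    obtain ⟨c', hc', hsh, -⟩ := hs.keep c hcT (by simp [hc, Shape.IsWeak])
    rw [hc, Shape.map] at hsh
    refine ⟨c', g a, _, hsh, hs.disjoint_singleton hcU hc', by rw [Set.biUnion_insert, hc']; rfl,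
      Val.Rep.subst hs hT hv ((Set.subset_insert _ _).trans hS) hσ⟩
  | .app v s, ⟨c, a, y, U, U', hc, hcU, hcU', hd, hS', hv, hs'⟩ =>
    subst hS'
    have hcD : c ∈ D := hS (.inl rfl)
    have hcT : c ∉ T := fun hcT => by
      obtain ⟨s, z, h1, _⟩ := hT c hcD hcT
      simp [hc] at h1
    obtain ⟨c', hc', hsh, -⟩ := hs.keep c hcT (by simp [hc, Shape.IsWeak])
    rw [hc, Shape.map] at hsh
    refine ⟨c', g a, f y, _, _, hsh, hs.disjoint_singleton hcU hc',
      hs.disjoint_singleton hcU' hc', hs.disjoint hd,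
      by rw [Set.biUnion_insert, Set.biUnion_union, hc']; rfl,
      Val.Rep.subst hs hT hv (fun _ h => hS (.inr (.inl h))) hσ,
      Tm.Rep.subst hs hT hs' (fun _ h => hS (.inr (.inr h))) hσ⟩
  | .sub t u, ⟨y, U, U', hd, hS', ht', hu⟩ =>
    subst hS'
    refine ⟨f y, _, _, hs.disjoint hd, Set.biUnion_union _ _ _,
      Tm.Rep.subst hs hT ht' (fun _ h => hS (.inl h)) ?_,
      Tm.Rep.subst hs hT hu (fun _ h => hS (.inr h)) hσ⟩
    rintro (_ | n) d hdD s hds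
    · have hdT : d ∉ T := fun hdT => by
        obtain ⟨s', z, h1, h2⟩ := hT d hdD hdT
        obtain ⟨-, rfl⟩ : s = s' ∧ y = z := by simpa [hds, cons] using h1
        obtain ⟨k, hk, h3, _⟩ := hu.root
        exact h2 ⟨k, hS (.inr hk), h3⟩
      obtain ⟨d', hd', hsh, -⟩ := hs.keep d hdT (by simp [hds, Shape.IsWeak])
      exact ⟨d', by simp [hsh, hds, Shape.map, cons], hd'⟩
    · exact Val.rep_rename.2 (hσ n d hdD s hds)
end

theorem liftSubst_var : liftSubst Val.var = Val.var := by
  funext n; cases n <;> rfl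

mutual
theorem Val.subst_var (v : Val) : v.subst Val.var = v := by
  cases v with
  | var n => rfl
  | lam t => rw [Val.subst, liftSubst_var, Tm.subst_var]
theorem Tm.subst_var (t : Tm) : t.subst Val.var = t := by
  cases t with
  | val v => rw [Tm.subst, Val.subst_var]
  | app v s => rw [Tm.subst, Val.subst_var, Tm.subst_var]
  | sub t u => rw [Tm.subst, liftSubst_var, Tm.subst_var, Tm.subst_var]
end

theorem Sim.rep_var (hs : Sim G H h f g T) {D : Set G.Link} (hT : Disjoint D T)
    (ρ : ℕ → ℕ ⊕ G.E) : ∀ n, ∀ d ∈ D, ∀ s, G.shape d = .der s (ρ n) →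
      (Val.var n).Rep H (f ∘ ρ) (g s) (h d) := by
  intro n d hd s hds
  obtain ⟨d', hd', hsh, -⟩ := hs.keep d (Set.disjoint_left.1 hT hd) (by simp [hds, Shape.IsWeak])
  exact ⟨d', by simp [hsh, hds, Shape.map], hd'⟩

theorem Val.Rep.transport (hs : Sim G H h f g T) {v : Val} {ρ a S} (hv : v.Rep G ρ a S)
    (hT : Disjoint S T) : v.Rep H (f ∘ ρ) (g a) (⋃ l ∈ S, h l) := by
  have := Val.Rep.subst hs (D := S) (fun l hl hlT => (Set.disjoint_left.1 hT hl hlT).elim) hv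
    subset_rfl (hs.rep_var hT ρ)
  rwa [Val.subst_var] at this

theorem Tm.Rep.transport (hs : Sim G H h f g T) {t : Tm} {ρ r S} (ht : t.Rep G ρ r S)
    (hT : Disjoint S T) : t.Rep H (f ∘ ρ) (f r) (⋃ l ∈ S, h l) := by
  have := Tm.Rep.subst hs (D := S) (fun l hl hlT => (Set.disjoint_left.1 hT hl hlT).elim) ht
    subset_rfl (hs.rep_var hT ρ)
  rwa [Tm.subst_var] at this

theorem PlugRep.transport (hs : Sim G H h f g T) {ρ : ℕ → ℕ ⊕ G.E} {L : List Tm} {ρ₀ S}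
    (hL : PlugRep G ρ L ρ₀ S) (hT : Disjoint S T) :
    PlugRep H (f ∘ ρ) L (f ∘ ρ₀) (⋃ l ∈ S, h l) := by
  induction L generalizing ρ₀ S with
  | nil => obtain ⟨rfl, rfl⟩ := hL; exact ⟨rfl, by simp⟩
  | cons u L ih =>
    obtain ⟨y, ρ₁, T₁, T₂, hd, rfl, rfl, hu, hL⟩ := hL
    rw [Set.disjoint_union_left] at hT
    exact ⟨f y, f ∘ ρ₁, _, _, hs.disjoint hd, Set.biUnion_union _ _ _, comp_cons _ _ _,
      hu.transport hs hT.1, ih hL hT.2⟩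

end Sim

/-! ### Reduction in contexts -/

section Red

variable {G H : Net} {X : Set ℕ} {i : Mode} {h : G.Link → Set H.Link} {f : ℕ ⊕ G.E → ℕ ⊕ H.E}
  {g : G.M → H.M} {T : Set G.Link}

/-- The term `t` reduces to `t'`, and `t'` is represented in `H` by the links that correspond to
the representation `S` of `t` in `G`. -/
def Red (G H : Net) (i : Mode) (h : G.Link → Set H.Link) (f : ℕ ⊕ G.E → ℕ ⊕ H.E) (t t' : Tm)
    (ρ : ℕ → ℕ ⊕ G.E) (r : ℕ ⊕ G.E) (S : Set G.Link) : Prop :=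
  t.Step i t' ∧ t'.Rep H (f ∘ ρ) (f r) (⋃ l ∈ S, h l)

/-- The analogue of `Red` for the bodies of abstractions. -/
def RedVal (G H : Net) (i : Mode) (h : G.Link → Set H.Link) (f : ℕ ⊕ G.E → ℕ ⊕ H.E)
    (g : G.M → H.M) (v v' : Val) (ρ : ℕ → ℕ ⊕ G.E) (a : G.M) (S : Set G.Link) : Prop :=
  (∃ t t', v = .lam t ∧ v' = .lam t' ∧ t.Step i t') ∧ v'.Rep H (f ∘ ρ) (g a) (⋃ l ∈ S, h l)

theorem Red.lam (hs : Sim G H h f g T) {p a x b t t' ρ} (hp : G.shape p = .par a x b)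
    (hpp : p ∉ G.box p) (hT : T ⊆ G.nw (G.box p))
    (hr : Red G H i h f t t' (cons x ρ) b (G.nw (G.box p))) :
    RedVal G H i h f g (.lam t) (.lam t') ρ a (insert p (G.nw (G.box p))) := by
  obtain ⟨p', hp', hsh, hbox⟩ := hs.keep p (fun h => hpp (hT h).1) (by simp [hp, Shape.IsWeak])
  have hbox := hbox ⟨_, _, _, hp⟩
  rw [hp, Shape.map] at hsh
  have hn : p' ∉ ⋃ k ∈ G.nw (G.box p), h k := hs.disjoint_singleton (fun h => hpp h.1) hp'
  refine ⟨⟨t, t', rfl, rfl, hr.1⟩, p', f x, f b, hsh, fun hmem => hn ?_, ?_, ?_⟩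
  · rw [← hbox]; exact ⟨hmem, by simp [hsh, Shape.IsWeak]⟩
  · rw [hbox, Set.biUnion_insert, hp']; rfl
  · rw [hbox, ← comp_cons]; exact hr.2

theorem Red.val (hs : Sim G H h f g T) {c r a v v' ρ U} (hc : G.shape c = .bang r a)
    (hcU : c ∉ U) (hT : T ⊆ U) (hr : RedVal G H i h f g v v' ρ a U) :
    Red G H i h f (.val v) (.val v') ρ r (insert c U) := by
  obtain ⟨⟨t, t', rfl, rfl, hst⟩, hv⟩ := hr
  obtain ⟨c', hc', hsh, -⟩ := hs.keep c (fun h => hcU (hT h)) (by simp [hc, Shape.IsWeak])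
  rw [hc, Shape.map] at hsh
  exact ⟨.lam hst, c', g a, _, hsh, hs.disjoint_singleton hcU hc',
    by rw [Set.biUnion_insert, hc']; rfl, hv⟩

theorem Red.appFun (hs : Sim G H h f g T) {c r a y v v' s ρ U U'} (hc : G.shape c = .tensor r a y)
    (hcU : c ∉ U) (hcU' : c ∉ U') (hd : Disjoint U U') (hT : T ⊆ U)
    (hr : RedVal G H i h f g v v' ρ a U) (hs' : s.Rep G ρ y U') :
    Red G H i h f (.app v s) (.app v' s) ρ r (insert c (U ∪ U')) := by
  obtain ⟨⟨t, t', rfl, rfl, hst⟩, hv⟩ := hr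
  obtain ⟨c', hc', hsh, -⟩ := hs.keep c (fun h => hcU (hT h)) (by simp [hc, Shape.IsWeak])
  rw [hc, Shape.map] at hsh
  exact ⟨.appFun s hst, c', g a, f y, _, _, hsh, hs.disjoint_singleton hcU hc',
    hs.disjoint_singleton hcU' hc', hs.disjoint hd,
    by rw [Set.biUnion_insert, Set.biUnion_union, hc']; rfl, hv,
    hs'.transport hs (hd.symm.mono_right hT)⟩

theorem Red.appArg (hs : Sim G H h f g T) {c r a y v s s' ρ U U'} (hc : G.shape c = .tensor r a y)
    (hcU : c ∉ U) (hcU' : c ∉ U') (hd : Disjoint U U') (hT : T ⊆ U')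
    (hv : v.Rep G ρ a U) (hr : Red G H i h f s s' ρ y U') :
    Red G H i h f (.app v s) (.app v s') ρ r (insert c (U ∪ U')) := by
  obtain ⟨c', hc', hsh, -⟩ := hs.keep c (fun h => hcU' (hT h)) (by simp [hc, Shape.IsWeak])
  rw [hc, Shape.map] at hsh
  exact ⟨.appArg v hr.1, c', g a, f y, _, _, hsh, hs.disjoint_singleton hcU hc',
    hs.disjoint_singleton hcU' hc', hs.disjoint hd,
    by rw [Set.biUnion_insert, Set.biUnion_union, hc']; rfl,
    hv.transport hs (hd.mono_right hT), hr.2⟩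

theorem Red.subBody (hs : Sim G H h f g T) {y r t t' u ρ U U'} (hd : Disjoint U U') (hT : T ⊆ U)
    (hr : Red G H i h f t t' (cons y ρ) r U) (hu : u.Rep G ρ y U') :
    Red G H i h f (.sub t u) (.sub t' u) ρ r (U ∪ U') :=
  ⟨.subBody u hr.1, f y, _, _, hs.disjoint hd, Set.biUnion_union _ _ _,
    by rw [← comp_cons]; exact hr.2, hu.transport hs (hd.symm.mono_right hT)⟩

theorem Red.subArg (hs : Sim G H h f g T) {y r t u u' ρ U U'} (hd : Disjoint U U') (hT : T ⊆ U')
    (ht : t.Rep G (cons y ρ) r U) (hr : Red G H i h f u u' ρ y U') :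
    Red G H i h f (.sub t u) (.sub t u') ρ r (U ∪ U') :=
  ⟨.subArg t hr.1, f y, _, _, hs.disjoint hd, Set.biUnion_union _ _ _,
    by rw [← comp_cons]; exact ht.transport hs (hd.mono_right hT), hr.2⟩

/-! ### Multiplicative steps -/

/-- What the multiplicative rule on a `⊗`-link `c` and a `⅋`-link `p` does to a net. -/
structure MultSim (G H : Net) (h : G.Link → Set H.Link) (f : ℕ ⊕ G.E → ℕ ⊕ H.E) (g : G.M → H.M)
    (c p : G.Link) (r y x b : ℕ ⊕ G.E) : Prop extends Sim G H h f g {c, p} where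
  erase_tensor : h c = ∅
  erase_par : h p = ∅
  f_var : f x = f y
  f_box : f b = f r

/-- Simulation of a root multiplicative step: the two cut links disappear, and because `x` is merged
with `y` and `b` with `r`, the links of the body and of the argument represent `t[x/u]`. -/
theorem MultSim.base {c p : G.Link} {r y x b : ℕ ⊕ G.E} (hM : MultSim G H h f g c p r y x b)
    {t u : Tm} {ρ} (hpp : p ∉ G.box p) {U' : Set G.Link} (hpU' : p ∉ U') (hcU : c ∉ G.box p)
    (hcU' : c ∉ U') (hd : Disjoint (G.nw (G.box p)) U')
    (ht : t.Rep G (cons x ρ) b (G.nw (G.box p))) (hu : u.Rep G ρ y U') :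
    Red G H .m h f (.app (.lam t) u) (.sub t u) ρ r
      (insert c (insert p (G.nw (G.box p)) ∪ U')) := by
  refine ⟨.mult t u, f y, ⋃ l ∈ G.nw (G.box p), h l, ⋃ l ∈ U', h l, hM.disjoint hd, ?_, ?_, ?_⟩
  · rw [Set.biUnion_insert, Set.biUnion_union, Set.biUnion_insert, hM.erase_tensor, hM.erase_par,
      Set.empty_union, Set.empty_union]
  · rw [← hM.f_var, ← hM.f_box, ← comp_cons]
    refine ht.transport hM.toSim (Set.disjoint_right.2 ?_)
    rintro l (rfl | rfl) hl
    · exact hcU hl.1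
    · exact hpp hl.1
  · refine hu.transport hM.toSim (Set.disjoint_right.2 ?_)
    rintro l (rfl | rfl) hl
    · exact hcU' hl
    · exact hpU' hl

/-- A set of links that is closed under passing to the link below an `m`-node contains both cut links
if it contains the `⊗`-link. -/
theorem mult_touched (hG : G.IsTidy X) {c p : G.Link} {r a y x b}
    (hc : G.shape c = .tensor r a y) (hp : G.shape p = .par a x b) {S : Set G.Link} (hcS : c ∈ S)
    (hS : ∀ {l m}, l ∈ S → m ∈ (G.shape l).mTargets → ∃ k ∈ S, m ∈ (G.shape k).mSources) :
    {c, p} ⊆ S := by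
  obtain ⟨k, hk, hak⟩ := hS hcS (m := a) (by simp [hc, Shape.mTargets])
  obtain rfl := hG.mout (l := p) (by simp [hp, Shape.mSources]) hak
  rintro l (rfl | rfl)
  · exact hcS
  · exact hk

mutual
/-- Every multiplicative cut in the representation of a value comes from a redex. -/
theorem MultSim.exists_redVal (hG : G.IsTidy X) {c p : G.Link} {r a y x b}
    (hM : MultSim G H h f g c p r y x b) (hc : G.shape c = .tensor r a y)
    (hp : G.shape p = .par a x b) {v : Val} {ρ a' S} (hv : v.Occ G ρ a' S) (hcS : c ∈ S) :
    ∃ v', RedVal G H .m h f g v v' ρ a' S := by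
  match v, hv with
  | .var n, ⟨⟨d, hd, hS⟩, _, _⟩ => subst hS; obtain rfl := hcS; simp [hc] at hd
  | .lam t, hv =>
    obtain ⟨q, x', b', hq, hqq, rfl, ht, _⟩ := hv.lam hG
    rcases hcS with rfl | hcS
    · simp [hc] at hq
    obtain ⟨t', ht'⟩ := MultSim.exists_red hG hM hc hp ht hcS
    exact ⟨_, ht'.lam hM.toSim hq hqq (mult_touched hG hc hp hcS ht.rep.m_source)⟩
/-- Every multiplicative cut in the representation of a term comes from a redex. -/
theorem MultSim.exists_red (hG : G.IsTidy X) {c p : G.Link} {r a y x b}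
    (hM : MultSim G H h f g c p r y x b) (hc : G.shape c = .tensor r a y)
    (hp : G.shape p = .par a x b) {t : Tm} {ρ r' S} (ht : t.Occ G ρ r' S) (hcS : c ∈ S) :
    ∃ t', Red G H .m h f t t' ρ r' S := by
  match t, ht with
  | .val v, ht =>
    obtain ⟨d, a', U, hd, hdU, rfl, hv⟩ := ht.val hG
    rcases hcS with rfl | hcS
    · simp [hc] at hd
    obtain ⟨v', hv'⟩ := MultSim.exists_redVal hG hM hc hp hv hcS
    exact ⟨_, Red.val hM.toSim hd hdU (mult_touched hG hc hp hcS hv.rep.m_source) hv'⟩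
  | .app v s, ht =>
    obtain ⟨d, a', y', U, U', hd, hdU, hdU', hdis, rfl, hv, hs⟩ := ht.app hG
    rcases hcS with rfl | hcS | hcS
    · obtain ⟨rfl, rfl, rfl⟩ : r = r' ∧ a = a' ∧ y = y' := by simpa [hc] using hd
      match v, hv with
      | .var n, ⟨⟨d, hd, hS⟩, _, _⟩ =>
        obtain rfl := hG.mout (a := a) (l := d) (l' := p) (by simp [hd, Shape.mSources])
          (by simp [hp, Shape.mSources])
        simp [hd] at hp
      | .lam t, hv =>
        obtain ⟨q, x', b', hq, hqq, rfl, hb, _⟩ := hv.lam hG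
        obtain rfl := hG.mout (a := a) (l := q) (l' := p) (by simp [hq, Shape.mSources])
          (by simp [hp, Shape.mSources])
        obtain ⟨rfl, rfl⟩ : x = x' ∧ b = b' := by simpa [hp] using hq
        rw [Set.disjoint_insert_left] at hdis
        exact ⟨_, hM.base hqq hdis.1 (fun h => hdU (.inr ⟨h, by simp [hc, Shape.IsWeak]⟩)) hdU'
          hdis.2 hb.rep hs.rep⟩
    · obtain ⟨v', hv'⟩ := MultSim.exists_redVal hG hM hc hp hv hcS
      exact ⟨_, Red.appFun hM.toSim hd hdU hdU' hdis
        (mult_touched hG hc hp hcS hv.rep.m_source) hv' hs.rep⟩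
    · obtain ⟨s', hs'⟩ := MultSim.exists_red hG hM hc hp hs hcS
      exact ⟨_, Red.appArg hM.toSim hd hdU hdU' hdis
        (mult_touched hG hc hp hcS hs.rep.m_source) hv.rep hs'⟩
  | .sub t u, ht =>
    obtain ⟨y', U, U', hdis, rfl, ht, hu⟩ := ht.sub hG
    rcases hcS with hcS | hcS
    · obtain ⟨t', ht'⟩ := MultSim.exists_red hG hM hc hp ht hcS
      exact ⟨_, Red.subBody hM.toSim hdis (mult_touched hG hc hp hcS ht.rep.m_source) ht' hu.rep⟩
    · obtain ⟨u', hu'⟩ := MultSim.exists_red hG hM hc hp hu hcS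
      exact ⟨_, Red.subArg hM.toSim hdis (mult_touched hG hc hp hcS hu.rep.m_source) ht.rep hu'⟩
end

/-! ### Exponential steps -/

/-- The links that are not weakenings and take part in an exponential step on a `!`-link `c` from
`x` to `a`. -/
def Net.expTouched (G : Net) (c : G.Link) (x : ℕ ⊕ G.E) (a : G.M) : Set G.Link :=
  insert c (G.nw (G.below a) ∪ {l | ∃ s, G.shape l = .der s x})

/-- What the exponential rules on a `!`-link `c` from `x` to `a` do to a net: the content of the
value below `a` is erased, and each dereliction on `x` is replaced by a copy of it.  The rule for
weakenings is the case where `x` has no derelictions. -/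
structure ExpSim (G H : Net) (h : G.Link → Set H.Link) (f : ℕ ⊕ G.E → ℕ ⊕ H.E) (g : G.M → H.M)
    (c : G.Link) (x : ℕ ⊕ G.E) (a : G.M) : Prop extends Sim G H h f g (G.expTouched c x a) where
  erase_bang : h c = ∅
  erase_below : ∀ l ∈ G.nw (G.below a), h l = ∅
  copy : ∀ (d : G.Link) (s : G.M) (v : Val) (ρ : ℕ → ℕ ⊕ G.E), G.shape d = .der s x →
    v.Occ G ρ a (G.nw (G.below a)) → v.Rep H (f ∘ ρ) (g s) (h d)

/-- No link of an occurrence has the root of the occurrence as target. -/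
theorem Tm.Occ.root_not_target (hG : G.IsTidy X) {t : Tm} {ρ r S} (ht : t.Occ G ρ r S) {l}
    (hl : l ∈ S) : r ∉ (G.shape l).eTargets := by
  intro hz
  have hr : r ∈ G.src S := by
    obtain ⟨k, hk, h1, _⟩ := ht.rep.root
    exact ⟨k, hk, h1⟩
  match t, ht with
  | .val v, ht =>
    obtain ⟨d, a, U, hd, hdU, rfl, hv⟩ := ht.val hG
    rcases hl with rfl | hl
    · simp [hd, Shape.eTargets] at hz
    rcases hv.rep.target hl hz with ⟨_, n, rfl⟩ | ⟨k, hk, hz'⟩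
    · exact ht.env n hr
    · exact hdU (hG.eout (l := d) (by simp [hd, Shape.eSources]) hz' ▸ hk)
  | .app v s, ht =>
    obtain ⟨d, a, y, U, U', hd, hdU, hdU', hdis, rfl, hv, hs⟩ := ht.app hG
    rcases hl with rfl | hl | hl
    · simp only [hd, Shape.eTargets, Set.mem_singleton_iff] at hz
      obtain ⟨k, hk, h1, _⟩ := hs.rep.root
      exact hdU' (hG.eout (l := l) (by simp [hd, Shape.eSources]) (hz ▸ h1) ▸ hk)
    · rcases hv.rep.target hl hz with ⟨_, n, rfl⟩ | ⟨k, hk, hz'⟩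
      · exact ht.env n hr
      · exact hdU (hG.eout (l := d) (by simp [hd, Shape.eSources]) hz' ▸ hk)
    · rcases hs.rep.target hl hz with ⟨_, n, rfl⟩ | ⟨k, hk, hz'⟩
      · exact ht.env n hr
      · exact hdU' (hG.eout (l := d) (by simp [hd, Shape.eSources]) hz' ▸ hk)
  | .sub t u, ht =>
    obtain ⟨y, U, U', hdis, rfl, ht', hu⟩ := ht.sub hG
    rcases hl with hl | hl
    · exact ht'.root_not_target hG hl hz
    rcases hu.rep.target hl hz with ⟨_, n, rfl⟩ | hz'
    · exact ht.env n hr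
    · obtain ⟨k, hk, h1, _⟩ := ht'.rep.root
      exact hG.src_disjoint hdis ⟨k, hk, h1⟩ hz'

/-- Simulation of a root exponential step.  The `!`-link is that of the value `v` under the list `L`
of substitutions, so the copies of the content of `v` lie in the scope of `L`, which stays. -/
theorem ExpSim.base (hG : G.IsTidy X) {c : G.Link} {x : ℕ ⊕ G.E} {a : G.M}
    (hE : ExpSim G H h f g c x a) (hc : G.shape c = .bang x a) {t : Tm} {v : Val} {L : List Tm}
    {ρ r} {U U' : Set G.Link} (hd : Disjoint U U') (ht : t.Occ G (cons x ρ) r U)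
    (hu : ((Tm.val v).plug L).Occ G ρ x U') :
    Red G H .e h f (.sub t ((Tm.val v).plug L)) ((t.subst (instSubst v L.length)).plug L) ρ r
        (U ∪ U') := by
  obtain ⟨ρ₀, S₀, T₀, hd₀, rfl, hv, hL⟩ := hu.plug hG
  obtain ⟨c', a', V, hc', hcV, rfl, hv⟩ := hv.val hG
  obtain rfl := hG.eout (z := x) (l := c) (l' := c') (by simp [hc, Shape.eSources])
    (by simp [hc', Shape.eSources])
  obtain rfl : a = a' := by simpa [hc] using hc'
  obtain rfl := hv.rep.eq_below hG
  have hx : x ∈ G.src (insert c (G.nw (G.below a)) ∪ T₀) :=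
    ⟨c, by simp, by simp [hc, Shape.eSources]⟩
  have hU : ∀ l ∈ U, l ∈ G.expTouched c x a → ∃ s, G.shape l = .der s x := by
    rintro l hl (rfl | hlb | hs)
    · exact (Set.disjoint_left.1 hd hl (by simp)).elim
    · exact (Set.disjoint_left.1 hd hl (by simp [hlb])).elim
    · exact hs
  have ht' : (t.subst (instSubst v L.length)).Rep H (f ∘ ρ₀) (f r) (⋃ l ∈ U, h l) := by
    refine ht.rep.subst hE.toSim (D := U) (fun l hl hlT => ?_) subset_rfl ?_
    · obtain ⟨s, hs⟩ := hU l hl hlT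
      exact ⟨s, x, hs, fun hx' => hG.src_disjoint hd hx' hx⟩
    · rintro (_ | n) d hdU s hds
      · exact hE.copy d s v ρ₀ hds hv
      · have hdT : d ∉ G.expTouched c x a := fun hdT => by
          obtain ⟨s', hs'⟩ := hU d hdU hdT
          obtain ⟨-, hρ⟩ : s = s' ∧ ρ n = x := by simpa [hds, cons] using hs'
          exact hu.env n (hρ ▸ hx)
        obtain ⟨d', hd', hsh, -⟩ := hE.keep d hdT (by simp [hds, Shape.IsWeak])
        exact ⟨d', by simp [hsh, hds, Shape.map, cons, hL.env], hd'⟩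
  have hT₀ : Disjoint T₀ (G.expTouched c x a) := by
    rw [Set.disjoint_right]
    rintro l (rfl | hlb | ⟨s, hs⟩) hl
    · exact Set.disjoint_left.1 hd₀ (.inl rfl) hl
    · exact Set.disjoint_left.1 hd₀ (.inr hlb) hl
    · exact hu.root_not_target hG (.inr hl) (by simp [hs, Shape.eTargets])
  have hdis := hE.disjoint (hd.mono_right (Set.subset_union_right (t := T₀)))
  have h0 : ⋃ l ∈ G.nw (G.below a), h l = ∅ := by
    simp only [Set.iUnion_eq_empty]; exact hE.erase_below
  refine ⟨.exp t v L, ?_⟩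
  rw [Set.biUnion_union, Set.biUnion_union, Set.biUnion_insert, hE.erase_bang, h0,
    Set.empty_union, Set.empty_union]
  exact ht'.plug (hL.transport hE.toSim hT₀) hdis

/-- A set of links that contains the cut `!`-link and is not entered at the cut node contains all links
that take part in the exponential step. -/
theorem exp_touched (hG : G.IsTidy X) {c : G.Link} {x : ℕ ⊕ G.E} {a : G.M}
    (hc : G.shape c = .bang x a) {S : Set G.Link} (hcS : c ∈ S)
    (hm : ∀ {l m}, l ∈ S → m ∈ (G.shape l).mTargets → ∃ k ∈ S, m ∈ (G.shape k).mSources)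
    (hb : ∀ {p}, p ∈ S → (G.shape p).IsPar → G.nw (G.box p) ⊆ S)
    (hx : ¬ G.Entered S x) : G.expTouched c x a ⊆ S := by
  obtain ⟨k, hk, hak⟩ := hm hcS (m := a) (by simp [hc, Shape.mTargets])
  rintro l (rfl | ⟨hl | ⟨p, y, b, hp, hl⟩, hw⟩ | ⟨s, hs⟩)
  · exact hcS
  · exact hG.mout hak hl ▸ hk
  · obtain rfl := hG.mout (l := p) (by simp [hp, Shape.mSources]) hak
    exact hb hk ⟨_, _, _, hp⟩ ⟨hl, hw⟩
  · by_contra hl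
    exact hx (.inr ⟨l, hl, by simp [hs, Shape.IsWeak], by simp [hs, Shape.eTargets]⟩)

theorem Val.Occ.exp_touched (hG : G.IsTidy X) {c : G.Link} {x : ℕ ⊕ G.E} {a : G.M}
    (hc : G.shape c = .bang x a) {v : Val} {ρ a' S} (hv : v.Occ G ρ a' S) (hcS : c ∈ S) :
    G.expTouched c x a ⊆ S :=
  VKer.exp_touched hG hc hcS hv.rep.m_source hv.rep.box_subset
    (hv.outer x ⟨c, hcS, by simp [hc, Shape.eSources]⟩)

theorem Tm.Occ.exp_touched (hG : G.IsTidy X) {c : G.Link} {x : ℕ ⊕ G.E} {a : G.M}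
    (hc : G.shape c = .bang x a) {t : Tm} {ρ r S} (ht : t.Occ G ρ r S) (hcS : c ∈ S)
    (hx : x ≠ r) : G.expTouched c x a ⊆ S :=
  VKer.exp_touched hG hc hcS ht.rep.m_source ht.rep.box_subset
    fun he => hx (ht.outer x ⟨c, hcS, by simp [hc, Shape.eSources]⟩ he)

mutual
/-- Every exponential cut in the representation of a value comes from a redex. -/
theorem ExpSim.exists_redVal (hG : G.IsTidy X) {c : G.Link} {x : ℕ ⊕ G.E} {a : G.M}
    (hE : ExpSim G H h f g c x a) (hc : G.shape c = .bang x a)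
    (hx : ∀ l, x ∈ (G.shape l).eTargets → (G.shape l).IsDer ∨ (G.shape l).IsWeak) {v : Val}
    {ρ a' S} (hv : v.Occ G ρ a' S) (hcS : c ∈ S) : ∃ v', RedVal G H .e h f g v v' ρ a' S := by
  match v, hv with
  | .var n, ⟨⟨d, hd, hS⟩, _, _⟩ => subst hS; obtain rfl := hcS; simp [hc] at hd
  | .lam t, hv =>
    obtain ⟨q, x', b', hq, hqq, rfl, ht, _⟩ := hv.lam hG
    rcases hcS with rfl | hcS
    · simp [hc] at hq
    have hxb : x ≠ b' := by
      rintro rfl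
      rcases hx q (by simp [hq, Shape.eTargets]) with h | h <;>
        simp [hq, Shape.IsDer, Shape.IsWeak] at h
    obtain ⟨t', ht'⟩ := ExpSim.exists_red hG hE hc hx ht hcS hxb
    exact ⟨_, ht'.lam hE.toSim hq hqq (ht.exp_touched hG hc hcS hxb)⟩
/-- Every exponential cut in the representation of a term comes from a redex, unless it is on the
root of the term. -/
theorem ExpSim.exists_red (hG : G.IsTidy X) {c : G.Link} {x : ℕ ⊕ G.E} {a : G.M}
    (hE : ExpSim G H h f g c x a) (hc : G.shape c = .bang x a)
    (hx : ∀ l, x ∈ (G.shape l).eTargets → (G.shape l).IsDer ∨ (G.shape l).IsWeak) {t : Tm}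
    {ρ r S} (ht : t.Occ G ρ r S) (hcS : c ∈ S) (hxr : x ≠ r) : ∃ t', Red G H .e h f t t' ρ r S := by
  match t, ht with
  | .val v, ht =>
    obtain ⟨d, a', U, hd, hdU, rfl, hv⟩ := ht.val hG
    rcases hcS with rfl | hcS
    · obtain ⟨rfl, -⟩ : x = r ∧ a = a' := by simpa [hc] using hd
      exact (hxr rfl).elim
    obtain ⟨v', hv'⟩ := ExpSim.exists_redVal hG hE hc hx hv hcS
    exact ⟨_, Red.val hE.toSim hd hdU (hv.exp_touched hG hc hcS) hv'⟩
  | .app v s, ht =>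
    obtain ⟨d, a', y', U, U', hd, hdU, hdU', hdis, rfl, hv, hs⟩ := ht.app hG
    rcases hcS with rfl | hcS | hcS
    · simp [hc] at hd
    · obtain ⟨v', hv'⟩ := ExpSim.exists_redVal hG hE hc hx hv hcS
      exact ⟨_, Red.appFun hE.toSim hd hdU hdU' hdis (hv.exp_touched hG hc hcS) hv' hs.rep⟩
    · have hxy : x ≠ y' := by
        rintro rfl
        rcases hx d (by simp [hd, Shape.eTargets]) with h | h <;>
          simp [hd, Shape.IsDer, Shape.IsWeak] at h
      obtain ⟨s', hs'⟩ := ExpSim.exists_red hG hE hc hx hs hcS hxy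
      exact ⟨_, Red.appArg hE.toSim hd hdU hdU' hdis (hs.exp_touched hG hc hcS hxy) hv.rep hs'⟩
  | .sub t u, ht =>
    obtain ⟨y, U, U', hdis, rfl, hb, hu⟩ := ht.sub hG
    rcases hcS with hcS | hcS
    · obtain ⟨t', ht'⟩ := ExpSim.exists_red hG hE hc hx hb hcS hxr
      exact ⟨_, Red.subBody hE.toSim hdis (hb.exp_touched hG hc hcS hxr) ht' hu.rep⟩
    · by_cases hxy : x = y
      · subst hxy
        obtain ⟨v, L, rfl⟩ := hu.exists_plug hG hc
        exact ⟨_, hE.base hG hc hdis hb hu⟩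
      · obtain ⟨u', hu'⟩ := ExpSim.exists_red hG hE hc hx hu hcS hxy
        exact ⟨_, Red.subArg hE.toSim hdis (hu.exp_touched hG hc hcS hxy) hb.rep hu'⟩
end

end Red

/-! ### Boxes of nets that represent terms -/

/-- The net `G` represents the term `t`, with the names in `X` as free variables. -/
structure Net.Denotes (G : Net) (t : Tm) (X : Set ℕ) : Prop where
  tidy : G.IsTidy X
  rep : t.Rep G Sum.inl (Sum.inr G.root) (G.nw Set.univ)

section Rep

variable {G : Net} {X : Set ℕ}

mutual
theorem Val.Rep.no_loop (hG : G.IsTidy X) {v : Val} {ρ a S} (h : v.Rep G ρ a S) {l z} (hl : l ∈ S)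
    (hz : z ∈ (G.shape l).eTargets) : z ∉ (G.shape l).eSources := by
  match v, h with
  | .var n, ⟨d, hd, hS⟩ => subst hS; obtain rfl := hl; simp [hd, Shape.eSources]
  | .lam t, ⟨p, x, b, hp, hpp, hS, ht⟩ =>
    subst hS
    rcases hl with rfl | hl
    · simp only [hp, Shape.eTargets, Set.mem_singleton_iff] at hz
      obtain ⟨k, hk, h1, _⟩ := ht.root
      exact fun hz' => hpp (hG.eout hz' (hz ▸ h1) ▸ hk.1)
    · exact ht.no_loop hG hl hz
/-- No link has the same exponential node as source and target. -/
theorem Tm.Rep.no_loop (hG : G.IsTidy X) {t : Tm} {ρ r S} (h : t.Rep G ρ r S) {l z} (hl : l ∈ S)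
    (hz : z ∈ (G.shape l).eTargets) : z ∉ (G.shape l).eSources := by
  match t, h with
  | .val v, ⟨c, a, T, hc, _, hS, hv⟩ =>
    subst hS
    rcases hl with rfl | hl
    · simp [hc, Shape.eTargets] at hz
    · exact hv.no_loop hG hl hz
  | .app v s, ⟨c, a, y, T, T', hc, _, hcT', _, hS, hv, hs⟩ =>
    subst hS
    rcases hl with rfl | hl | hl
    · simp only [hc, Shape.eTargets, Set.mem_singleton_iff] at hz
      obtain ⟨k, hk, h1, _⟩ := hs.root
      exact fun hz' => hcT' (hG.eout hz' (hz ▸ h1) ▸ hk)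
    · exact hv.no_loop hG hl hz
    · exact hs.no_loop hG hl hz
  | .sub t u, ⟨y, T, T', _, hS, ht, hu⟩ =>
    subst hS
    rcases hl with hl | hl
    · exact ht.no_loop hG hl hz
    · exact hu.no_loop hG hl hz
end

end Rep

namespace Net.Denotes

variable {G : Net} {t : Tm} {X : Set ℕ}

theorem occ (hG : G.Denotes t X) : t.Occ G Sum.inl (Sum.inr G.root) (G.nw Set.univ) := by
  refine ⟨hG.rep, ?_, ?_⟩
  · rintro n ⟨l, _, hl⟩
    exact hG.tidy.names n l hl
  · rintro z - (he | ⟨l, hl, hw, _⟩)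
    · exact he
    · exact (hl ⟨trivial, hw⟩).elim

theorem fv_subset (hG : G.Denotes t X) : t.fv ⊆ X := by
  intro n hn
  obtain ⟨l, _, hl⟩ := hG.rep.fv_target hn
  rcases hG.tidy.tgt_src hl with ⟨l', h⟩ | ⟨m, hm, h⟩
  · exact (hG.tidy.names n l' h).elim
  · obtain rfl := Sum.inl.inj h
    exact hm

section Box

variable {p : G.Link} {a : G.M} {x b : ℕ ⊕ G.E}

/-- The occurrence of a term in a box.  The box does not contain its `⅋`-link, and it contains all
links on its variable. -/
theorem box_occ (hG : G.Denotes t X) (hp : G.shape p = .par a x b) :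
    p ∉ G.box p ∧ (∀ l, ¬ (G.shape l).IsWeak → x ∈ (G.shape l).eTargets → l ∈ G.box p) ∧
      ∃ s ρ, Tm.Occ G s (cons x ρ) b (G.nw (G.box p)) := by
  obtain ⟨s, ρ, h⟩ := hG.occ.par hG.tidy (p := p) ⟨trivial, by simp [hp, Shape.IsWeak]⟩ hp
  obtain ⟨q, x', b', hq, hqq, -, hs, hx⟩ := h.lam hG.tidy
  obtain rfl := hG.tidy.mout (a := a) (l := p) (l' := q) (by simp [hp, Shape.mSources])
    (by simp [hq, Shape.mSources])
  obtain ⟨rfl, rfl⟩ : x = x' ∧ b = b' := by simpa [hp] using hq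
  exact ⟨hqq, hx, s, ρ, hs⟩

theorem box_irrefl (hG : G.Denotes t X) (hp : (G.shape p).IsPar) : p ∉ G.box p := by
  obtain ⟨a, x, b, hp⟩ := hp
  exact (hG.box_occ hp).1

theorem box_trans (hG : G.Denotes t X) (hp : (G.shape p).IsPar) {q} (hq : (G.shape q).IsPar)
    (hqp : q ∈ G.box p) : G.box q ⊆ G.box p := by
  obtain ⟨a, x, b, hp⟩ := hp
  obtain ⟨-, -, s, ρ, hs⟩ := hG.box_occ hp
  have hsub := hs.rep.box_subset (p := q) ⟨hqp, hq.not_isWeak⟩ hq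
  obtain ⟨a', x', b', hq⟩ := hq
  intro l hl
  by_cases hw : (G.shape l).IsWeak
  · obtain ⟨z, hz⟩ := hw
    refine (hG.tidy.weak_box hp hz).2 (.inr ?_)
    rcases (hG.tidy.weak_box hq hz).1 hl with rfl | ⟨k, hk, hkz⟩
    · exact ⟨q, hqp, by simp [hq, Shape.eSources]⟩
    · exact ⟨k, (hsub ⟨hk, Shape.not_isWeak_of_eSource hkz⟩).1, hkz⟩
  · exact (hsub ⟨hl, hw⟩).1

theorem box_m_source (hG : G.Denotes t X) (hp : (G.shape p).IsPar) {l l' m} (hl : l ∈ G.box p)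
    (hm : m ∈ (G.shape l).mTargets) (hm' : m ∈ (G.shape l').mSources) : l' ∈ G.box p := by
  obtain ⟨a, x, b, hp⟩ := hp
  obtain ⟨-, -, s, ρ, hs⟩ := hG.box_occ hp
  obtain ⟨k, hk, h⟩ := hs.rep.m_source ⟨hl, Shape.not_isWeak_of_mTarget hm⟩ hm
  exact hG.tidy.mout hm' h ▸ hk.1

theorem box_m_target (hG : G.Denotes t X) (hp : (G.shape p).IsPar) {l l' m} (hl : l ∈ G.box p)
    (hm : m ∈ (G.shape l).mSources) (hm' : m ∈ (G.shape l').mTargets) : l' ∈ G.box p := by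
  obtain ⟨a, x, b, hp⟩ := hp
  obtain ⟨-, -, s, ρ, hs⟩ := hG.box_occ hp
  obtain ⟨k, hk, h⟩ := hs.rep.m_target ⟨hl, Shape.not_isWeak_of_mSource hm⟩ hm
  exact hG.tidy.min hm' h ▸ hk.1

/-- All links on an exponential source of a box, except for the root, are in the box. -/
theorem box_source (hG : G.Denotes t X) (hp : G.shape p = .par a x b) {l l' z} (hl : l ∈ G.box p)
    (hz : z ∈ (G.shape l).eSources) (hz' : z ∈ (G.shape l').eTargets) (hzb : z ≠ b) :
    l' ∈ G.box p := by
  obtain ⟨-, -, s, ρ, hs⟩ := hG.box_occ hp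
  by_contra hl'
  by_cases hw : (G.shape l').IsWeak
  · obtain ⟨y, hy⟩ := hw
    obtain rfl : z = y := by simpa [hy, Shape.eTargets] using hz'
    exact hl' ((hG.tidy.weak_box hp hy).2 (.inr ⟨l, hl, hz⟩))
  · exact hzb (hs.outer z (mem_src_nw hl hz) (.inr ⟨l', fun h => hl' h.1, hw, hz'⟩))

/-- A link of a box that is neither a dereliction nor a weakening has its target in the box. -/
theorem box_target (hG : G.Denotes t X) (hp : (G.shape p).IsPar) {l z} (hl : l ∈ G.box p)
    (hz : z ∈ (G.shape l).eTargets) (hd : ¬ (G.shape l).IsDer) (hw : ¬ (G.shape l).IsWeak) :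
    ∃ k ∈ G.box p, z ∈ (G.shape k).eSources := by
  obtain ⟨a, x, b, hp⟩ := hp
  obtain ⟨-, -, s, ρ, hs⟩ := hG.box_occ hp
  rcases hs.rep.target ⟨hl, hw⟩ hz with ⟨h, _⟩ | ⟨k, hk, h⟩
  · exact (hd h).elim
  · exact ⟨k, hk.1, h⟩

theorem box_root (hG : G.Denotes t X) (hp : G.shape p = .par a x b) :
    ∃ l ∈ G.box p, b ∈ (G.shape l).eSources ∧ ¬ (G.shape l).IsPar := by
  obtain ⟨-, -, s, ρ, hs⟩ := hG.box_occ hp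
  obtain ⟨l, hl, h⟩ := hs.rep.root
  exact ⟨l, hl.1, h⟩

/-- All links on the variable of a box are in the box. -/
theorem box_var (hG : G.Denotes t X) (hp : G.shape p = .par a x b) {l}
    (hl : x ∈ (G.shape l).eTargets) : l ∈ G.box p := by
  by_cases hw : (G.shape l).IsWeak
  · obtain ⟨y, hy⟩ := hw
    exact (hG.tidy.weak_box hp hy).2 (.inl (by simpa [hy, Shape.eTargets, eq_comm] using hl))
  · exact (hG.box_occ hp).2.1 l hw hl

/-- Only derelictions and weakenings are on the variable of a box. -/
theorem box_var_target (hG : G.Denotes t X) (hp : G.shape p = .par a x b) {l}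
    (hl : x ∈ (G.shape l).eTargets) : (G.shape l).IsDer ∨ (G.shape l).IsWeak := by
  by_contra! h
  obtain ⟨k, hk, hx⟩ := hG.box_target ⟨_, _, _, hp⟩ (hG.box_var hp hl) hl h.1 h.2
  obtain rfl := hG.tidy.eout (l' := p) hx (by simp [hp, Shape.eSources])
  exact hG.box_irrefl ⟨_, _, _, hp⟩ hk

/-- Only the `⅋`-link of a box is on its root. -/
theorem box_root_target (hG : G.Denotes t X) (hp : G.shape p = .par a x b) {l}
    (hl : b ∈ (G.shape l).eTargets) : l = p := by
  by_contra hne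
  obtain ⟨s, z, h⟩ := hG.tidy.ein (l := p) (by simp [hp, Shape.eTargets]) hl (Ne.symm hne)
  simp [hp] at h

theorem laminar (hG : G.Denotes t X) {q} (hp : (G.shape p).IsPar) (hq : (G.shape q).IsPar) :
    p = q ∨ p ∈ G.box q ∨ q ∈ G.box p ∨ Disjoint (G.nw (G.box p)) (G.nw (G.box q)) :=
  hG.rep.laminar ⟨trivial, hp.not_isWeak⟩ ⟨trivial, hq.not_isWeak⟩ hp hq

end Box

end Net.Denotes

/-! ### The multiplicative rule -/

/-- The conditions on a simulation under which representations of terms as whole nets are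
preserved. -/
structure Preserves (G H : Net) (X : Set ℕ) (h : G.Link → Set H.Link)
    (f : ℕ ⊕ G.E → ℕ ⊕ H.E) : Prop where
  names : ∀ n, f (Sum.inl n) = Sum.inl n
  root : f (Sum.inr G.root) = Sum.inr H.root
  cover : ⋃ l ∈ G.nw Set.univ, h l = H.nw Set.univ
  tidy : H.IsTidy X

theorem Preserves.denotes {G H : Net} {X : Set ℕ} {h : G.Link → Set H.Link}
    {f : ℕ ⊕ G.E → ℕ ⊕ H.E} (hP : Preserves G H X h f) {t : Tm}
    (ht : t.Rep H (f ∘ Sum.inl) (f (Sum.inr G.root)) (⋃ l ∈ G.nw Set.univ, h l)) :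
    H.Denotes t X := by
  refine ⟨hP.tidy, ?_⟩
  rwa [hP.cover, hP.root, funext (f := f ∘ Sum.inl) hP.names] at ht

/-- The multiplicative rule merges nodes and removes two links, and otherwise it is the identity.  It
preserves the conditions on whole nets because the two mergers join a target with a source: `b` and
`y` have no other incoming link, and `r` and `x` no other outgoing link. -/
theorem Net.Denotes.multReduct {G : Net} {t : Tm} {X : Set ℕ} (hG : G.Denotes t X)
    {c p : G.Link} {r y x b : ℕ ⊕ G.E} {a : G.M} (hc : G.shape c = .tensor r a y)
    (hp : G.shape p = .par a x b) :
    ∃ h f g, MultSim G (G.multReduct c p r y x b) h f g c p r y x b ∧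
      Preserves G (G.multReduct c p r y x b) X h f := by
  classical
  have hpar : (G.shape p).IsPar := ⟨_, _, _, hp⟩
  have hT := hG.tidy
  have hcs : r ∈ (G.shape c).eSources := by simp [hc, Shape.eSources]
  have hct : y ∈ (G.shape c).eTargets := by simp [hc, Shape.eTargets]
  have hcm : a ∈ (G.shape c).mTargets := by simp [hc, Shape.mTargets]
  have hps : x ∈ (G.shape p).eSources := by simp [hp, Shape.eSources]
  have hpt : b ∈ (G.shape p).eTargets := by simp [hp, Shape.eTargets]
  have hpm : a ∈ (G.shape p).mSources := by simp [hp, Shape.mSources]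
  have hcd : ¬ (G.shape c).IsDer := by simp [hc, Shape.IsDer]
  have hcw : ¬ (G.shape c).IsWeak := by simp [hc, Shape.IsWeak]
  have hcp : ¬ (G.shape c).IsPar := by simp [hc, Shape.IsPar]
  have hne : c ≠ p := by rintro rfl; exact hcp hpar
  obtain ⟨lb, hlb, hlbs, hlbp⟩ := hG.box_root hp
  -- the `⊗`-link is on the source node of the argument
  obtain ⟨ly, hlys, hlyn⟩ : ∃ l, y ∈ (G.shape l).eSources ∧ ¬ (G.shape l).IsPar := by
    rcases hG.rep.target (l := c) ⟨trivial, hcw⟩ hct with ⟨h, _⟩ | ⟨l, _, h⟩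
    · exact (hcd h).elim
    · refine ⟨l, h, ?_⟩
      rintro ⟨a', x', b', hl⟩
      obtain rfl : y = x' := by simpa [hl, Shape.eSources] using h
      rcases hG.box_var_target hl hct with h | h
      exacts [hcd h, hcw h]
  have hcbox : ∀ {q}, (G.shape q).IsPar → (c ∈ G.box q ↔ p ∈ G.box q) := fun hq =>
    ⟨fun h => hG.box_m_source hq h hcm hpm, fun h => hG.box_m_target hq h hpm hcm⟩
  have hcpb : c ∉ G.box p := fun h => hG.box_irrefl hpar ((hcbox hpar).1 h)
  have hxy : x ≠ y := by
    rintro rfl; exact hlyn (hT.eout hps hlys ▸ hpar)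
  have hxb : x ≠ b := by
    rintro rfl; exact hlbp (hT.eout hps hlbs ▸ hpar)
  have hyb : y ≠ b := by
    rintro rfl; exact hne (hG.box_root_target hp hct)
  have hrx : r ≠ x := by
    rintro rfl; exact hne (hT.eout hcs hps)
  have hrb : r ≠ b := by
    rintro rfl; exact hcpb (hT.eout hcs hlbs ▸ hlb)
  have hry : r ≠ y := by
    rintro rfl; exact hG.rep.no_loop hT ⟨trivial, hcw⟩ hct hcs
  obtain ⟨f, hf⟩ : ∃ f : ℕ ⊕ G.E → ℕ ⊕ G.E,
    f = fun z => if z = b then r else if z = x then y else z := ⟨_, rfl⟩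
  have fb : f b = r := by simp [hf]
  have fx : f x = y := by simp [hf, hxb]
  have fr : f r = r := by simp [hf, hrb, hrx]
  have fy : f y = y := by simp [hf, hyb]
  have fne : ∀ {z}, z ≠ b → z ≠ x → f z = z := fun h1 h2 => by simp [hf, h1, h2]
  -- on sources and on targets of the remaining links nothing is merged
  have ks : ∀ {l z}, l ≠ c → l ≠ p → z ∈ (G.shape l).eSources → z ≠ r ∧ z ≠ x := by
    intro l z h1 h2 hz
    exact ⟨by rintro rfl; exact h1 (hT.eout hz hcs), by rintro rfl; exact h2 (hT.eout hz hps)⟩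
  have kt : ∀ {l z}, l ≠ c → l ≠ p → z ∈ (G.shape l).eTargets → z ≠ b ∧ z ≠ y := by
    intro l z h1 h2 hz
    exact ⟨by rintro rfl; exact h2 (hG.box_root_target hp hz),
      by rintro rfl; exact hcd (hT.ein hct hz (Ne.symm h1))⟩
  have is : ∀ {z z'}, z ≠ r ∧ z ≠ x → z' ≠ r ∧ z' ≠ x → f z = f z' → z = z' := by
    rintro z z' ⟨h1, h2⟩ ⟨h3, h4⟩ h
    by_cases e : z = b <;> by_cases e' : z' = b
    · rw [e, e']
    · rw [e, fb, fne e' h4] at h; exact (h3 h.symm).elim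
    · rw [e', fb, fne e h2] at h; exact (h1 h).elim
    · rwa [fne e h2, fne e' h4] at h
  have it : ∀ {z z'}, z ≠ b ∧ z ≠ y → z' ≠ b ∧ z' ≠ y → f z = f z' → z = z' := by
    rintro z z' ⟨h1, h2⟩ ⟨h3, h4⟩ h
    by_cases e : z = x <;> by_cases e' : z' = x
    · rw [e, e']
    · rw [e, fx, fne h3 e'] at h; exact (h4 h.symm).elim
    · rw [e', fx, fne h1 e] at h; exact (h2 h).elim
    · rwa [fne h1 e, fne h3 e'] at h
  -- a target is merged with a source exactly if `b` and `r`, or `x` and `y` are merged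
  have hst : ∀ {z z'}, z ≠ b ∧ z ≠ y → z' ≠ r ∧ z' ≠ x → f z = f z' →
      z = z' ∨ (z = r ∧ z' = b) ∨ (z = x ∧ z' = y) := by
    rintro z z' ⟨h1, h2⟩ ⟨h3, h4⟩ h
    by_cases e : z = x <;> by_cases e' : z' = b
    · rw [e, e', fx, fb] at h; exact (hry h.symm).elim
    · rw [e, fx, fne e' h4] at h; exact .inr (.inr ⟨e, h.symm⟩)
    · rw [e', fb, fne h1 e] at h; exact .inr (.inl ⟨h, e'⟩)
    · rw [fne h1 e, fne e' h4] at h; exact .inl h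
  have hfn : ∀ n, f (Sum.inl n) = Sum.inl n := by
    intro n
    refine fne ?_ ?_
    · rintro rfl; exact hT.names n lb hlbs
    · rintro rfl; exact hT.names n p hps
  have hroot : f (Sum.inr G.root) = Sum.inr G.root := by
    refine fne ?_ ?_
    · intro h; exact hT.root_target rfl (h ▸ hpt)
    · intro h
      obtain ⟨l, _, hl, hn⟩ := hG.rep.root
      exact hn (hT.eout hps (h ▸ hl) ▸ hpar)
  have tidy : Tidy (E := G.E) (M := G.M) (L := {l : G.Link // l ≠ c ∧ l ≠ p})
      (fun l => (G.shape l.1).map f id) (fun l => {l' | l'.1 ∈ G.box l.1})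
      {Sum.inr G.root} X := by
    constructor
    · rintro n ⟨l, hl⟩ hmem
      obtain ⟨z, hz, e⟩ := (Shape.mem_eSources_map _ _ _).1 hmem
      have h1 := ks hl.1 hl.2 hz
      have : z = Sum.inl n ∨ z = b := by
        by_cases e' : z = b
        · exact .inr e'
        · exact .inl (by rw [← e, fne e' h1.2])
      rcases this with rfl | rfl
      · exact hT.names n l hz
      · rw [fb] at e; subst e; exact hT.names n c hcs
    · rintro z ⟨l, hl⟩ ⟨l', hl'⟩ h1 h2
      obtain ⟨z1, hz1, rfl⟩ := (Shape.mem_eSources_map _ _ _).1 h1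
      obtain ⟨z2, hz2, e⟩ := (Shape.mem_eSources_map _ _ _).1 h2
      obtain rfl := is (ks hl'.1 hl'.2 hz2) (ks hl.1 hl.2 hz1) e
      exact Subtype.ext (hT.eout hz1 hz2)
    · rintro m ⟨l, hl⟩ ⟨l', hl'⟩ h1 h2
      obtain ⟨z1, hz1, rfl⟩ := (Shape.mem_mSources_map _ _ _).1 h1
      obtain ⟨z2, hz2, rfl⟩ := (Shape.mem_mSources_map _ _ _).1 h2
      exact Subtype.ext (hT.mout hz1 hz2)
    · rintro m ⟨l, hl⟩ ⟨l', hl'⟩ h1 h2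
      obtain ⟨z1, hz1, rfl⟩ := (Shape.mem_mTargets_map _ _ _).1 h1
      obtain ⟨z2, hz2, rfl⟩ := (Shape.mem_mTargets_map _ _ _).1 h2
      exact Subtype.ext (hT.min hz1 hz2)
    · rintro z ⟨l, hl⟩ ⟨l', hl'⟩ h1 h2 hll
      obtain ⟨z1, hz1, rfl⟩ := (Shape.mem_eTargets_map _ _ _).1 h1
      obtain ⟨z2, hz2, e⟩ := (Shape.mem_eTargets_map _ _ _).1 h2
      obtain rfl := it (kt hl'.1 hl'.2 hz2) (kt hl.1 hl.2 hz1) e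
      exact (Shape.isDer_map _ _ _).2 (hT.ein hz1 hz2 fun e => hll (Subtype.ext e))
    · rintro z ⟨l, hl⟩ rfl h1
      obtain ⟨z1, hz1, e⟩ := (Shape.mem_eTargets_map _ _ _).1 h1
      have h3 := kt hl.1 hl.2 hz1
      by_cases e' : z1 = x
      · rw [e', fx] at e
        exact hT.root_target rfl (show Sum.inr G.root ∈ _ from e ▸ hct)
      · rw [fne h3.1 e'] at e
        exact hT.root_target rfl (show Sum.inr G.root ∈ _ from e ▸ hz1)
    · rintro z ⟨l, hl⟩ h1
      obtain ⟨z, hz, rfl⟩ := (Shape.mem_eSources_map _ _ _).1 h1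
      obtain ⟨h2, h3⟩ := ks hl.1 hl.2 hz
      have key : ∀ z₀, f z₀ = f z → z₀ ≠ b → z₀ ≠ y → ∀ l', z₀ ∈ (G.shape l').eTargets →
          ∃ l' : {l : G.Link // l ≠ c ∧ l ≠ p}, f z ∈ ((G.shape l'.1).map f id).eTargets := by
        intro z₀ e hb hy l' hl'
        have h4 : l' ≠ c := by
          rintro rfl; exact hy (Shape.eTargets_unique hl' hct)
        have h5 : l' ≠ p := by
          rintro rfl; exact hb (Shape.eTargets_unique hl' hpt)
        exact ⟨⟨l', h4, h5⟩, (Shape.mem_eTargets_map _ _ _).2 ⟨z₀, hl', e⟩⟩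
      by_cases e : z = b
      · rcases hT.src_tgt hcs with h | ⟨l', hl'⟩
        · left; rw [e, fb]; exact h
        · exact .inr (key r (by rw [e, fb, fr]) hrb hry l' hl')
      by_cases e' : z = y
      · rcases hT.src_tgt hps with h | ⟨l', hl'⟩
        · obtain ⟨k, _, hk, hn⟩ := hG.rep.root
          exact (hn (hT.eout (l := k) hk ((Set.mem_singleton_iff.1 h) ▸ hps) ▸ hpar)).elim
        · exact .inr (key x (by rw [e', fx, fy]) hxb hxy l' hl')
      rcases hT.src_tgt hz with h | ⟨l', hl'⟩
      · left; rw [fne e h3]; exact h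
      · exact .inr (key z rfl e e' l' hl')
    · intro n hn
      obtain ⟨l, hl⟩ := hT.name_tgt n hn
      have h4 : l ≠ c := by
        rintro rfl
        obtain rfl := Shape.eTargets_unique hl hct
        exact hT.names n ly hlys
      have h5 : l ≠ p := by
        rintro rfl
        obtain rfl := Shape.eTargets_unique hl hpt
        exact hT.names n lb hlbs
      exact ⟨⟨l, h4, h5⟩, (Shape.mem_eTargets_map _ _ _).2 ⟨_, hl, hfn n⟩⟩
    · rintro z ⟨l, hl⟩ h1
      obtain ⟨z, hz, rfl⟩ := (Shape.mem_eTargets_map _ _ _).1 h1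
      obtain ⟨h2, h3⟩ := kt hl.1 hl.2 hz
      rcases hT.tgt_src hz with ⟨l', hl'⟩ | ⟨n, hn, rfl⟩
      · left
        by_cases h4 : l' = c
        · subst h4
          obtain rfl := Shape.eSources_unique hl' hcs
          exact ⟨⟨lb, by rintro rfl; exact hcpb hlb, by rintro rfl; exact hlbp hpar⟩,
            (Shape.mem_eSources_map _ _ _).2 ⟨b, hlbs, by rw [fb, fr]⟩⟩
        by_cases h5 : l' = p
        · subst h5
          obtain rfl := Shape.eSources_unique hl' hps
          exact ⟨⟨ly, by rintro rfl; exact hry (Shape.eSources_unique hcs hlys),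
            by rintro rfl; exact hlyn hpar⟩,
            (Shape.mem_eSources_map _ _ _).2 ⟨y, hlys, by rw [fx, fy]⟩⟩
        exact ⟨⟨l', h4, h5⟩, (Shape.mem_eSources_map _ _ _).2 ⟨z, hl', rfl⟩⟩
      · exact .inr ⟨n, hn, hfn n⟩
    · rintro ⟨q, hq1, hq2⟩ a' x' b' ⟨w, hw1, hw2⟩ z' hq hw
      replace hq : (G.shape q).map f id = .par a' x' b' := hq
      replace hw : (G.shape w).map f id = .weak z' := hw
      obtain ⟨a', x', b', hq'⟩ : (G.shape q).IsPar :=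
        (Shape.isPar_map _ f id).1 ⟨_, _, _, hq⟩
      obtain ⟨z, hw'⟩ : (G.shape w).IsWeak := (Shape.isWeak_map _ f id).1 ⟨_, hw⟩
      rw [hq', Shape.map, Shape.par.injEq] at hq
      rw [hw', Shape.map, Shape.weak.injEq] at hw
      obtain ⟨-, rfl, -⟩ := hq
      subst hw
      have hqpar : (G.shape q).IsPar := ⟨_, _, _, hq'⟩
      have hz := kt hw1 hw2 (z := z) (by simp [hw', Shape.eTargets])
      have hx' := ks hq1 hq2 (z := x') (by simp [hq', Shape.eSources])
      -- the box of `q` contains the links with a merged source exactly if it contains the cut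
      have hpq : ∀ k, b ∈ (G.shape k).eSources ∨ y ∈ (G.shape k).eSources →
          (k ∈ G.box q ↔ p ∈ G.box q) := by
        intro k hk
        rcases hk with hk | hk
        · obtain rfl := hT.eout hk hlbs
          refine ⟨fun h => hG.box_source hq' h hk hpt ?_, fun h => hG.box_trans hqpar hpar h hlb⟩
          rintro rfl
          exact hq2 (hG.box_root_target hp (by simp [hq', Shape.eTargets]))
        · refine ⟨fun h => (hcbox hqpar).1 (hG.box_source hq' h hk hct ?_), fun h => ?_⟩
          · rintro rfl
            exact hq1.symm (hG.box_root_target hq' hct)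
          · obtain ⟨k', h1, h2⟩ := hG.box_target hqpar ((hcbox hqpar).2 h) hct hcd hcw
            exact hT.eout hk h2 ▸ h1
      refine (hT.weak_box hq' hw').trans ⟨?_, ?_⟩
      · rintro (rfl | ⟨l, hl, hlz⟩)
        · exact .inl rfl
        right
        by_cases h4 : l = c
        · subst h4
          obtain rfl := Shape.eSources_unique hlz hcs
          exact ⟨⟨lb, by rintro rfl; exact hcpb hlb, by rintro rfl; exact hlbp hpar⟩,
            (hpq lb (.inl hlbs)).2 ((hcbox hqpar).1 hl),
            (Shape.mem_eSources_map _ _ _).2 ⟨b, hlbs, by rw [fb, fr]⟩⟩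
        by_cases h5 : l = p
        · subst h5
          obtain rfl := Shape.eSources_unique hlz hps
          exact ⟨⟨ly, by rintro rfl; exact hry (Shape.eSources_unique hcs hlys),
            by rintro rfl; exact hlyn hpar⟩, (hpq ly (.inr hlys)).2 hl,
            (Shape.mem_eSources_map _ _ _).2 ⟨y, hlys, by rw [fx, fy]⟩⟩
        exact ⟨⟨l, h4, h5⟩, hl, (Shape.mem_eSources_map _ _ _).2 ⟨z, hlz, rfl⟩⟩
      · rintro (h | ⟨⟨l, hl1, hl2⟩, hl, hlz⟩)
        · rcases hst hz hx' h with h | ⟨-, rfl⟩ | ⟨-, rfl⟩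
          · exact .inl h
          · exact (hlbp (hT.eout (l := q) (by simp [hq', Shape.eSources]) hlbs ▸ hqpar)).elim
          · exact (hlyn (hT.eout (l := q) (by simp [hq', Shape.eSources]) hlys ▸ hqpar)).elim
        · obtain ⟨z2, hz2, e⟩ := (Shape.mem_eSources_map _ _ _).1 hlz
          right
          rcases hst hz (ks hl1 hl2 hz2) e.symm with rfl | ⟨rfl, rfl⟩ | ⟨rfl, rfl⟩
          · exact ⟨l, hl, hz2⟩
          · exact ⟨c, (hcbox hqpar).2 ((hpq l (.inl hz2)).1 hl), hcs⟩
          · exact ⟨p, (hpq l (.inr hz2)).1 hl, hps⟩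
  refine ⟨fun l => {l' | l'.1 = l}, f, id, ⟨⟨?_, ?_⟩, ?_, ?_, ?_, ?_⟩, ⟨hfn, hroot, ?_, ?_⟩⟩
  · intro l l' hll
    rw [Set.disjoint_left]
    rintro k rfl h
    exact hll h
  · intro l hl _
    have hl' : l ≠ c ∧ l ≠ p := by simpa [not_or] using hl
    refine ⟨⟨l, hl'⟩, Set.ext fun k =>
      ⟨fun h => Subtype.ext h, fun h => congrArg Subtype.val (Set.mem_singleton_iff.1 h)⟩,
      by rw [hf]; rfl, fun _ => ?_⟩
    ext k
    rw [Set.mem_iUnion₂]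
    constructor
    · rintro ⟨h1, h2⟩
      exact ⟨k.1, ⟨h1, fun h => h2 ((Shape.isWeak_map _ _ _).2 h)⟩, rfl⟩
    · rintro ⟨k', ⟨h1, h2⟩, rfl⟩
      exact ⟨h1, fun h => h2 ((Shape.isWeak_map _ _ _).1 h)⟩
  · ext k; exact ⟨fun h => k.2.1 h, False.elim⟩
  · ext k; exact ⟨fun h => k.2.2 h, False.elim⟩
  · rw [fx, fy]
  · rw [fb, fr]
  · ext k
    rw [Set.mem_iUnion₂]
    constructor
    · rintro ⟨k', ⟨h1, h2⟩, rfl⟩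
      exact ⟨trivial, fun h => h2 ((Shape.isWeak_map _ _ _).1 h)⟩
    · rintro ⟨h1, h2⟩
      exact ⟨k.1, ⟨trivial, fun h => h2 ((Shape.isWeak_map _ _ _).2 h)⟩, rfl⟩
  · rw [hf] at tidy; exact tidy

/-! ### The content of a value below a `!`-link -/

namespace Net.Denotes

variable {G : Net} {t : Tm} {X : Set ℕ} {c : G.Link} {x : ℕ ⊕ G.E} {a : G.M}

theorem below_occ (hG : G.Denotes t X) (hc : G.shape c = .bang x a) :
    ∃ (v : Val) (ρ : ℕ → ℕ ⊕ G.E), v.Occ G ρ a (G.nw (G.below a)) ∧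
      x ∉ G.src (G.nw (G.below a)) ∧ c ∉ G.below a ∧ ∀ n, ρ n ≠ x := by
  have hcw : ¬ (G.shape c).IsWeak := by simp [hc, Shape.IsWeak]
  obtain ⟨v, ρ, T, hv, hx, hcT, hρ⟩ := hG.occ.bang hG.tidy ⟨trivial, hcw⟩ hc
  obtain rfl := hv.rep.eq_below hG.tidy
  exact ⟨v, ρ, hv, hx, fun h => hcT ⟨h, hcw⟩, hρ⟩

theorem below_box (hG : G.Denotes t X) {q} (hq : (G.shape q).IsPar) (hqB : q ∈ G.below a) :
    G.box q ⊆ G.below a := by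
  rcases hqB with h | ⟨p, x', b, hp, h⟩
  · obtain ⟨a', x', b, hq⟩ := hq
    obtain rfl : a = a' := by simpa [hq, Shape.mSources] using h
    exact fun l hl => .inr ⟨q, x', b, hq, hl⟩
  · exact fun l hl => .inr ⟨p, x', b, hp, hG.box_trans ⟨_, _, _, hp⟩ hq h hl⟩

theorem below_weak (hG : G.Denotes t X) {w z} (hw : G.shape w = .weak z) :
    w ∈ G.below a ↔ ∃ l ∈ G.below a, z ∈ (G.shape l).eSources := by
  constructor
  · rintro (h | ⟨p, x', b, hp, h⟩)
    · simp [hw, Shape.mSources] at h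
    · rcases (hG.tidy.weak_box hp hw).1 h with rfl | ⟨l, hl, hz⟩
      · exact ⟨p, .inl (by simp [hp, Shape.mSources]), by simp [hp, Shape.eSources]⟩
      · exact ⟨l, .inr ⟨p, x', b, hp, hl⟩, hz⟩
  · rintro ⟨l, h | ⟨p, x', b, hp, hl⟩, hz⟩
    · match hl : G.shape l, h, hz with
      | .par a' x' b, h, hz =>
        obtain rfl : a = a' := by simpa [Shape.mSources] using h
        exact .inr ⟨l, x', b, hl,
          (hG.tidy.weak_box hl hw).2 (.inl (by simpa [Shape.eSources] using hz))⟩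
      | .bang _ _, h, _ => simp [Shape.mSources] at h
      | .tensor _ _ _, h, _ => simp [Shape.mSources] at h
    · exact .inr ⟨p, x', b, hp, (hG.tidy.weak_box hp hw).2 (.inr ⟨l, hl, hz⟩)⟩

/-- All links on an exponential source of the content are in it. -/
theorem below_source (hG : G.Denotes t X) (hc : G.shape c = .bang x a) {l l' z}
    (hl : l ∈ G.below a) (hz : z ∈ (G.shape l).eSources) (hz' : z ∈ (G.shape l').eTargets) :
    l' ∈ G.below a := by
  by_cases hw : (G.shape l').IsWeak
  · obtain ⟨y, hy⟩ := hw
    obtain rfl : z = y := by simpa [hy, Shape.eTargets] using hz'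
    exact (hG.below_weak hy).2 ⟨l, hl, hz⟩
  · obtain ⟨v, ρ, hv, -⟩ := hG.below_occ hc
    by_contra hl'
    exact hv.outer z (mem_src_nw hl hz) (.inr ⟨l', fun h => hl' h.1, hw, hz'⟩)

theorem below_root (hG : G.Denotes t X) (hc : G.shape c = .bang x a) {l} (hl : l ∈ G.below a) :
    Sum.inr G.root ∉ (G.shape l).eSources := by
  obtain ⟨v, ρ, hv, -⟩ := hG.below_occ hc
  exact fun hz => hv.outer _ (mem_src_nw hl hz) (.inl rfl)

/-- A link of the content that is not a dereliction has its target in it. -/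
theorem below_target (hG : G.Denotes t X) (hc : G.shape c = .bang x a) {l z}
    (hl : l ∈ G.below a) (hz : z ∈ (G.shape l).eTargets) (hd : ¬ (G.shape l).IsDer) :
    ∃ k ∈ G.below a, z ∈ (G.shape k).eSources := by
  by_cases hw : (G.shape l).IsWeak
  · obtain ⟨y, hy⟩ := hw
    obtain rfl : z = y := by simpa [hy, Shape.eTargets] using hz
    exact (hG.below_weak hy).1 hl
  · obtain ⟨v, ρ, hv, -⟩ := hG.below_occ hc
    rcases hv.rep.target ⟨hl, hw⟩ hz with ⟨h, _⟩ | ⟨k, hk, h⟩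
    · exact (hd h).elim
    · exact ⟨k, hk.1, h⟩

/-- No link of the content is on the cut node. -/
theorem below_cut (hG : G.Denotes t X) (hc : G.shape c = .bang x a) {l} (hl : l ∈ G.below a) :
    x ∉ (G.shape l).eTargets := by
  intro hx
  obtain ⟨v, ρ, hv, hxs, -, hρ⟩ := hG.below_occ hc
  by_cases hw : (G.shape l).IsWeak
  · obtain ⟨k, hk, h⟩ := hG.below_target hc hl hx fun h => h.not_isWeak hw
    exact hxs (mem_src_nw hk h)
  · rcases hv.rep.target ⟨hl, hw⟩ hx with ⟨_, n, h⟩ | h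
    · exact hρ n h.symm
    · exact hxs h

theorem below_bang (hG : G.Denotes t X) (hc : G.shape c = .bang x a) : c ∉ G.below a := by
  obtain ⟨v, ρ, hv, hxs, h, hρ⟩ := hG.below_occ hc
  exact h

theorem below_m_target (hG : G.Denotes t X) (hc : G.shape c = .bang x a) {l}
    (hl : l ∈ G.below a) : a ∉ (G.shape l).mTargets := fun h =>
  hG.below_bang hc (hG.tidy.min (l := c) (by simp [hc, Shape.mTargets]) h ▸ hl)

theorem below_subset_box (hG : G.Denotes t X) (hc : G.shape c = .bang x a) {q}
    (hq : (G.shape q).IsPar) (hcq : c ∈ G.box q) : G.below a ⊆ G.box q := by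
  have hca : a ∈ (G.shape c).mTargets := by simp [hc, Shape.mTargets]
  rintro l (h | ⟨p, x', b, hp, h⟩)
  · exact hG.box_m_source hq hcq hca h
  · exact hG.box_trans hq ⟨_, _, _, hp⟩
      (hG.box_m_source hq hcq hca (by simp [hp, Shape.mSources])) h

theorem bang_mem_box (hG : G.Denotes t X) (hc : G.shape c = .bang x a) {q}
    (hq : (G.shape q).IsPar) (hqB : q ∉ G.below a) {l} (hlB : l ∈ G.below a) (hlq : l ∈ G.box q)
    (hw : ¬ (G.shape l).IsWeak) : c ∈ G.box q := by
  have hca : a ∈ (G.shape c).mTargets := by simp [hc, Shape.mTargets]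
  rcases hlB with h | ⟨p, x', b, hp, h⟩
  · exact hG.box_m_target hq hlq h hca
  · have hpa : a ∈ (G.shape p).mSources := by simp [hp, Shape.mSources]
    rcases hG.laminar (p := p) (q := q) ⟨_, _, _, hp⟩ hq with rfl | h' | h' | h'
    · exact (hqB (.inl hpa)).elim
    · exact hG.box_m_target hq h' hpa hca
    · exact (hqB (.inr ⟨p, x', b, hp, h'⟩)).elim
    · exact (Set.disjoint_left.1 h' ⟨h, hw⟩ ⟨hlq, hw⟩).elim

end Net.Denotes

/-! ### The exponential rule for derelictions -/

section Der

variable {G : Net} {t : Tm} {X : Set ℕ} {c : G.Link} {x : ℕ ⊕ G.E} {a : G.M}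

theorem Net.copyE_shared {d : G.DersOn x} {z : ℕ ⊕ G.E}
    (hz : ∀ h ∈ G.below a, z ∉ (G.shape h).eSources) :
    G.copyE x a d z = Sum.map id Sum.inl z := by
  match z with
  | .inl n => rfl
  | .inr e => exact if_neg (by simpa using hz)

theorem Net.Denotes.copyE_copied (hG : G.Denotes t X) {d : G.DersOn x} {z : ℕ ⊕ G.E} {l}
    (hl : l ∈ G.below a) (hz : z ∈ (G.shape l).eSources) :
    ∃ e, z = .inr e ∧ G.copyE x a d z = .inr (.inr (d, e)) := by
  match z with
  | .inl n => exact (hG.tidy.names n l hz).elim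
  | .inr e => exact ⟨e, rfl, if_pos ⟨l, hl, hz⟩⟩

/-- The reduct of the rule for derelictions is tidy, where `sh` and `bx` are its links and boxes.
Exponential sources of the content are copied, so they stay apart from all other nodes, and its
remaining targets are targets of derelictions and are shared. -/
theorem Net.Denotes.tidy_derReduct (hG : G.Denotes t X) (hc : G.shape c = .bang x a)
    (d₀ : G.DersOn x)
    {sh : G.DerKept c x a ⊕ G.DersOn x × G.below a →
      Shape (ℕ ⊕ (G.E ⊕ G.DersOn x × G.E)) (G.M ⊕ G.DersOn x × G.M)}
    {bx : G.DerKept c x a ⊕ G.DersOn x × G.below a →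
      Set (G.DerKept c x a ⊕ G.DersOn x × G.below a)}
    (shl : ∀ l, sh (.inl l) = (G.shape l.1).map (Sum.map id Sum.inl) Sum.inl)
    (shr : ∀ d h, sh (.inr (d, h)) = (G.shape h.1).map (G.copyE x a d) (G.copyM x a d))
    (bll : ∀ l l', .inl l' ∈ bx (.inl l) ↔ l'.1 ∈ G.box l.1)
    (blr : ∀ l d h, .inr (d, h) ∈ bx (.inl l) ↔ d.1.1 ∈ G.box l.1)
    (brl : ∀ d h l, .inl l ∉ bx (.inr (d, h)))
    (brr : ∀ d h d' h', .inr (d', h') ∈ bx (.inr (d, h)) ↔ d' = d ∧ h'.1 ∈ G.box h.1) :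
    Tidy sh bx {Sum.inr (Sum.inl G.root)} X := by
  have hT := hG.tidy
  have hcs : x ∈ (G.shape c).eSources := by simp [hc, Shape.eSources]
  have hct : ∀ z, z ∉ (G.shape c).eTargets := by simp [hc, Shape.eTargets]
  have hd : ∀ d : G.DersOn x, d.1.1 ∉ G.below a := fun d h =>
    hG.below_cut hc h (by simp [d.2, Shape.eTargets])
  have dsrc : ∀ (d : G.DersOn x) z, z ∉ (G.shape d.1.1).eSources := fun d z => by
    simp [d.2, Shape.eSources]
  -- every link on `x` is a dereliction
  have hx : ∀ l, x ∈ (G.shape l).eTargets → ∃ s, G.shape l = .der s x := by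
    intro l hl
    by_cases e : l = d₀.1.1
    · exact ⟨d₀.1.2, e ▸ d₀.2⟩
    · obtain ⟨s, z, h⟩ := hT.ein (l' := d₀.1.1) hl (by simp [d₀.2, Shape.eTargets]) e
      obtain rfl : x = z := by simpa [h, Shape.eTargets] using hl
      exact ⟨s, h⟩
  have inj : Function.Injective
      (Sum.map id Sum.inl : ℕ ⊕ G.E → ℕ ⊕ (G.E ⊕ G.DersOn x × G.E)) :=
    Sum.map_injective.2 ⟨Function.injective_id, Sum.inl_injective⟩
  have nc : ∀ (z : ℕ ⊕ G.E) d e, (Sum.map id Sum.inl z : ℕ ⊕ (G.E ⊕ G.DersOn x × G.E)) ≠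
      .inr (.inr (d, e)) := by
    rintro (n | z) d e h <;> simp at h
  have ksrc : ∀ {l : G.DerKept c x a} {z}, z ∈ (G.shape l.1).eSources →
      ∀ h ∈ G.below a, z ∉ (G.shape h).eSources :=
    fun {l z} hz h hh hz' => l.2.2.1 (hT.eout hz' hz ▸ hh)
  have ktgt : ∀ {l : G.DerKept c x a} {z}, z ∈ (G.shape l.1).eTargets →
      ∀ h ∈ G.below a, z ∉ (G.shape h).eSources :=
    fun {l z} hz h hh hz' => l.2.2.1 (hG.below_source hc hh hz' hz)
  -- a link is kept, erased, or a dereliction on `x`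
  have cases : ∀ l, (∃ l' : G.DerKept c x a, l'.1 = l) ∨ l = c ∨ l ∈ G.below a ∨
      ∃ d : G.DersOn x, d.1.1 = l := by
    intro l
    by_contra! h
    obtain ⟨h1, h2, h3, h4⟩ := h
    exact h1 ⟨l, h2, h3, fun s hs => h4 ⟨(l, s), hs⟩ rfl⟩ rfl
  have msrc : ∀ {d : G.DersOn x}, d.1.2 ∈ (G.shape d.1.1).mSources := by
    intro d; simp [d.2, Shape.mSources]
  have copyM_ne : ∀ {d : G.DersOn x} {m}, m ≠ a → G.copyM x a d m = .inr (d, m) :=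
    fun h => if_neg h
  have copyM_eq : ∀ {d : G.DersOn x}, G.copyM x a d a = .inl d.1.2 := fun {d} => if_pos rfl
  -- targets of links that are shared by the copies
  have tgt_of : ∀ {l z}, l ≠ c → (∀ s, G.shape l ≠ .der s x) → z ∈ (G.shape l).eTargets →
      (∀ h ∈ G.below a, z ∉ (G.shape h).eSources) →
      ∃ k, Sum.map id Sum.inl z ∈ (sh k).eTargets := by
    intro l z h1 h2 hz hs
    by_cases hlB : l ∈ G.below a
    · refine ⟨.inr (d₀, ⟨l, hlB⟩), ?_⟩
      rw [shr, Shape.mem_eTargets_map]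
      exact ⟨z, hz, Net.copyE_shared hs⟩
    · refine ⟨.inl ⟨l, h1, hlB, h2⟩, ?_⟩
      rw [shl, Shape.mem_eTargets_map]
      exact ⟨z, hz, rfl⟩
  constructor
  · rintro n (l | ⟨d, h⟩) hmem
    · rw [shl, Shape.mem_eSources_map] at hmem
      obtain ⟨(m | z), hz, e⟩ := hmem
      · exact hT.names m _ hz
      · simp at e
    · rw [shr, Shape.mem_eSources_map] at hmem
      obtain ⟨z, hz, e⟩ := hmem
      obtain ⟨e', rfl, h'⟩ := hG.copyE_copied (d := d) h.2 hz
      rw [h'] at e; simp at e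
  · rintro z (l | ⟨d, h⟩) (l' | ⟨d', h'⟩) h1 h2 <;>
      simp only [shl, shr, Shape.mem_eSources_map] at h1 h2 <;>
      obtain ⟨z1, hz1, rfl⟩ := h1 <;> obtain ⟨z2, hz2, e⟩ := h2
    · obtain rfl := inj e
      exact congrArg _ (Subtype.ext (hT.eout hz1 hz2))
    · obtain ⟨e', rfl, h''⟩ := hG.copyE_copied (d := d') h'.2 hz2
      exact (nc _ _ _ (e.symm.trans h'')).elim
    · obtain ⟨e', rfl, h''⟩ := hG.copyE_copied (d := d) h.2 hz1
      exact (nc _ _ _ (e.trans h'')).elim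
    · obtain ⟨e1, rfl, h3⟩ := hG.copyE_copied (d := d) h.2 hz1
      obtain ⟨e2, rfl, h4⟩ := hG.copyE_copied (d := d') h'.2 hz2
      rw [h3, h4] at e
      simp only [Sum.inr.injEq, Prod.mk.injEq] at e
      obtain ⟨rfl, rfl⟩ := e
      rw [Subtype.ext (hT.eout hz1 hz2)]
  · rintro m (l | ⟨d, h⟩) (l' | ⟨d', h'⟩) h1 h2 <;>
      simp only [shl, shr, Shape.mem_mSources_map] at h1 h2 <;>
      obtain ⟨z1, hz1, rfl⟩ := h1 <;> obtain ⟨z2, hz2, e⟩ := h2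
    · obtain rfl := Sum.inl_injective e
      exact congrArg _ (Subtype.ext (hT.mout hz1 hz2))
    · by_cases ha : z2 = a
      · rw [ha, copyM_eq] at e
        obtain rfl := Sum.inl_injective e
        exact (l.2.2.2 d'.1.2 (hT.mout hz1 msrc ▸ d'.2)).elim
      · rw [copyM_ne ha] at e; simp at e
    · by_cases ha : z1 = a
      · rw [ha, copyM_eq] at e
        obtain rfl := Sum.inl_injective e
        exact (l'.2.2.2 d.1.2 (hT.mout hz2 msrc ▸ d.2)).elim
      · rw [copyM_ne ha] at e; simp at e
    · by_cases ha : z1 = a <;> by_cases ha' : z2 = a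
      · subst ha ha'
        rw [copyM_eq, copyM_eq] at e
        have e := Sum.inl_injective e
        obtain rfl : d = d' := Subtype.ext (Prod.ext (hT.mout msrc (e ▸ msrc)) e.symm)
        rw [Subtype.ext (hT.mout hz1 hz2)]
      · rw [ha, copyM_eq, copyM_ne ha'] at e; simp at e
      · rw [ha', copyM_eq, copyM_ne ha] at e; simp at e
      · rw [copyM_ne ha, copyM_ne ha'] at e
        simp only [Sum.inr.injEq, Prod.mk.injEq] at e
        obtain ⟨rfl, rfl⟩ := e
        rw [Subtype.ext (hT.mout hz1 hz2)]
  · have hm : ∀ {h : G.below a} {m}, m ∈ (G.shape h.1).mTargets → m ≠ a := by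
      rintro h m hm rfl
      exact hG.below_m_target hc h.2 hm
    rintro m (l | ⟨d, h⟩) (l' | ⟨d', h'⟩) h1 h2 <;>
      simp only [shl, shr, Shape.mem_mTargets_map] at h1 h2 <;>
      obtain ⟨z1, hz1, rfl⟩ := h1 <;> obtain ⟨z2, hz2, e⟩ := h2
    · obtain rfl := Sum.inl_injective e
      exact congrArg _ (Subtype.ext (hT.min hz1 hz2))
    · rw [copyM_ne (hm hz2)] at e; simp at e
    · rw [copyM_ne (hm hz1)] at e; simp at e
    · rw [copyM_ne (hm hz1), copyM_ne (hm hz2)] at e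
      simp only [Sum.inr.injEq, Prod.mk.injEq] at e
      obtain ⟨rfl, rfl⟩ := e
      rw [Subtype.ext (hT.min hz1 hz2)]
  · rintro z (l | ⟨d, h⟩) (l' | ⟨d', h'⟩) h1 h2 hne <;>
      simp only [shl, shr, Shape.mem_eTargets_map, Shape.isDer_map] at h1 h2 ⊢ <;>
      obtain ⟨z1, hz1, rfl⟩ := h1 <;> obtain ⟨z2, hz2, e⟩ := h2
    · obtain rfl := inj e
      exact hT.ein hz1 hz2 fun e => hne (congrArg _ (Subtype.ext e))
    · by_cases hs : ∀ h ∈ G.below a, z2 ∉ (G.shape h).eSources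
      · rw [Net.copyE_shared hs] at e
        obtain rfl := inj e
        exact hT.ein hz1 hz2 fun e => l.2.2.1 (e ▸ h'.2)
      · push Not at hs
        obtain ⟨k, hk, hs⟩ := hs
        obtain ⟨e', rfl, h''⟩ := hG.copyE_copied (d := d') hk hs
        exact (nc _ _ _ (e.symm.trans h'')).elim
    · by_contra hder
      obtain ⟨k, hk, hs⟩ := hG.below_target hc h.2 hz1 hder
      obtain ⟨e', rfl, h''⟩ := hG.copyE_copied (d := d) hk hs
      exact (nc _ _ _ (e.trans h'')).elim
    · by_contra hder
      obtain ⟨k, hk, hs⟩ := hG.below_target hc h.2 hz1 hder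
      obtain ⟨e1, rfl, h3⟩ := hG.copyE_copied (d := d) hk hs
      by_cases hs' : ∀ h ∈ G.below a, z2 ∉ (G.shape h).eSources
      · rw [Net.copyE_shared hs', h3] at e
        exact nc _ _ _ e
      · push Not at hs'
        obtain ⟨k', hk', hs'⟩ := hs'
        obtain ⟨e2, rfl, h4⟩ := hG.copyE_copied (d := d') hk' hs'
        rw [h3, h4] at e
        simp only [Sum.inr.injEq, Prod.mk.injEq] at e
        obtain ⟨rfl, rfl⟩ := e
        refine hder (hT.ein hz1 hz2 fun e => hne ?_)
        rw [Subtype.ext e]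
  · rintro z (l | ⟨d, h⟩) rfl h1 <;>
      simp only [shl, shr, Shape.mem_eTargets_map] at h1 <;> obtain ⟨z1, hz1, e⟩ := h1
    · obtain rfl : z1 = Sum.inr G.root := inj e
      exact hT.root_target rfl hz1
    · by_cases hs : ∀ h ∈ G.below a, z1 ∉ (G.shape h).eSources
      · rw [Net.copyE_shared hs] at e
        obtain rfl : z1 = Sum.inr G.root := inj e
        exact hT.root_target rfl hz1
      · push Not at hs
        obtain ⟨k, hk, hs⟩ := hs
        obtain ⟨e', rfl, h''⟩ := hG.copyE_copied (d := d) hk hs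
        rw [h''] at e; simp at e
  · rintro z (l | ⟨d, h⟩) h1 <;>
      simp only [shl, shr, Shape.mem_eSources_map] at h1 <;> obtain ⟨z1, hz1, rfl⟩ := h1
    · rcases hT.src_tgt hz1 with h | ⟨l', hl'⟩
      · left
        rw [Set.mem_singleton_iff.1 h]; rfl
      · refine .inr (tgt_of (fun e => hct _ (e ▸ hl')) (fun s hs => ?_) hl' (ksrc hz1))
        obtain rfl : z1 = x := by simpa [hs, Shape.eTargets] using hl'
        exact l.2.1 (hT.eout hz1 hcs)
    · rcases hT.src_tgt hz1 with h' | ⟨l', hl'⟩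
      · exact (hG.below_root hc h.2 (Set.mem_singleton_iff.1 h' ▸ hz1)).elim
      · right
        refine ⟨.inr (d, ⟨l', hG.below_source hc h.2 hz1 hl'⟩), ?_⟩
        rw [shr, Shape.mem_eTargets_map]
        exact ⟨z1, hl', rfl⟩
  · intro n hn
    obtain ⟨l, hl⟩ := hT.name_tgt n hn
    refine tgt_of (fun e => hct _ (e ▸ hl)) (fun s hs => ?_) hl (fun h _ => hT.names n h)
    obtain rfl : Sum.inl n = x := by simpa [hs, Shape.eTargets] using hl
    exact hT.names n c hcs
  · have key : ∀ {l z}, z ∈ (G.shape l).eTargets → z ≠ x →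
        (∀ h ∈ G.below a, z ∉ (G.shape h).eSources) →
        (∃ k, Sum.map id Sum.inl z ∈ (sh k).eSources) ∨ ∃ n ∈ X,
          (Sum.map id Sum.inl z : ℕ ⊕ (G.E ⊕ G.DersOn x × G.E)) = Sum.inl n := by
      intro l z hz hzx hs
      rcases hT.tgt_src hz with ⟨l', hl'⟩ | ⟨n, hn, rfl⟩
      · left
        rcases cases l' with ⟨k, rfl⟩ | rfl | h | ⟨d, rfl⟩
        · exact ⟨.inl k, by rw [shl, Shape.mem_eSources_map]; exact ⟨z, hl', rfl⟩⟩
        · exact (hzx (Shape.eSources_unique hl' hcs)).elim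
        · exact (hs _ h hl').elim
        · exact (dsrc d z hl').elim
      · exact .inr ⟨n, hn, rfl⟩
    rintro z (l | ⟨d, h⟩) h1 <;>
      simp only [shl, shr, Shape.mem_eTargets_map] at h1 <;> obtain ⟨z1, hz1, rfl⟩ := h1
    · refine key hz1 ?_ (ktgt hz1)
      rintro rfl
      obtain ⟨s, hs⟩ := hx _ hz1
      exact l.2.2.2 s hs
    · by_cases hs : ∀ h ∈ G.below a, z1 ∉ (G.shape h).eSources
      · rw [Net.copyE_shared hs]
        refine key hz1 ?_ hs
        rintro rfl
        exact hG.below_cut hc h.2 hz1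
      · push Not at hs
        obtain ⟨k, hk, hs⟩ := hs
        left
        refine ⟨.inr (d, ⟨k, hk⟩), ?_⟩
        rw [shr, Shape.mem_eSources_map]
        exact ⟨z1, hs, rfl⟩
  · rintro (q | ⟨d, q⟩) m y b (w | ⟨d', w⟩) z hq hw
    · -- a kept weakening in the box of a kept link
      rw [shl] at hq hw
      obtain ⟨m', y', b', hq'⟩ := (Shape.isPar_map _ _ _).1 ⟨_, _, _, hq⟩
      obtain ⟨z', hw'⟩ := (Shape.isWeak_map _ _ _).1 ⟨_, hw⟩
      rw [hq', Shape.map, Shape.par.injEq] at hq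
      rw [hw', Shape.map, Shape.weak.injEq] at hw
      obtain ⟨-, rfl, -⟩ := hq
      subst hw
      have hwt : z' ∈ (G.shape w.1).eTargets := by simp [hw', Shape.eTargets]
      rw [bll, hT.weak_box hq' hw', inj.eq_iff]
      refine or_congr_right ⟨?_, ?_⟩
      · rintro ⟨l, hl, hz⟩
        rcases cases l with ⟨k, rfl⟩ | rfl | h | ⟨d, rfl⟩
        · refine ⟨.inl k, (bll _ _).2 hl, ?_⟩
          rw [shl, Shape.mem_eSources_map]
          exact ⟨z', hz, rfl⟩
        · obtain rfl := Shape.eSources_unique hz hcs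
          obtain ⟨s, hs⟩ := hx _ hwt
          exact (w.2.2.2 s hs).elim
        · exact (ktgt hwt _ h hz).elim
        · exact (dsrc d z' hz).elim
      · rintro ⟨l | ⟨d, h⟩, hl, hz⟩
        · rw [shl, Shape.mem_eSources_map] at hz
          obtain ⟨z1, hz1, e⟩ := hz
          obtain rfl := inj e
          exact ⟨l.1, (bll _ _).1 hl, hz1⟩
        · rw [shr, Shape.mem_eSources_map] at hz
          obtain ⟨z1, hz1, e⟩ := hz
          obtain ⟨e', rfl, h''⟩ := hG.copyE_copied (d := d) h.2 hz1
          exact (nc _ _ _ (e.symm.trans h'')).elim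
    · -- a copied weakening is in the box of a kept link together with the dereliction it replaces
      rw [shl] at hq
      rw [shr] at hw
      obtain ⟨m', y', b', hq'⟩ := (Shape.isPar_map _ _ _).1 ⟨_, _, _, hq⟩
      obtain ⟨z', hw'⟩ := (Shape.isWeak_map _ _ _).1 ⟨_, hw⟩
      rw [hq', Shape.map, Shape.par.injEq] at hq
      rw [hw', Shape.map, Shape.weak.injEq] at hw
      obtain ⟨-, rfl, -⟩ := hq
      subst hw
      obtain ⟨k, hk, hkz⟩ := (hG.below_weak hw').1 w.2
      obtain ⟨e, rfl, he⟩ := hG.copyE_copied (d := d') hk hkz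
      rw [blr, he]
      constructor
      · intro h
        refine .inr ⟨.inr (d', ⟨k, hk⟩), (blr _ _ _).2 h, ?_⟩
        rw [shr, Shape.mem_eSources_map]
        exact ⟨_, hkz, he⟩
      · rintro (h | ⟨l | ⟨d, h⟩, hl, hz⟩)
        · exact (nc _ _ _ h.symm).elim
        · rw [shl, Shape.mem_eSources_map] at hz
          obtain ⟨z1, hz1, e⟩ := hz
          exact (nc _ _ _ e).elim
        · rw [shr, Shape.mem_eSources_map] at hz
          obtain ⟨z1, hz1, e⟩ := hz
          obtain ⟨e', rfl, h''⟩ := hG.copyE_copied (d := d) h.2 hz1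
          rw [h''] at e
          simp only [Sum.inr.injEq, Prod.mk.injEq] at e
          obtain ⟨rfl, rfl⟩ := e
          exact (blr _ _ _).1 hl
    · -- the box of a copied link contains no kept link
      rw [shr] at hq
      rw [shl] at hw
      obtain ⟨m', y', b', hq'⟩ := (Shape.isPar_map _ _ _).1 ⟨_, _, _, hq⟩
      obtain ⟨z', hw'⟩ := (Shape.isWeak_map _ _ _).1 ⟨_, hw⟩
      rw [hq', Shape.map, Shape.par.injEq] at hq
      rw [hw', Shape.map, Shape.weak.injEq] at hw
      obtain ⟨-, rfl, -⟩ := hq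
      subst hw
      refine iff_of_false (brl _ _ _) ?_
      rintro (h | ⟨l | ⟨d', h⟩, hl, hz⟩)
      · obtain ⟨e', rfl, h''⟩ := hG.copyE_copied (d := d) (z := y') q.2
          (by simp [hq', Shape.eSources])
        exact nc _ _ _ (h.trans h'')
      · exact brl _ _ _ hl
      · rw [shr, Shape.mem_eSources_map] at hz
        obtain ⟨z1, hz1, e⟩ := hz
        obtain ⟨e', rfl, h''⟩ := hG.copyE_copied (d := d') h.2 hz1
        exact nc _ _ _ (e.symm.trans h'')
    · -- the box of a copied link contains copied links for the same dereliction only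
      rw [shr] at hq hw
      obtain ⟨m', y', b', hq'⟩ := (Shape.isPar_map _ _ _).1 ⟨_, _, _, hq⟩
      obtain ⟨z', hw'⟩ := (Shape.isWeak_map _ _ _).1 ⟨_, hw⟩
      rw [hq', Shape.map, Shape.par.injEq] at hq
      rw [hw', Shape.map, Shape.weak.injEq] at hw
      obtain ⟨-, rfl, -⟩ := hq
      subst hw
      obtain ⟨k, hk, hkz⟩ := (hG.below_weak hw').1 w.2
      obtain ⟨e, rfl, he⟩ := hG.copyE_copied (d := d') hk hkz
      obtain ⟨e', rfl, he'⟩ := hG.copyE_copied (d := d) (z := y') q.2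
        (by simp [hq', Shape.eSources])
      rw [brr, hT.weak_box hq' hw', he, he']
      simp only [Sum.inr.injEq, Prod.mk.injEq]
      constructor
      · rintro ⟨rfl, rfl | ⟨l, hl, hz⟩⟩
        · exact .inl ⟨rfl, rfl⟩
        · have hlB : l ∈ G.below a := hG.below_box ⟨_, _, _, hq'⟩ q.2 hl
          refine .inr ⟨.inr (d', ⟨l, hlB⟩), (brr _ _ _ _).2 ⟨rfl, hl⟩, ?_⟩
          rw [shr, Shape.mem_eSources_map]
          exact ⟨_, hz, he⟩
      · rintro (⟨rfl, rfl⟩ | ⟨l | ⟨d₁, h⟩, hl, hz⟩)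
        · exact ⟨rfl, .inl rfl⟩
        · exact (brl _ _ _ hl).elim
        · obtain ⟨rfl, hl'⟩ := (brr _ _ _ _).1 hl
          rw [shr, Shape.mem_eSources_map] at hz
          obtain ⟨z1, hz1, e1⟩ := hz
          obtain ⟨e2, rfl, h''⟩ := hG.copyE_copied (d := d₁) h.2 hz1
          rw [h''] at e1
          simp only [Sum.inr.injEq, Prod.mk.injEq] at e1
          obtain ⟨rfl, rfl⟩ := e1
          exact ⟨rfl, .inr ⟨h.1, hl', hz1⟩⟩

/-- The rule for derelictions replaces each dereliction on the cut node by a copy of the content, and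
keeps the other links. -/
theorem Net.Denotes.derReduct (hG : G.Denotes t X) (hc : G.shape c = .bang x a)
    (d₀ : G.DersOn x) :
    ∃ h f g, ExpSim G (G.derReduct c x a) h f g c x a ∧
      Preserves G (G.derReduct c x a) X h f := by
  have hd : ∀ d : G.DersOn x, d.1.1 ∉ G.below a := fun d h =>
    hG.below_cut hc h (by simp [d.2, Shape.eTargets])
  have hwl : ∀ l : G.DerKept c x a, ((G.derReduct c x a).shape (.inl l)).IsWeak ↔
      (G.shape l.1).IsWeak := fun l => Shape.isWeak_map _ _ _
  have hwr : ∀ d (k : G.below a), ((G.derReduct c x a).shape (.inr (d, k))).IsWeak ↔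
      (G.shape k.1).IsWeak := fun d k => Shape.isWeak_map _ _ _
  have hdw : ∀ d : G.DersOn x, ¬ (G.shape d.1.1).IsWeak := fun d => by simp [d.2, Shape.IsWeak]
  have bll : ∀ l l' : G.DerKept c x a, .inl l' ∈ (G.derReduct c x a).box (.inl l) ↔
      l'.1 ∈ G.box l.1 := by
    intro l l'
    constructor
    · rintro (⟨k, hk, h⟩ | ⟨d, k, hk, h⟩)
      · obtain rfl := Sum.inl_injective hk; exact h
      · exact (Sum.inl_ne_inr hk).elim
    · exact fun h => .inl ⟨l', rfl, h⟩
  have blr : ∀ (l : G.DerKept c x a) (d : G.DersOn x) (k : G.below a),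
      .inr (d, k) ∈ (G.derReduct c x a).box (.inl l) ↔ d.1.1 ∈ G.box l.1 := by
    intro l d k
    constructor
    · rintro (⟨k', hk, h⟩ | ⟨d', k', hk, h⟩)
      · exact (Sum.inr_ne_inl hk).elim
      · obtain ⟨rfl, rfl⟩ := Prod.mk.inj (Sum.inr_injective hk); exact h
    · exact fun h => .inr ⟨d, k, rfl, h⟩
  have brl : ∀ (d : G.DersOn x) (k : G.below a) (l : G.DerKept c x a),
      .inl l ∉ (G.derReduct c x a).box (.inr (d, k)) := by
    rintro d k l ⟨k', hk, h⟩
    exact Sum.inl_ne_inr hk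
  have brr : ∀ (d : G.DersOn x) (k : G.below a) (d' : G.DersOn x) (k' : G.below a),
      .inr (d', k') ∈ (G.derReduct c x a).box (.inr (d, k)) ↔ d' = d ∧ k'.1 ∈ G.box k.1 := by
    intro d k d' k'
    constructor
    · rintro ⟨k'', hk, h⟩
      obtain ⟨rfl, rfl⟩ := Prod.mk.inj (Sum.inr_injective hk)
      exact ⟨rfl, h⟩
    · rintro ⟨rfl, h⟩
      exact ⟨k', rfl, h⟩
  -- a kept link corresponds to itself, and a dereliction on the cut node to its copy
  let h : G.Link → Set (G.derReduct c x a).Link := fun l =>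
    {k | (∃ l' : G.DerKept c x a, k = .inl l' ∧ l'.1 = l) ∨
      ∃ (d : G.DersOn x) (k' : G.below a), k = .inr (d, k') ∧ d.1.1 = l ∧
        ¬ (G.shape k'.1).IsWeak}
  have hinl : ∀ (l' : G.DerKept c x a) l, .inl l' ∈ h l ↔ l'.1 = l := by
    intro l' l
    constructor
    · rintro (⟨k, hk, h⟩ | ⟨d, k, hk, h⟩)
      · obtain rfl := Sum.inl_injective hk; exact h
      · exact (Sum.inl_ne_inr hk).elim
    · exact fun h => .inl ⟨l', rfl, h⟩
  have hinr : ∀ (d : G.DersOn x) (k' : G.below a) l,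
      .inr (d, k') ∈ h l ↔ d.1.1 = l ∧ ¬ (G.shape k'.1).IsWeak := by
    intro d k' l
    constructor
    · rintro (⟨k, hk, h⟩ | ⟨d, k, hk, h⟩)
      · exact (Sum.inr_ne_inl hk).elim
      · obtain ⟨rfl, rfl⟩ := Prod.mk.inj (Sum.inr_injective hk); exact h
    · exact fun h => .inr ⟨d, k', rfl, h⟩
  have hempty : ∀ l, (∀ l' : G.DerKept c x a, l'.1 ≠ l) → (∀ d : G.DersOn x, d.1.1 ≠ l) →
      h l = ∅ := by
    intro l h1 h2
    ext (l' | ⟨d, k⟩)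
    · exact ⟨fun h => h1 l' ((hinl _ _).1 h), False.elim⟩
    · exact ⟨fun h => h2 d ((hinr _ _ _).1 h).1, False.elim⟩
  refine ⟨h, Sum.map id Sum.inl, Sum.inl, ⟨⟨?_, ?_⟩, ?_, ?_, ?_⟩, ⟨fun _ => rfl, rfl, ?_, ?_⟩⟩
  · intro l l' hne
    rw [Set.disjoint_left]
    rintro (k | ⟨d, k⟩) h1 h2
    · exact hne (((hinl _ _).1 h1).symm.trans ((hinl _ _).1 h2))
    · exact hne (((hinr _ _ _).1 h1).1.symm.trans ((hinr _ _ _).1 h2).1)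
  · intro l hl hw
    have hk : l ≠ c ∧ l ∉ G.below a ∧ ∀ s, G.shape l ≠ .der s x :=
      ⟨fun h => hl (.inl h), fun h => hl (.inr (.inl ⟨h, hw⟩)),
        fun s h => hl (.inr (.inr ⟨s, h⟩))⟩
    refine ⟨.inl ⟨l, hk⟩, ?_, rfl, fun _ => ?_⟩
    · ext (l' | ⟨d, k⟩)
      · refine (hinl _ _).trans ⟨fun h => ?_, fun h => ?_⟩
        · exact congrArg Sum.inl (Subtype.ext h : l' = ⟨l, hk⟩)
        · exact congrArg Subtype.val (Sum.inl_injective h)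
      · exact (hinr _ _ _).trans
          ⟨fun h => (hk.2.2 _ (h.1 ▸ d.2)).elim, fun h => (Sum.inr_ne_inl h).elim⟩
    · ext k
      rw [Set.mem_iUnion₂]
      rcases k with l' | ⟨d, k⟩
      · constructor
        · rintro ⟨h1, h2⟩
          exact ⟨l'.1, ⟨(bll _ _).1 h1, fun h => h2 ((hwl _).2 h)⟩, (hinl _ _).2 rfl⟩
        · rintro ⟨k, ⟨h1, h2⟩, hk⟩
          obtain rfl := (hinl _ _).1 hk
          exact ⟨(bll _ _).2 h1, fun h => h2 ((hwl _).1 h)⟩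
      · constructor
        · rintro ⟨h1, h2⟩
          exact ⟨d.1.1, ⟨(blr _ _ _).1 h1, hdw d⟩,
            (hinr _ _ _).2 ⟨rfl, fun h => h2 ((hwr _ _).2 h)⟩⟩
        · rintro ⟨k', ⟨h1, h2⟩, hk⟩
          obtain ⟨rfl, h3⟩ := (hinr _ _ _).1 hk
          exact ⟨(blr _ _ _).2 h1, fun h => h3 ((hwr _ _).1 h)⟩
  · refine hempty c (fun l' => l'.2.1) fun d e => ?_
    have := d.2
    rw [e, hc] at this
    cases this
  · intro l hl
    exact hempty l (fun l' e => l'.2.2.1 (e ▸ hl.1)) fun d e => hd d (e ▸ hl.1)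
  · -- the copy of the content for a dereliction is its image under a simulation
    intro d s v ρ hds hv
    let d₁ : G.DersOn x := ⟨(d, s), hds⟩
    let h₁ : G.Link → Set (G.derReduct c x a).Link := fun l =>
      {k | ∃ hl : l ∈ G.below a, k = .inr (d₁, ⟨l, hl⟩)}
    have hs : Sim G (G.derReduct c x a) h₁ (G.copyE x a d₁) (G.copyM x a d₁)
        (G.nw (G.below a))ᶜ := by
      constructor
      · intro l l' hne
        rw [Set.disjoint_left]
        rintro k ⟨hl, rfl⟩ ⟨hl', e⟩
        exact hne (congrArg Subtype.val (Prod.mk.inj (Sum.inr_injective e)).2)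
      · intro l hl _
        rw [Set.notMem_compl_iff] at hl
        refine ⟨.inr (d₁, ⟨l, hl.1⟩), ?_, rfl, fun hp => ?_⟩
        · ext k
          exact ⟨fun ⟨_, e⟩ => e, fun e => ⟨hl.1, e⟩⟩
        · ext k
          rw [Set.mem_iUnion₂]
          constructor
          · rintro ⟨⟨k', rfl, h1⟩, h2⟩
            exact ⟨k'.1, ⟨h1, fun h => h2 ((hwr _ _).2 h)⟩, k'.2, rfl⟩
          · rintro ⟨k', ⟨h1, h2⟩, hk', rfl⟩
            exact ⟨⟨⟨k', hk'⟩, rfl, h1⟩, fun h => h2 ((hwr _ _).1 h)⟩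
    have := hv.rep.transport hs (Set.disjoint_compl_right_iff_subset.2 subset_rfl)
    have e1 : G.copyE x a d₁ ∘ ρ = Sum.map id Sum.inl ∘ ρ := by
      funext n
      exact Net.copyE_shared fun k hk hz => hv.env n (mem_src_nw hk hz)
    have e2 : G.copyM x a d₁ a = .inl s := if_pos rfl
    have e3 : ⋃ l ∈ G.nw (G.below a), h₁ l = h d := by
      ext k
      rw [Set.mem_iUnion₂]
      rcases k with l' | ⟨d', k⟩
      · refine Iff.trans ?_ (hinl _ _).symm
        constructor
        · rintro ⟨_, _, _, e⟩
          exact (Sum.inl_ne_inr e).elim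
        · rintro rfl
          exact (l'.2.2.2 _ hds).elim
      · refine Iff.trans ?_ (hinr _ _ _).symm
        constructor
        · rintro ⟨l, hl, hl', e⟩
          obtain ⟨rfl, rfl⟩ := Prod.mk.inj (Sum.inr_injective e)
          exact ⟨rfl, hl.2⟩
        · rintro ⟨e, hk⟩
          refine ⟨k.1, ⟨k.2, hk⟩, k.2, ?_⟩
          have : d' = d₁ := by
            refine Subtype.ext (Prod.ext e ?_)
            have h3 := d'.2
            rw [e, hds] at h3
            exact (Shape.der.inj h3).1.symm
          rw [this]
    have cong : ∀ {ρ ρ' : ℕ → ℕ ⊕ (G.derReduct c x a).E} {m m' : (G.derReduct c x a).M} {S S'},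
        ρ = ρ' → m = m' → S = S' → v.Rep (G.derReduct c x a) ρ m S →
        v.Rep (G.derReduct c x a) ρ' m' S' := by
      rintro _ _ _ _ _ _ rfl rfl rfl h
      exact h
    exact cong e1 e2 e3 this
  · ext k
    rw [Set.mem_iUnion₂]
    rcases k with l' | ⟨d, k⟩
    · constructor
      · rintro ⟨k, ⟨-, h2⟩, hk⟩
        obtain rfl := (hinl _ _).1 hk
        exact ⟨trivial, fun h => h2 ((hwl _).1 h)⟩
      · rintro ⟨-, h⟩
        exact ⟨l'.1, ⟨trivial, fun h' => h ((hwl _).2 h')⟩, (hinl _ _).2 rfl⟩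
    · constructor
      · rintro ⟨k', -, hk⟩
        exact ⟨trivial, fun h => ((hinr _ _ _).1 hk).2 ((hwr _ _).1 h)⟩
      · rintro ⟨-, h⟩
        exact ⟨d.1.1, ⟨trivial, hdw d⟩, (hinr _ _ _).2 ⟨rfl, fun h' => h ((hwr _ _).2 h')⟩⟩
  · exact hG.tidy_derReduct hc d₀ (fun _ => rfl) (fun _ _ => rfl) bll blr brl brr

end Der

/-! ### The exponential rule for weakenings -/

section Weak

variable {G : Net} {t : Tm} {X : Set ℕ} {c w : G.Link} {x : ℕ ⊕ G.E} {a : G.M}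

/-- The reduct of the rule for weakenings is tidy, where `sh` and `bx` are its links and boxes.  The
targets of the erased content that are left without a link get one, the new weakening. -/
theorem Net.Denotes.tidy_weakReduct (hG : G.Denotes t X) (hc : G.shape c = .bang x a)
    (hw : G.shape w = .weak x)
    {sh : G.WeakKept c w a ⊕ G.NewWeak c w a → Shape (ℕ ⊕ G.E) G.M}
    {bx : G.WeakKept c w a ⊕ G.NewWeak c w a → Set (G.WeakKept c w a ⊕ G.NewWeak c w a)}
    (shl : ∀ l, sh (.inl l) = G.shape l.1)
    (shr : ∀ y, sh (.inr y) = .weak y.1)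
    (bll : ∀ l l', .inl l' ∈ bx (.inl l) ↔ l'.1 ∈ G.box l.1)
    (blr : ∀ l y, .inr y ∈ bx (.inl l) ↔ c ∈ G.box l.1 ∧
      (y.1 ∈ G.freeVars (G.box l.1) → y.1 ∈ (G.shape l.1).eSources)) :
    Tidy sh bx {Sum.inr G.root} X := by
  have hT := hG.tidy
  have hcs : x ∈ (G.shape c).eSources := by simp [hc, Shape.eSources]
  have hct : ∀ z, z ∉ (G.shape c).eTargets := by simp [hc, Shape.eTargets]
  have hwt : x ∈ (G.shape w).eTargets := by simp [hw, Shape.eTargets]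
  have hws : ∀ z, z ∉ (G.shape w).eSources := by simp [hw, Shape.eSources]
  have hwB : w ∉ G.below a := fun h => hG.below_cut hc h hwt
  -- the weakening is the only link on `x`
  have hx : ∀ l, x ∈ (G.shape l).eTargets → l = w := by
    intro l hl
    by_contra hne
    obtain ⟨s, z, h⟩ := hT.ein hwt hl (Ne.symm hne)
    simp [hw] at h
  have cases : ∀ l, (∃ l' : G.WeakKept c w a, l'.1 = l) ∨ l = c ∨ l = w ∨ l ∈ G.below a := by
    intro l
    by_contra! h
    obtain ⟨h1, h2, h3, h4⟩ := h
    exact h1 ⟨l, h2, h3, h4⟩ rfl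
  have ktgt : ∀ {l : G.WeakKept c w a} {z}, z ∈ (G.shape l.1).eTargets →
      ∀ h ∈ G.below a, z ∉ (G.shape h).eSources :=
    fun {l z} hz h hh hz' => l.2.2.2 (hG.below_source hc hh hz' hz)
  have ksrc : ∀ {l : G.WeakKept c w a} {z}, z ∈ (G.shape l.1).eSources →
      ∀ h ∈ G.below a, z ∉ (G.shape h).eSources :=
    fun {l z} hz h hh hz' => l.2.2.2 (hT.eout hz' hz ▸ hh)
  -- a new weakening is on the target of a dereliction of the erased content
  have hnew : ∀ y : G.NewWeak c w a, ∃ h ∈ G.below a, y.1 ∈ (G.shape h).eTargets ∧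
      (G.shape h).IsDer := by
    rintro ⟨y, ⟨⟨h, hh, hy | hy⟩, hfree⟩, _⟩
    · exact (hfree h hh hy).elim
    · refine ⟨h, hh, hy, ?_⟩
      by_contra hd
      obtain ⟨k, hk, hk'⟩ := hG.below_target hc hh hy hd
      exact hfree k hk hk'
  have tgt_of : ∀ {l z}, z ∈ (G.shape l).eTargets → z ≠ x →
      (∀ h ∈ G.below a, z ∉ (G.shape h).eSources) → ∃ k, z ∈ (sh k).eTargets := by
    intro l z hz hzx hs
    by_cases hk : ∃ l : G.WeakKept c w a, z ∈ (G.shape l.1).eTargets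
    · obtain ⟨l, hl⟩ := hk
      exact ⟨.inl l, by rwa [shl]⟩
    · push Not at hk
      have hlB : l ∈ G.below a := by
        rcases cases l with ⟨k, rfl⟩ | rfl | rfl | h
        · exact (hk k hz).elim
        · exact (hct z hz).elim
        · exact (hzx (Shape.eTargets_unique hz hwt)).elim
        · exact h
      exact ⟨.inr ⟨z, ⟨⟨l, hlB, .inr hz⟩, hs⟩, hk⟩, by rw [shr]; rfl⟩
  have src_of : ∀ {l z}, z ∈ (G.shape l).eTargets → z ≠ x →
      (∀ h ∈ G.below a, z ∉ (G.shape h).eSources) →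
      (∃ k, z ∈ (sh k).eSources) ∨ ∃ n ∈ X, z = Sum.inl n := by
    intro l z hz hzx hs
    refine (hT.tgt_src hz).imp_left ?_
    rintro ⟨l', hl'⟩
    rcases cases l' with ⟨k, rfl⟩ | rfl | rfl | h
    · exact ⟨.inl k, by rwa [shl]⟩
    · exact (hzx (Shape.eSources_unique hl' hcs)).elim
    · exact (hws _ hl').elim
    · exact (hs _ h hl').elim
  have kx : ∀ {l : G.WeakKept c w a} {z}, z ∈ (G.shape l.1).eTargets → z ≠ x := by
    rintro l z hz rfl
    exact l.2.2.1 (hx _ hz)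
  have nsrc : ∀ (y : G.NewWeak c w a) z, z ∉ (sh (.inr y)).eSources := by
    intro y z; rw [shr]; exact id
  constructor
  · rintro n (l | y) h
    · rw [shl] at h; exact hT.names n _ h
    · exact nsrc _ _ h
  · rintro z (l | y) (l' | y') h1 h2
    · rw [shl] at h1 h2; exact congrArg _ (Subtype.ext (hT.eout h1 h2))
    · exact (nsrc _ _ h2).elim
    · exact (nsrc _ _ h1).elim
    · exact (nsrc _ _ h2).elim
  · rintro m (l | y) (l' | y') h1 h2 <;> simp only [shl, shr] at h1 h2
    · exact congrArg _ (Subtype.ext (hT.mout h1 h2))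
    · exact h2.elim
    · exact h1.elim
    · exact h1.elim
  · rintro m (l | y) (l' | y') h1 h2 <;> simp only [shl, shr] at h1 h2
    · exact congrArg _ (Subtype.ext (hT.min h1 h2))
    · exact h2.elim
    · exact h1.elim
    · exact h1.elim
  · rintro z (l | y) (l' | y') h1 h2 hne <;> simp only [shl, shr] at h1 h2 ⊢
    · exact hT.ein h1 h2 fun e => hne (congrArg _ (Subtype.ext e))
    · obtain rfl : z = y'.1 := h2
      exact (y'.2.2 l h1).elim
    · obtain rfl : z = y.1 := h1
      exact (y.2.2 l' h2).elim
    · have e : z = y.1 := h1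
      have e' : z = y'.1 := h2
      exact (hne (congrArg _ (Subtype.ext (e.symm.trans e')))).elim
  · rintro z (l | y) hz h1 <;> simp only [shl, shr] at h1
    · exact hT.root_target hz h1
    · obtain rfl : z = y.1 := h1
      obtain ⟨h, _, h2, _⟩ := hnew y
      exact hT.root_target hz h2
  · rintro z (l | y) h1
    · rw [shl] at h1
      refine (hT.src_tgt h1).imp_right ?_
      rintro ⟨l', hl'⟩
      refine tgt_of hl' ?_ (ksrc h1)
      rintro rfl
      exact l.2.1 (hT.eout h1 hcs)
    · exact (nsrc _ _ h1).elim
  · intro n hn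
    obtain ⟨l, hl⟩ := hT.name_tgt n hn
    refine tgt_of hl ?_ (fun h _ => hT.names n h)
    rintro rfl
    exact hT.names n c hcs
  · rintro z (l | y) h1 <;> simp only [shl, shr] at h1
    · exact src_of h1 (kx h1) (ktgt h1)
    · obtain rfl : z = y.1 := h1
      obtain ⟨h, hh, h2, _⟩ := hnew y
      refine src_of h2 ?_ y.2.1.2
      intro e
      exact hG.below_cut hc hh (e ▸ h2)
  · rintro (q | y) m x' b (v | y') z hq hv
    · rw [shl] at hq hv
      have hvt : z ∈ (G.shape v.1).eTargets := by simp [hv, Shape.eTargets]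
      rw [bll, hT.weak_box hq hv]
      refine or_congr_right ⟨?_, ?_⟩
      · rintro ⟨l, hl, hz⟩
        rcases cases l with ⟨k, rfl⟩ | rfl | rfl | h
        · exact ⟨.inl k, (bll _ _).2 hl, by rwa [shl]⟩
        · exact (kx hvt (Shape.eSources_unique hz hcs)).elim
        · exact (hws _ hz).elim
        · exact (ktgt hvt _ h hz).elim
      · rintro ⟨l | y, hl, hz⟩
        · rw [shl] at hz
          exact ⟨l.1, (bll _ _).1 hl, hz⟩
        · exact (nsrc _ _ hz).elim
    · rw [shl] at hq
      rw [shr] at hv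
      obtain rfl : y'.1 = z := by simpa using hv
      have hqp : (G.shape q.1).IsPar := ⟨_, _, _, hq⟩
      obtain ⟨h, hh, hy, hder⟩ := hnew y'
      have hyx : y'.1 ≠ x := fun e => hG.below_cut hc hh (e ▸ hy)
      rw [blr]
      -- the new weakening on `y'` is in the box of `q` exactly if the box binds `y'` or contains
      -- an outgoing link of `y'`
      constructor
      · rintro ⟨hcq, hfree⟩
        by_cases hs : ∃ l ∈ G.box q.1, y'.1 ∈ (G.shape l).eSources
        · obtain ⟨l, hl, hz⟩ := hs
          right
          rcases cases l with ⟨k, rfl⟩ | rfl | rfl | h'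
          · exact ⟨.inl k, (bll _ _).2 hl, by rwa [shl]⟩
          · exact (hyx (Shape.eSources_unique hz hcs)).elim
          · exact (hws _ hz).elim
          · exact (y'.2.1.2 _ h' hz).elim
        · push Not at hs
          left
          have := hfree ⟨⟨h, hG.below_subset_box hc hqp hcq hh, .inr hy⟩, hs⟩
          simpa [hq, Shape.eSources] using this
      · have hin : h ∈ G.box q.1 → c ∈ G.box q.1 := fun hl =>
          hG.bang_mem_box hc hqp q.2.2.2 hh hl hder.not_isWeak
        rintro (e | ⟨l | y, hl, hz⟩)
        · exact ⟨hin (hG.box_var hq (e ▸ hy)), fun _ => by rw [e, hq]; rfl⟩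
        · rw [shl] at hz
          have hl := (bll _ _).1 hl
          refine ⟨hin (hG.box_source hq hl hz hy ?_), fun h => (h.2 _ hl hz).elim⟩
          intro e
          exact hqp.not_isDer (hG.box_root_target hq (e ▸ hy) ▸ hder)
        · exact (nsrc _ _ hz).elim
    · rw [shr] at hq; cases hq
    · rw [shr] at hq; cases hq

/-- The rule for weakenings is the case of the exponential step without derelictions on the cut node.
Links that are not weakenings are kept or erased. -/
theorem Net.Denotes.weakReduct (hG : G.Denotes t X) (hc : G.shape c = .bang x a)
    (hw : G.shape w = .weak x) :
    ∃ h f g, ExpSim G (G.weakReduct c w a) h f g c x a ∧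
      Preserves G (G.weakReduct c w a) X h f := by
  have hww : (G.shape w).IsWeak := ⟨_, hw⟩
  have hr : ∀ y : G.NewWeak c w a, ((G.weakReduct c w a).shape (.inr y)).IsWeak :=
    fun y => ⟨_, rfl⟩
  have bll : ∀ l l' : G.WeakKept c w a, .inl l' ∈ (G.weakReduct c w a).box (.inl l) ↔
      l'.1 ∈ G.box l.1 := by
    intro l l'
    constructor
    · rintro (⟨k, hk, h⟩ | ⟨y, hk, h⟩)
      · obtain rfl := Sum.inl_injective hk; exact h
      · exact (Sum.inl_ne_inr hk).elim
    · exact fun h => .inl ⟨l', rfl, h⟩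
  have blr : ∀ (l : G.WeakKept c w a) (y : G.NewWeak c w a),
      .inr y ∈ (G.weakReduct c w a).box (.inl l) ↔ c ∈ G.box l.1 ∧
      (y.1 ∈ G.freeVars (G.box l.1) → y.1 ∈ (G.shape l.1).eSources) := by
    intro l y
    constructor
    · rintro (⟨k', hk, h⟩ | ⟨y', hk, h⟩)
      · exact (Sum.inr_ne_inl hk).elim
      · obtain rfl := Sum.inr_injective hk; exact h
    · exact fun h => .inr ⟨y, rfl, h⟩
  let h : G.Link → Set (G.weakReduct c w a).Link := fun l =>
    {k | ∃ l' : G.WeakKept c w a, k = .inl l' ∧ l'.1 = l}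
  have hempty : ∀ l, (∀ l' : G.WeakKept c w a, l'.1 ≠ l) → h l = ∅ := by
    intro l hl
    ext k
    exact ⟨fun ⟨l', _, h'⟩ => hl l' h', False.elim⟩
  refine ⟨h, id, id, ⟨⟨?_, ?_⟩, ?_, ?_, ?_⟩, ⟨fun _ => rfl, rfl, ?_, ?_⟩⟩
  · intro l l' hne
    rw [Set.disjoint_left]
    rintro k ⟨k', rfl, rfl⟩ ⟨k'', e, h2⟩
    obtain rfl := Sum.inl_injective e
    exact hne h2
  · intro l hl hlw
    have hk : l ≠ c ∧ l ≠ w ∧ l ∉ G.below a :=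
      ⟨fun h => hl (.inl h), fun h => hlw (h ▸ hww), fun h => hl (.inr (.inl ⟨h, hlw⟩))⟩
    refine ⟨.inl ⟨l, hk⟩, ?_, (Shape.map_id _).symm, fun _ => ?_⟩
    · ext k
      exact ⟨fun ⟨l', e, h'⟩ => e.trans (congrArg Sum.inl (Subtype.ext h' : l' = ⟨l, hk⟩)),
        fun e => ⟨⟨l, hk⟩, e, rfl⟩⟩
    · ext k
      rw [Set.mem_iUnion₂]
      constructor
      · rintro ⟨h1, h2⟩
        rcases k with l' | y
        · exact ⟨l'.1, ⟨(bll _ _).1 h1, h2⟩, l', rfl, rfl⟩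
        · exact (h2 (hr y)).elim
      · rintro ⟨_, ⟨h1, h2⟩, l', rfl, rfl⟩
        exact ⟨(bll _ _).2 h1, h2⟩
  · exact hempty c fun l' => l'.2.1
  · intro l hl
    exact hempty l fun l' e => l'.2.2.2 (e ▸ hl.1)
  · -- besides the weakening, no dereliction can be on the cut node
    intro d s v ρ hds _
    obtain ⟨s', z, h⟩ := hG.tidy.ein (z := x) (l := w) (l' := d) (by simp [hw, Shape.eTargets])
      (by simp [hds, Shape.eTargets]) (by rintro rfl; simp [hds] at hw)
    simp [hw] at h
  · ext k
    rw [Set.mem_iUnion₂]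
    constructor
    · rintro ⟨_, ⟨-, h2⟩, l', rfl, rfl⟩
      exact ⟨trivial, h2⟩
    · rintro ⟨-, h⟩
      rcases k with l' | y
      · exact ⟨l'.1, ⟨trivial, h⟩, l', rfl, rfl⟩
      · exact (h (hr y)).elim
  · exact hG.tidy_weakReduct hc hw (fun _ => rfl) (fun _ => rfl) bll blr

end Weak

/-! ### Steps of terms and of nets -/

section Steps

variable {G : Net} {X : Set ℕ}

/-- Every cut-elimination step of a net that represents a term is a step of the term. -/
theorem Net.Denotes.exists_step {t : Tm} (hG : G.Denotes t X) {i : Mode} {H : Net}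
    (hr : Net.Rule i G H) : ∃ t', t.Step i t' ∧ H.Denotes t' X := by
  have exp : ∀ {c x a H h f g}, G.shape c = .bang x a → ExpSim G H h f g c x a →
      Preserves G H X h f → (∃ l, x ∈ (G.shape l).eTargets) →
      (∀ l, x ∈ (G.shape l).eTargets → (G.shape l).IsDer ∨ (G.shape l).IsWeak) →
      ∃ t', t.Step .e t' ∧ H.Denotes t' X := by
    rintro c x a H h f g hc hE hP ⟨l, hl⟩ hx
    have hxr : x ≠ Sum.inr G.root := fun e => hG.tidy.root_target rfl (e ▸ hl)
    obtain ⟨t', ht', hrep⟩ := hE.exists_red hG.tidy hc hx hG.occ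
      ⟨trivial, by simp [hc, Shape.IsWeak]⟩ hxr
    exact ⟨t', ht', hP.denotes hrep⟩
  cases hr with
  | mult _ c p r a y x b hc hp =>
    obtain ⟨h, f, g, hM, hP⟩ := hG.multReduct hc hp
    obtain ⟨t', ht', hrep⟩ := hM.exists_red hG.tidy hc hp hG.occ
      ⟨trivial, by simp [hc, Shape.IsWeak]⟩
    exact ⟨t', ht', hP.denotes hrep⟩
  | der _ c d x a s hc hd =>
    obtain ⟨h, f, g, hE, hP⟩ := hG.derReduct hc ⟨(d, s), hd⟩
    have hdt : x ∈ (G.shape d).eTargets := by simp [hd, Shape.eTargets]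
    refine exp hc hE hP ⟨d, hdt⟩ fun l hl => .inl ?_
    by_cases e : l = d
    · exact ⟨s, x, e ▸ hd⟩
    · exact hG.tidy.ein hl hdt e
  | weak _ c w x a hc hw =>
    obtain ⟨h, f, g, hE, hP⟩ := hG.weakReduct hc hw
    have hwt : x ∈ (G.shape w).eTargets := by simp [hw, Shape.eTargets]
    refine exp hc hE hP ⟨w, hwt⟩ fun l hl => ?_
    by_cases e : l = w
    · exact .inr ⟨x, e ▸ hw⟩
    · exact .inl (hG.tidy.ein hl hwt e)

/-- A step of a term occurring in a net is simulated by a cut-elimination step of the net.  The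
touched links `T` are in the occurrence, so the context is preserved. -/
theorem Net.Denotes.exists_red {t₀ : Tm} (hG : G.Denotes t₀ X) {i : Mode} {t t' : Tm}
    (hst : t.Step i t') {ρ r S} (ht : t.Occ G ρ r S) :
    ∃ H h f g T, Net.Rule i G H ∧ Sim G H h f g T ∧ Preserves G H X h f ∧ T ⊆ S ∧
      Red G H i h f t t' ρ r S := by
  have hT := hG.tidy
  induction hst generalizing ρ r S with
  | mult t u =>
    obtain ⟨c, a, y, U, U', hc, hcU, hcU', hd, rfl, hv, hu⟩ := ht.app hT
    obtain ⟨p, x, b, hp, hpp, rfl, hb, -⟩ := hv.lam hT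
    obtain ⟨h, f, g, hM, hP⟩ := hG.multReduct hc hp
    rw [Set.disjoint_insert_left] at hd
    refine ⟨_, h, f, g, _, .mult G c p r a y x b hc hp, hM.toSim, hP, ?_,
      hM.base hpp hd.1 (fun h => hcU (.inr ⟨h, by simp [hc, Shape.IsWeak]⟩)) hcU' hd.2 hb.rep
        hu.rep⟩
    rintro l (rfl | rfl)
    · exact .inl rfl
    · exact .inr (.inl (.inl rfl))
  | exp t v L =>
    obtain ⟨x, U, U', hd, rfl, hb, hu⟩ := ht.sub hT
    obtain ⟨ρ₀, S₀, T₀, hd₀, hU', hv, hL⟩ := hu.plug hT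
    obtain ⟨c, a, V, hc, hcV, hS₀, -⟩ := hv.val hT
    have hcU' : c ∈ U' := by rw [hU', hS₀]; exact .inl (.inl rfl)
    have hxU' : x ∈ G.src U' := ⟨c, hcU', by simp [hc, Shape.eSources]⟩
    have hxr : x ≠ r := by
      rintro rfl
      obtain ⟨k, hk, h1, _⟩ := hb.rep.root
      exact hT.src_disjoint hd ⟨k, hk, h1⟩ hxU'
    have hsub := ht.exp_touched hT hc (.inr hcU') hxr
    by_cases hder : ∃ d s, G.shape d = .der s x
    · obtain ⟨d, s, hds⟩ := hder
      obtain ⟨h, f, g, hE, hP⟩ := hG.derReduct hc ⟨(d, s), hds⟩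
      exact ⟨_, h, f, g, _, .der G c d x a s hc hds, hE.toSim, hP, hsub,
        hE.base hT hc hd hb hu⟩
    · -- the cut node has an incoming link, and it cannot be anything but a weakening
      obtain ⟨w, hw⟩ : ∃ w, G.shape w = .weak x := by
        rcases hT.src_tgt (l := c) (z := x) (by simp [hc, Shape.eSources]) with h | ⟨l, hl⟩
        · exact (hxr (ht.outer x (G.src_mono Set.subset_union_right hxU') (.inl h))).elim
        by_cases hlw : (G.shape l).IsWeak
        · obtain ⟨z, hz⟩ := hlw
          obtain rfl : x = z := by simpa [hz, Shape.eTargets] using hl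
          exact ⟨l, hz⟩
        have hlS : l ∈ U ∪ U' := by
          by_contra hlS
          exact hxr (ht.outer x (G.src_mono Set.subset_union_right hxU') (.inr ⟨l, hlS, hlw, hl⟩))
        rcases hlS with hlU | hlU
        · rcases hb.rep.target hlU hl with ⟨⟨s, z, hs⟩, -⟩ | h
          · obtain rfl : x = z := by simpa [hs, Shape.eTargets] using hl
            exact (hder ⟨l, s, hs⟩).elim
          · exact (hT.src_disjoint hd h hxU').elim
        · exact (hu.root_not_target hT hlU hl).elim
      obtain ⟨h, f, g, hE, hP⟩ := hG.weakReduct hc hw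
      exact ⟨_, h, f, g, _, .weak G c w x a hc hw, hE.toSim, hP, hsub,
        hE.base hT hc hd hb hu⟩
  | lam _ ih =>
    obtain ⟨c, a, V, hc, hcV, rfl, hv⟩ := ht.val hT
    obtain ⟨p, x, b, hp, hpp, rfl, hb, -⟩ := hv.lam hT
    obtain ⟨H, h, f, g, T, hr, hs, hP, hTS, hred⟩ := ih hb
    have hTS' := hTS.trans (Set.subset_insert p _)
    exact ⟨H, h, f, g, T, hr, hs, hP, hTS'.trans (Set.subset_insert c _),
      Red.val hs hc hcV hTS' (hred.lam hs hp hpp hTS)⟩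
  | appFun s _ ih =>
    obtain ⟨c, a, y, U, U', hc, hcU, hcU', hd, rfl, hv, hu⟩ := ht.app hT
    obtain ⟨p, x, b, hp, hpp, rfl, hb, -⟩ := hv.lam hT
    obtain ⟨H, h, f, g, T, hr, hs, hP, hTS, hred⟩ := ih hb
    have hTS' := hTS.trans (Set.subset_insert p _)
    exact ⟨H, h, f, g, T, hr, hs, hP, fun l hl => .inr (.inl (hTS' hl)),
      Red.appFun hs hc hcU hcU' hd hTS' (hred.lam hs hp hpp hTS) hu.rep⟩
  | appArg v _ ih =>
    obtain ⟨c, a, y, U, U', hc, hcU, hcU', hd, rfl, hv, hu⟩ := ht.app hT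
    obtain ⟨H, h, f, g, T, hr, hs, hP, hTS, hred⟩ := ih hu
    exact ⟨H, h, f, g, T, hr, hs, hP, fun l hl => .inr (.inr (hTS hl)),
      Red.appArg hs hc hcU hcU' hd hTS hv.rep hred⟩
  | subBody u _ ih =>
    obtain ⟨y, U, U', hd, rfl, hb, hu⟩ := ht.sub hT
    obtain ⟨H, h, f, g, T, hr, hs, hP, hTS, hred⟩ := ih hb
    exact ⟨H, h, f, g, T, hr, hs, hP, fun l hl => .inl (hTS hl),
      Red.subBody hs hd hTS hred hu.rep⟩
  | subArg t _ ih =>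
    obtain ⟨y, U, U', hd, rfl, hb, hu⟩ := ht.sub hT
    obtain ⟨H, h, f, g, T, hr, hs, hP, hTS, hred⟩ := ih hu
    exact ⟨H, h, f, g, T, hr, hs, hP, fun l hl => .inr (hTS hl),
      Red.subArg hs hd hTS hb.rep hred⟩

/-- Every step of a term is simulated by a cut-elimination step of a net that represents it. -/
theorem Net.Denotes.exists_rule {t t' : Tm} (hG : G.Denotes t X) {i : Mode} (hst : t.Step i t') :
    ∃ H, Net.Rule i G H ∧ H.Denotes t' X := by
  obtain ⟨H, h, f, g, T, hr, -, hP, -, hred⟩ := hG.exists_red hst hG.occ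
  exact ⟨H, hr, hP.denotes hred.2⟩

end Steps

/-! ### Representations of terms are nets -/

namespace Net.Denotes

variable {G : Net} {t : Tm} {X : Set ℕ}

/-- A set of links that represents a term up to weakenings satisfies the conditions on a net. -/
theorem isNetOn (hG : G.Denotes t X) {S : Set G.Link} {s : Tm} {ρ r} (hs : s.Rep G ρ r (G.nw S))
    (hr : ∀ l ∈ S, r ∉ (G.shape l).eTargets)
    (hbox : ∀ l ∈ S, (G.shape l).IsPar → G.box l ⊆ S) : G.IsNetOn S r where
  root_mem := by
    obtain ⟨l, hl, h, _⟩ := hs.root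
    exact ⟨l, hl.1, .inl h⟩
  root_source := hr
  conclusions := by
    intro x hx l hl hxl
    by_contra! h
    rcases hs.target ⟨hl, h.2⟩ hxl with ⟨hd, _⟩ | ⟨k, hk, hxk⟩
    · exact h.1 hd
    · exact hx.2 k hk.1 hxk
  mult_in := by
    rintro a ⟨l, hl, h | h⟩
    · obtain ⟨k, hk, hak⟩ := hs.m_target ⟨hl, Shape.not_isWeak_of_mSource h⟩ h
      exact ⟨k, ⟨hk.1, hak⟩, fun k' hk' => hG.tidy.min hk'.2 hak⟩
    · exact ⟨l, ⟨hl, h⟩, fun k' hk' => hG.tidy.min hk'.2 h⟩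
  mult_out := by
    rintro a ⟨l, hl, h | h⟩
    · exact ⟨l, ⟨hl, h⟩, fun k' hk' => hG.tidy.mout hk'.2 h⟩
    · obtain ⟨k, hk, hak⟩ := hs.m_source ⟨hl, Shape.not_isWeak_of_mTarget h⟩ h
      exact ⟨k, ⟨hk.1, hak⟩, fun k' hk' => hG.tidy.mout hk'.2 hak⟩
  exp_out := fun x l _ l' _ h h' => hG.tidy.eout h h'
  exp_in := fun x l _ l' _ h h' hne => ⟨hG.tidy.ein h h' hne, hG.tidy.ein h' h hne.symm⟩
  box_subset := hbox

theorem box_isNetOn (hG : G.Denotes t X) {p a x b} (hp : G.shape p = .par a x b) :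
    G.IsNetOn (G.box p) b := by
  obtain ⟨-, -, s, ρ, hs⟩ := hG.box_occ hp
  have hpar : (G.shape p).IsPar := ⟨_, _, _, hp⟩
  refine hG.isNetOn hs.rep (fun l hl hb => ?_) fun l hl hlp => hG.box_trans hpar hlp hl
  obtain rfl := hG.box_root_target hp hb
  exact hG.box_irrefl hpar hl

/-- A node with an outgoing link in a box does not occur in another box, unless the boxes are
nested. -/
theorem src_notMem_eNodes (hG : G.Denotes t X) {p q} (hp : (G.shape p).IsPar)
    (hq : (G.shape q).IsPar) (hpq : p ∉ G.box q) (hqp : q ∉ G.box p)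
    (hd : Disjoint (G.nw (G.box p)) (G.nw (G.box q))) {z} (hz : z ∈ G.eNodes (G.box q)) :
    ∀ l ∈ G.box p, z ∉ (G.shape l).eSources := by
  intro l hl hzl
  have hsrc : ∀ k ∈ G.box q, z ∉ (G.shape k).eSources := fun k hk hzk => by
    obtain rfl := hG.tidy.eout hzl hzk
    have hw := Shape.not_isWeak_of_eSource hzl
    exact Set.disjoint_left.1 hd ⟨hl, hw⟩ ⟨hk, hw⟩
  obtain ⟨k, hk, hzk⟩ := hz
  have hzk := hzk.resolve_left (hsrc k hk)
  obtain ⟨a, x, b, hp⟩ := hp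
  have hzb : z ≠ b := by
    rintro rfl
    exact hpq (hG.box_root_target hp hzk ▸ hk)
  have hkp := hG.box_source hp hl hzl hzk hzb
  by_cases hw : (G.shape k).IsWeak
  · obtain ⟨y, hy⟩ := hw
    obtain rfl : z = y := by simpa [hy, Shape.eTargets] using hzk
    obtain ⟨a', x', b', hq⟩ := hq
    rcases (hG.tidy.weak_box hq hy).1 hk with rfl | ⟨k', hk', hzk'⟩
    · exact hqp (hG.tidy.eout (l' := q) hzl (by simp [hq, Shape.eSources]) ▸ hl)
    · exact hsrc k' hk' hzk'
  · exact Set.disjoint_left.1 hd ⟨hkp, hw⟩ ⟨hk, hw⟩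

theorem isNet (hG : G.Denotes t X) : G.IsNet where
  names_free := hG.tidy.names
  free_named := by
    rintro e ⟨⟨l, _, h | h⟩, hn⟩
    · exact hn l trivial h
    · rcases hG.tidy.tgt_src h with ⟨l', h'⟩ | ⟨n, _, h'⟩
      · exact hn l' trivial h'
      · cases h'
  whole := hG.isNetOn hG.rep (fun l _ => hG.tidy.root_target rfl) fun _ _ _ => Set.subset_univ _
  box_isNet := fun _ _ _ _ => hG.box_isNetOn
  border_var := by
    intro p a x b hp
    have hx : x ∈ (G.shape p).eSources := by simp [hp, Shape.eSources]
    refine ⟨?_, fun l hl hxl => hG.box_irrefl ⟨_, _, _, hp⟩ (hG.tidy.eout hxl hx ▸ hl)⟩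
    rcases hG.tidy.src_tgt hx with rfl | ⟨l, hl⟩
    · obtain ⟨l, _, hl, hn⟩ := hG.rep.root
      exact (hn (hG.tidy.eout hx hl ▸ ⟨_, _, _, hp⟩)).elim
    · exact ⟨l, hG.box_var hp hl, .inr hl⟩
  border_weak := by
    intro p a x b hp y hy hyx w hw hwy
    rcases (hG.tidy.weak_box hp hwy).1 hw with h | ⟨l, hl, h⟩
    · exact hyx h
    · exact hy.2 l hl h
  nesting := by
    intro p q hp hq hpq hqp
    have h1 : p ∉ G.box q := fun h => hpq (hG.box_trans hq hp h)
    have h2 : q ∉ G.box p := fun h => hqp (hG.box_trans hp hq h)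
    have hd : Disjoint (G.nw (G.box p)) (G.nw (G.box q)) := by
      rcases hG.laminar hp hq with rfl | h | h | h
      exacts [(hpq subset_rfl).elim, (h1 h).elim, (h2 h).elim, h]
    refine ⟨fun z hz => ⟨⟨hz.1, ?_⟩, ⟨hz.2, ?_⟩⟩, ?_⟩
    · exact hG.src_notMem_eNodes hp hq h1 h2 hd hz.2
    · exact hG.src_notMem_eNodes hq hp h2 h1 hd.symm hz.1
    · refine Set.eq_empty_of_forall_notMem fun m hm => ?_
      obtain ⟨a, x, b, hp⟩ := hp
      obtain ⟨a', x', b', hq⟩ := hq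
      obtain ⟨l, ⟨hl, hml⟩, -⟩ := (hG.box_isNetOn hp).mult_out m hm.1
      obtain ⟨k, ⟨hk, hmk⟩, -⟩ := (hG.box_isNetOn hq).mult_out m hm.2
      obtain rfl := hG.tidy.mout hml hmk
      have hw := Shape.not_isWeak_of_mSource hml
      exact Set.disjoint_left.1 hd ⟨hl, hw⟩ ⟨hk, hw⟩
  internal_closure := by
    rintro p hpar z ⟨⟨l, hl, hzl⟩, k, hk, hzk⟩ l' hl'
    obtain ⟨a, x, b, hp⟩ := id hpar
    refine hG.box_source hp hl hzl hl' ?_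
    rintro rfl
    exact hG.box_irrefl hpar (hG.box_root_target hp hzk ▸ hk)

end Net.Denotes

/-! ### Invariance under isomorphism -/

theorem Net.Denotes.of_iso {G K : Net} {t : Tm} {X : Set ℕ} (hG : G.Denotes t X)
    (hi : G.Iso K) : K.Denotes t X := by
  obtain ⟨φ, ε, μ, hε, hμ, hsh, hbox, hroot⟩ := hi
  have hT := hG.tidy
  have hf : ∀ {l l' z z'}, z ∈ (G.shape l).eSources ∨ z ∈ (G.shape l).eTargets →
      z' ∈ (G.shape l').eSources ∨ z' ∈ (G.shape l').eTargets →
      Sum.map (id : ℕ → ℕ) ε z = Sum.map id ε z' → z = z' := by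
    rintro l l' (n | e) (n' | e') hz hz' h
    · simpa using h
    · simp at h
    · simp at h
    · rw [hε ⟨l, trivial, hz⟩ ⟨l', trivial, hz'⟩ (by simpa using h)]
  have hg : ∀ {l l' a a'}, a ∈ (G.shape l).mSources ∨ a ∈ (G.shape l).mTargets →
      a' ∈ (G.shape l').mSources ∨ a' ∈ (G.shape l').mTargets → μ a = μ a' → a = a' :=
    fun ha ha' h => hμ ⟨_, trivial, ha⟩ ⟨_, trivial, ha'⟩ h
  have hn : ∀ {n z}, Sum.map (id : ℕ → ℕ) ε z = Sum.inl n → z = Sum.inl n := by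
    rintro n (m | e) h
    · simpa using h
    · simp at h
  have hes : ∀ {l z}, z ∈ (K.shape (φ l)).eSources ↔
      ∃ y ∈ (G.shape l).eSources, Sum.map id ε y = z := by intro l z; rw [hsh]; simp
  have het : ∀ {l z}, z ∈ (K.shape (φ l)).eTargets ↔
      ∃ y ∈ (G.shape l).eTargets, Sum.map id ε y = z := by intro l z; rw [hsh]; simp
  have hms : ∀ {l a}, a ∈ (K.shape (φ l)).mSources ↔
      ∃ y ∈ (G.shape l).mSources, μ y = a := by intro l a; rw [hsh]; simp
  have hmt : ∀ {l a}, a ∈ (K.shape (φ l)).mTargets ↔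
      ∃ y ∈ (G.shape l).mTargets, μ y = a := by intro l a; rw [hsh]; simp
  have hw : ∀ {l}, (K.shape (φ l)).IsWeak ↔ (G.shape l).IsWeak := by intro l; rw [hsh]; simp
  refine ⟨⟨?_, ?_, ?_, ?_, ?_, ?_, ?_, ?_, ?_, ?_⟩, ?_⟩
  · intro n l hl
    obtain ⟨l, rfl⟩ := φ.surjective l
    obtain ⟨y, hy, e⟩ := hes.1 hl
    exact hT.names n l (hn e ▸ hy)
  · intro z l l' h h'
    obtain ⟨l, rfl⟩ := φ.surjective l
    obtain ⟨l', rfl⟩ := φ.surjective l'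
    obtain ⟨y, hy, rfl⟩ := hes.1 h
    obtain ⟨y', hy', e⟩ := hes.1 h'
    obtain rfl := hf (.inl hy') (.inl hy) e
    rw [hT.eout hy hy']
  · intro a l l' h h'
    obtain ⟨l, rfl⟩ := φ.surjective l
    obtain ⟨l', rfl⟩ := φ.surjective l'
    obtain ⟨y, hy, rfl⟩ := hms.1 h
    obtain ⟨y', hy', e⟩ := hms.1 h'
    obtain rfl := hg (.inl hy') (.inl hy) e
    rw [hT.mout hy hy']
  · intro a l l' h h'
    obtain ⟨l, rfl⟩ := φ.surjective l
    obtain ⟨l', rfl⟩ := φ.surjective l'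
    obtain ⟨y, hy, rfl⟩ := hmt.1 h
    obtain ⟨y', hy', e⟩ := hmt.1 h'
    obtain rfl := hg (.inr hy') (.inr hy) e
    rw [hT.min hy hy']
  · intro z l l' h h' hne
    obtain ⟨l, rfl⟩ := φ.surjective l
    obtain ⟨l', rfl⟩ := φ.surjective l'
    obtain ⟨y, hy, rfl⟩ := het.1 h
    obtain ⟨y', hy', e⟩ := het.1 h'
    obtain rfl := hf (.inr hy') (.inr hy) e
    rw [hsh, Shape.isDer_map]
    exact hT.ein hy hy' fun e => hne (e ▸ rfl)
  · rintro z l rfl h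
    obtain ⟨l, rfl⟩ := φ.surjective l
    obtain ⟨y, hy, e⟩ := het.1 h
    obtain ⟨k, _, hk, _⟩ := hG.rep.root
    obtain rfl := hf (.inr hy) (.inl hk) (by rw [e, hroot]; rfl)
    exact hT.root_target rfl hy
  · intro z l h
    obtain ⟨l, rfl⟩ := φ.surjective l
    obtain ⟨y, hy, rfl⟩ := hes.1 h
    rcases hT.src_tgt hy with rfl | ⟨l', hl'⟩
    · exact .inl (by rw [hroot]; rfl)
    · exact .inr ⟨φ l', het.2 ⟨y, hl', rfl⟩⟩
  · intro n hnX
    obtain ⟨l, hl⟩ := hT.name_tgt n hnX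
    exact ⟨φ l, het.2 ⟨_, hl, rfl⟩⟩
  · intro z l h
    obtain ⟨l, rfl⟩ := φ.surjective l
    obtain ⟨y, hy, rfl⟩ := het.1 h
    rcases hT.tgt_src hy with ⟨l', hl'⟩ | ⟨n, hnX, rfl⟩
    · exact .inl ⟨φ l', hes.2 ⟨y, hl', rfl⟩⟩
    · exact .inr ⟨n, hnX, rfl⟩
  · intro p a x b w z hp hwz
    obtain ⟨p, rfl⟩ := φ.surjective p
    obtain ⟨w, rfl⟩ := φ.surjective w
    rw [hsh] at hp hwz
    obtain ⟨a, x, b, hp'⟩ : (G.shape p).IsPar := by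
      rw [← Shape.isPar_map _ (Sum.map id ε) μ]; exact ⟨_, _, _, hp⟩
    obtain ⟨z, hw'⟩ : (G.shape w).IsWeak := by
      rw [← Shape.isWeak_map _ (Sum.map id ε) μ]; exact ⟨_, hwz⟩
    rw [hp', Shape.map] at hp
    rw [hw', Shape.map] at hwz
    cases hp
    cases hwz
    rw [hbox p ⟨_, _, _, hp'⟩, φ.injective.mem_set_image, hT.weak_box hp' hw']
    have hz : z ∈ (G.shape w).eTargets := by simp [hw', Shape.eTargets]
    constructor
    · rintro (rfl | ⟨l, hl, hzl⟩)
      · exact .inl rfl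
      · exact .inr ⟨φ l, ⟨l, hl, rfl⟩, hes.2 ⟨z, hzl, rfl⟩⟩
    · rintro (e | ⟨-, ⟨l, hl, rfl⟩, hzl⟩)
      · exact .inl (hf (l' := p) (.inr hz) (.inl (by simp [hp', Shape.eSources])) e)
      · obtain ⟨y, hy, e⟩ := hes.1 hzl
        exact .inr ⟨l, hl, hf (.inl hy) (.inr hz) e ▸ hy⟩
  · have hs : Sim G K (fun l => {φ l}) (Sum.map id ε) μ ∅ := by
      refine ⟨fun h => by simpa using h, fun l _ _ => ⟨φ l, rfl, hsh l, fun hp => ?_⟩⟩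
      rw [hbox l hp]
      ext k
      rw [Set.mem_iUnion₂]
      constructor
      · rintro ⟨⟨k, hk, rfl⟩, hkw⟩
        exact ⟨k, ⟨hk, fun h => hkw (hw.2 h)⟩, rfl⟩
      · rintro ⟨k, hk, rfl⟩
        exact ⟨⟨k, hk.1, rfl⟩, fun h => hk.2 (hw.1 h)⟩
    have := hG.rep.transport hs (Set.disjoint_empty _)
    have e1 : (⋃ l ∈ G.nw Set.univ, {φ l}) = K.nw Set.univ := by
      ext k
      rw [Set.mem_iUnion₂]
      constructor
      · rintro ⟨k, hk, rfl⟩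
        exact ⟨trivial, fun h => hk.2 (hw.1 h)⟩
      · intro hk
        obtain ⟨k, rfl⟩ := φ.surjective k
        exact ⟨k, ⟨trivial, fun h => hk.2 (hw.2 h)⟩, rfl⟩
    rw [e1] at this
    rw [hroot]
    exact this

/-! ### Uniqueness of the net represented by a term -/

/-- Two links have the same label, and their sources and targets are related by `P` and `N`. -/
def Shape.Rel {E M E' M' : Type} (P : E → E' → Prop) (N : M → M' → Prop) :
    Shape E M → Shape E' M' → Prop
  | .bang s a, .bang s' a' => P s s' ∧ N a a'
  | .der a z, .der a' z' => N a a' ∧ P z z'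
  | .weak z, .weak z' => P z z'
  | .par a x b, .par a' x' b' => N a a' ∧ P x x' ∧ P b b'
  | .tensor s a y, .tensor s' a' y' => P s s' ∧ N a a' ∧ P y y'
  | _, _ => False

namespace Shape.Rel

variable {E M E' M' : Type} {P P' : E → E' → Prop} {N N' : M → M' → Prop} {s : Shape E M}
  {s' : Shape E' M'}

theorem mono (h : s.Rel P N s') (hP : ∀ z z', P z z' → P' z z') (hN : ∀ a a', N a a' → N' a a') :
    s.Rel P' N' s' := by
  cases s <;> cases s' <;> simp only [Shape.Rel] at h ⊢ <;> grind

theorem symm (h : s.Rel P N s') : s'.Rel (flip P) (flip N) s := by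
  cases s <;> cases s' <;> exact h

theorem eSource (h : s.Rel P N s') {z} (hz : z ∈ s.eSources) : ∃ z' ∈ s'.eSources, P z z' := by
  cases s <;> cases s' <;> simp_all [Shape.Rel, eSources]

theorem eTarget (h : s.Rel P N s') {z} (hz : z ∈ s.eTargets) : ∃ z' ∈ s'.eTargets, P z z' := by
  cases s <;> cases s' <;> simp_all [Shape.Rel, eTargets]

theorem mSource (h : s.Rel P N s') {a} (ha : a ∈ s.mSources) : ∃ a' ∈ s'.mSources, N a a' := by
  cases s <;> cases s' <;> simp_all [Shape.Rel, mSources]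

theorem mTarget (h : s.Rel P N s') {a} (ha : a ∈ s.mTargets) : ∃ a' ∈ s'.mTargets, N a a' := by
  cases s <;> cases s' <;> simp_all [Shape.Rel, mTargets]

theorem isPar (h : s.Rel P N s') (hs : s.IsPar) : s'.IsPar := by
  cases s <;> cases s' <;> simp_all [Shape.Rel, IsPar]

theorem eq_map (h : s.Rel P N s') {f : E → E'} {g : M → M'} (hf : ∀ z z', P z z' → z' = f z)
    (hg : ∀ a a', N a a' → a' = g a) : s' = s.map f g := by
  cases s <;> cases s' <;> simp only [Shape.Rel] at h <;> simp only [map] <;> grind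

end Shape.Rel

section

variable {G K : Net}

/-- The nodes are sources of corresponding links. -/
def ESrc (Q : G.Link → K.Link → Prop) (z : ℕ ⊕ G.E) (z' : ℕ ⊕ K.E) : Prop :=
  ∃ l l', Q l l' ∧ z ∈ (G.shape l).eSources ∧ z' ∈ (K.shape l').eSources

/-- The multiplicative nodes are sources of corresponding links. -/
def MSrc (Q : G.Link → K.Link → Prop) (a : G.M) (a' : K.M) : Prop :=
  ∃ l l', Q l l' ∧ a ∈ (G.shape l).mSources ∧ a' ∈ (K.shape l').mSources

/-- A bijective correspondence between links of two nets that respects boxes. -/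
structure Matching (G K : Net) (Q : G.Link → K.Link → Prop) (S : Set G.Link) (S' : Set K.Link) :
    Prop where
  left : ∀ {l l'}, Q l l' → l ∈ S ∧ ¬ (G.shape l).IsWeak
  right : ∀ {l l'}, Q l l' → l' ∈ S' ∧ ¬ (K.shape l').IsWeak
  ex : ∀ l ∈ S, ∃ l', Q l l'
  ex' : ∀ l' ∈ S', ∃ l, Q l l'
  fn : ∀ {l l' l''}, Q l l' → Q l l'' → l' = l''
  inj : ∀ {l l' k}, Q l k → Q l' k → l = l'
  box_left : ∀ {l l'}, Q l l' → (G.shape l).IsPar → G.nw (G.box l) ⊆ S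
  box_right : ∀ {l l'}, Q l l' → (G.shape l).IsPar → K.nw (K.box l') ⊆ S'
  box : ∀ {l l' k k'}, Q l l' → Q k k' → (G.shape l).IsPar → (k ∈ G.box l ↔ k' ∈ K.box l')

namespace Matching

variable {Q Q₁ Q₂ : G.Link → K.Link → Prop} {S S₁ S₂ : Set G.Link} {S' S₁' S₂' : Set K.Link}

theorem union (h₁ : Matching G K Q₁ S₁ S₁') (h₂ : Matching G K Q₂ S₂ S₂') (hd : Disjoint S₁ S₂)
    (hd' : Disjoint S₁' S₂') :
    Matching G K (fun l l' => Q₁ l l' ∨ Q₂ l l') (S₁ ∪ S₂) (S₁' ∪ S₂') := by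
  have hn : ∀ {l}, l ∈ S₁ → l ∈ S₂ → False := fun h h' => Set.disjoint_left.1 hd h h'
  have hn' : ∀ {l}, l ∈ S₁' → l ∈ S₂' → False := fun h h' => Set.disjoint_left.1 hd' h h'
  refine ⟨?_, ?_, ?_, ?_, ?_, ?_, ?_, ?_, ?_⟩
  · rintro l l' (h | h)
    exacts [⟨.inl (h₁.left h).1, (h₁.left h).2⟩, ⟨.inr (h₂.left h).1, (h₂.left h).2⟩]
  · rintro l l' (h | h)
    exacts [⟨.inl (h₁.right h).1, (h₁.right h).2⟩, ⟨.inr (h₂.right h).1, (h₂.right h).2⟩]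
  · rintro l (h | h)
    exacts [(h₁.ex l h).imp fun _ h => .inl h, (h₂.ex l h).imp fun _ h => .inr h]
  · rintro l (h | h)
    exacts [(h₁.ex' l h).imp fun _ h => .inl h, (h₂.ex' l h).imp fun _ h => .inr h]
  · rintro l l' l'' (h | h) (h' | h')
    exacts [h₁.fn h h', (hn (h₁.left h).1 (h₂.left h').1).elim,
      (hn (h₁.left h').1 (h₂.left h).1).elim, h₂.fn h h']
  · rintro l l' k (h | h) (h' | h')
    exacts [h₁.inj h h', (hn' (h₁.right h).1 (h₂.right h').1).elim,
      (hn' (h₁.right h').1 (h₂.right h).1).elim, h₂.inj h h']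
  · rintro l l' (h | h) hp
    exacts [(h₁.box_left h hp).trans Set.subset_union_left,
      (h₂.box_left h hp).trans Set.subset_union_right]
  · rintro l l' (h | h) hp
    exacts [(h₁.box_right h hp).trans Set.subset_union_left,
      (h₂.box_right h hp).trans Set.subset_union_right]
  · rintro l l' k k' (h | h) (h' | h') hp
    · exact h₁.box h h' hp
    · have := h₂.left h'
      have := h₂.right h'
      exact ⟨fun hk => (hn (h₁.box_left h hp ⟨hk, by tauto⟩) (by tauto)).elim,
        fun hk => (hn' (h₁.box_right h hp ⟨hk, by tauto⟩) (by tauto)).elim⟩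
    · have := h₁.left h'
      have := h₁.right h'
      exact ⟨fun hk => (hn (by tauto) (h₂.box_left h hp ⟨hk, by tauto⟩)).elim,
        fun hk => (hn' (by tauto) (h₂.box_right h hp ⟨hk, by tauto⟩)).elim⟩
    · exact h₂.box h h' hp

theorem insert (h : Matching G K Q S S') {c c'} (hc : c ∉ S) (hc' : c' ∉ S')
    (hw : ¬ (G.shape c).IsWeak) (hw' : ¬ (K.shape c').IsWeak)
    (hbox : (G.shape c).IsPar →
      S = G.nw (G.box c) ∧ S' = K.nw (K.box c') ∧ c ∉ G.box c ∧ c' ∉ K.box c') :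
    Matching G K (fun l l' => (l = c ∧ l' = c') ∨ Q l l') (insert c S) (insert c' S') := by
  refine ⟨?_, ?_, ?_, ?_, ?_, ?_, ?_, ?_, ?_⟩
  · rintro l l' (⟨rfl, rfl⟩ | h')
    exacts [⟨.inl rfl, hw⟩, ⟨.inr (h.left h').1, (h.left h').2⟩]
  · rintro l l' (⟨rfl, rfl⟩ | h')
    exacts [⟨.inl rfl, hw'⟩, ⟨.inr (h.right h').1, (h.right h').2⟩]
  · rintro l (rfl | h')
    exacts [⟨c', .inl ⟨rfl, rfl⟩⟩, (h.ex l h').imp fun _ h => .inr h]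
  · rintro l (rfl | h')
    exacts [⟨c, .inl ⟨rfl, rfl⟩⟩, (h.ex' l h').imp fun _ h => .inr h]
  · rintro l l' l'' (⟨rfl, rfl⟩ | h₁) (⟨h₂, rfl⟩ | h₂)
    exacts [rfl, (hc (h.left h₂).1).elim, (hc (h₂ ▸ (h.left h₁).1)).elim, h.fn h₁ h₂]
  · rintro l l' k (⟨rfl, rfl⟩ | h₁) (⟨rfl, h₂⟩ | h₂)
    exacts [rfl, (hc' (h.right h₂).1).elim, (hc' (h₂ ▸ (h.right h₁).1)).elim, h.inj h₁ h₂]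
  · rintro l l' (⟨rfl, rfl⟩ | h') hp
    · rw [← (hbox hp).1]; exact Set.subset_insert _ _
    · exact (h.box_left h' hp).trans (Set.subset_insert _ _)
  · rintro l l' (⟨rfl, rfl⟩ | h') hp
    · rw [← (hbox hp).2.1]; exact Set.subset_insert _ _
    · exact (h.box_right h' hp).trans (Set.subset_insert _ _)
  · rintro l l' k k' (⟨rfl, rfl⟩ | h₁) (⟨rfl, rfl⟩ | h₂) hp
    · obtain ⟨-, -, h₁, h₂⟩ := hbox hp
      exact ⟨fun h => (h₁ h).elim, fun h => (h₂ h).elim⟩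
    · have h₃ := (h.left h₂).1
      have h₄ := (h.right h₂).1
      rw [(hbox hp).1] at h₃
      rw [(hbox hp).2.1] at h₄
      exact ⟨fun _ => h₄.1, fun _ => h₃.1⟩
    · exact ⟨fun hk => (hc (h.box_left h₁ hp ⟨hk, hw⟩)).elim,
        fun hk => (hc' (h.box_right h₁ hp ⟨hk, hw'⟩)).elim⟩
    · exact h.box h₁ h₂ hp

theorem empty : Matching G K (fun _ _ => False) ∅ ∅ := by
  refine ⟨?_, ?_, ?_, ?_, ?_, ?_, ?_, ?_, ?_⟩ <;> simp

end Matching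

/-- Corresponding links have corresponding nodes, where the nodes of the free variables correspond
by the environments `ρ` and `ρ'`. -/
def Respects (Q : G.Link → K.Link → Prop) (ρ : ℕ → ℕ ⊕ G.E) (ρ' : ℕ → ℕ ⊕ K.E) : Prop :=
  ∀ l l', Q l l' → (G.shape l).Rel (fun z z' => ESrc Q z z' ∨ ∃ n, z = ρ n ∧ z' = ρ' n) (MSrc Q)
    (K.shape l')

/-- Correspondence of links persists when links are added, and when variables become bound. -/
theorem Respects.rel {Q Q' : G.Link → K.Link → Prop} {ρ₀ ρ : ℕ → ℕ ⊕ G.E}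
    {ρ₀' ρ' : ℕ → ℕ ⊕ K.E} (h : Respects Q ρ₀ ρ₀')
    (hQ : ∀ l l', Q l l' → Q' l l')
    (hρ : ∀ n, ESrc Q' (ρ₀ n) (ρ₀' n) ∨ ∃ m, ρ₀ n = ρ m ∧ ρ₀' n = ρ' m) {l l'} (hl : Q l l') :
    (G.shape l).Rel (fun z z' => ESrc Q' z z' ∨ ∃ n, z = ρ n ∧ z' = ρ' n) (MSrc Q')
      (K.shape l') := by
  refine (h l l' hl).mono ?_ ?_
  · rintro z z' (⟨k, k', hk, h⟩ | ⟨n, rfl, rfl⟩)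
    · exact .inl ⟨k, k', hQ _ _ hk, h⟩
    · exact hρ n
  · rintro a a' ⟨k, k', hk, h⟩
    exact ⟨k, k', hQ _ _ hk, h⟩

mutual
theorem Val.Rep.exists_matching {v : Val} {ρ a S ρ' a' S'} (h : v.Rep G ρ a S)
    (h' : v.Rep K ρ' a' S') :
    ∃ Q, Matching G K Q S S' ∧ Respects Q ρ ρ' ∧ MSrc Q a a' := by
  match v, h, h' with
  | .var n, ⟨d, hd, hS⟩, ⟨d', hd', hS'⟩ =>
    subst hS hS'
    have hm := (Matching.empty (G := G) (K := K)).insert (c := d) (c' := d') id id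
      (by simp [hd, Shape.IsWeak]) (by simp [hd', Shape.IsWeak]) (by simp [hd, Shape.IsPar])
    have ha : MSrc (G := G) (K := K) (fun l l' => (l = d ∧ l' = d') ∨ False) a a' :=
      ⟨d, d', .inl ⟨rfl, rfl⟩, by simp [hd, Shape.mSources], by simp [hd', Shape.mSources]⟩
    refine ⟨_, by simpa using hm, ?_, ha⟩
    rintro l l' (⟨rfl, rfl⟩ | h)
    · rw [hd, hd']
      exact ⟨ha, .inr ⟨n, rfl, rfl⟩⟩
    · exact h.elim
  | .lam t, ⟨p, x, b, hp, hpp, hS, ht⟩, ⟨p', x', b', hp', hpp', hS', ht'⟩ =>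
    subst hS hS'
    obtain ⟨Q, hQ, hr, k, k', hk, hb⟩ := ht.exists_matching ht'
    have hm := hQ.insert (c := p) (c' := p') (fun h => hpp h.1) (fun h => hpp' h.1)
      (by simp [hp, Shape.IsWeak]) (by simp [hp', Shape.IsWeak])
      fun _ => ⟨rfl, rfl, hpp, hpp'⟩
    have ha : MSrc (fun l l' => (l = p ∧ l' = p') ∨ Q l l') a a' :=
      ⟨p, p', .inl ⟨rfl, rfl⟩, by simp [hp, Shape.mSources], by simp [hp', Shape.mSources]⟩
    have hx : ESrc (fun l l' => (l = p ∧ l' = p') ∨ Q l l') x x' :=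
      ⟨p, p', .inl ⟨rfl, rfl⟩, by simp [hp, Shape.eSources], by simp [hp', Shape.eSources]⟩
    refine ⟨_, hm, ?_, ha⟩
    rintro l l' (⟨rfl, rfl⟩ | h)
    · rw [hp, hp']
      exact ⟨ha, .inl hx, .inl ⟨k, k', .inr hk, hb⟩⟩
    · refine hr.rel (fun _ _ => .inr) ?_ h
      rintro (_ | n)
      · exact .inl hx
      · exact .inr ⟨n, rfl, rfl⟩
/-- Two representations of the same term correspond to each other link by link. -/
theorem Tm.Rep.exists_matching {t : Tm} {ρ r S ρ' r' S'} (h : t.Rep G ρ r S)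
    (h' : t.Rep K ρ' r' S') :
    ∃ Q, Matching G K Q S S' ∧ Respects Q ρ ρ' ∧ ESrc Q r r' := by
  match t, h, h' with
  | .val v, ⟨c, a, T, hc, hcT, hS, hv⟩, ⟨c', a', T', hc', hcT', hS', hv'⟩ =>
    subst hS hS'
    obtain ⟨Q, hQ, hr, k, k', hk, ha⟩ := hv.exists_matching hv'
    have hm := hQ.insert hcT hcT' (by simp [hc, Shape.IsWeak]) (by simp [hc', Shape.IsWeak])
      (by simp [hc, Shape.IsPar])
    have he : ESrc (fun l l' => (l = c ∧ l' = c') ∨ Q l l') r r' :=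
      ⟨c, c', .inl ⟨rfl, rfl⟩, by simp [hc, Shape.eSources], by simp [hc', Shape.eSources]⟩
    refine ⟨_, hm, ?_, he⟩
    rintro l l' (⟨rfl, rfl⟩ | h)
    · rw [hc, hc']
      exact ⟨.inl he, k, k', .inr hk, ha⟩
    · exact hr.rel (fun _ _ => .inr) (fun n => .inr ⟨n, rfl, rfl⟩) h
  | .app v s, ⟨c, a, y, T, U, hc, hcT, hcU, hd, hS, hv, hs⟩,
      ⟨c', a', y', T', U', hc', hcT', hcU', hd', hS', hv', hs'⟩ =>
    subst hS hS'
    obtain ⟨Q₁, hQ₁, hr₁, k, k', hk, ha⟩ := hv.exists_matching hv'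
    obtain ⟨Q₂, hQ₂, hr₂, j, j', hj, hy⟩ := hs.exists_matching hs'
    have hm := (hQ₁.union hQ₂ hd hd').insert (c := c) (c' := c') (by simp [hcT, hcU])
      (by simp [hcT', hcU']) (by simp [hc, Shape.IsWeak]) (by simp [hc', Shape.IsWeak])
      (by simp [hc, Shape.IsPar])
    have he : ESrc (fun l l' => (l = c ∧ l' = c') ∨ Q₁ l l' ∨ Q₂ l l') r r' :=
      ⟨c, c', .inl ⟨rfl, rfl⟩, by simp [hc, Shape.eSources], by simp [hc', Shape.eSources]⟩
    refine ⟨_, hm, ?_, he⟩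
    rintro l l' (⟨rfl, rfl⟩ | h | h)
    · rw [hc, hc']
      exact ⟨.inl he, ⟨k, k', .inr (.inl hk), ha⟩, .inl ⟨j, j', .inr (.inr hj), hy⟩⟩
    · exact hr₁.rel (fun _ _ h => .inr (.inl h)) (fun n => .inr ⟨n, rfl, rfl⟩) h
    · exact hr₂.rel (fun _ _ h => .inr (.inr h)) (fun n => .inr ⟨n, rfl, rfl⟩) h
  | .sub t u, ⟨y, T, U, hd, hS, ht, hu⟩, ⟨y', T', U', hd', hS', ht', hu'⟩ =>
    subst hS hS'
    obtain ⟨Q₁, hQ₁, hr₁, k, k', hk, hb⟩ := ht.exists_matching ht'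
    obtain ⟨Q₂, hQ₂, hr₂, j, j', hj, hy⟩ := hu.exists_matching hu'
    refine ⟨_, hQ₁.union hQ₂ hd hd', ?_, k, k', .inl hk, hb⟩
    rintro l l' (h | h)
    · refine hr₁.rel (fun _ _ => .inl) ?_ h
      rintro (_ | n)
      · exact .inl ⟨j, j', .inr hj, hy⟩
      · exact .inr ⟨n, rfl, rfl⟩
    · exact hr₂.rel (fun _ _ => .inr) (fun n => .inr ⟨n, rfl, rfl⟩) h
end

/-- A correspondence between all links of `G` and `K` that are not weakenings, for representations
of the same term. -/
structure Twins (G K : Net) (X : Set ℕ) (Q : G.Link → K.Link → Prop) : Prop where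
  tidy : G.IsTidy X
  tidy' : K.IsTidy X
  matching : Matching G K Q (G.nw Set.univ) (K.nw Set.univ)
  respects : Respects Q Sum.inl Sum.inl
  root : ESrc Q (Sum.inr G.root) (Sum.inr K.root)

/-- The nodes are sources of corresponding links, or they have the same name. -/
def ENode (Q : G.Link → K.Link → Prop) (z : ℕ ⊕ G.E) (z' : ℕ ⊕ K.E) : Prop :=
  ESrc Q z z' ∨ ∃ n, z = Sum.inl n ∧ z' = Sum.inl n

/-- Correspondence of all links: weakenings correspond if their targets do. -/
def Total (Q : G.Link → K.Link → Prop) (l : G.Link) (l' : K.Link) : Prop :=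
  Q l l' ∨ ∃ z z', G.shape l = .weak z ∧ K.shape l' = .weak z' ∧ ENode Q z z'

theorem ENode.symm {Q : G.Link → K.Link → Prop} {z z'} (h : ENode Q z z') :
    ENode (G := K) (K := G) (flip Q) z' z := by
  rcases h with ⟨l, l', h, h1, h2⟩ | ⟨n, h1, h2⟩
  · exact .inl ⟨l', l, h, h2, h1⟩
  · exact .inr ⟨n, h2, h1⟩

theorem Total.symm {Q : G.Link → K.Link → Prop} {l l'} (h : Total Q l l') :
    Total (G := K) (K := G) (flip Q) l' l := by
  rcases h with h | ⟨z, z', h1, h2, h⟩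
  · exact .inl h
  · exact .inr ⟨z', z, h2, h1, h.symm⟩

namespace Twins

variable {X : Set ℕ} {Q : G.Link → K.Link → Prop}

theorem symm (h : Twins G K X Q) : Twins K G X (flip Q) where
  tidy := h.tidy'
  tidy' := h.tidy
  matching := by
    have hm := h.matching
    have hp : ∀ {l l'}, Q l l' → (K.shape l').IsPar → (G.shape l).IsPar :=
      fun hl hp => (h.respects _ _ hl).symm.isPar hp
    exact ⟨hm.right, hm.left, hm.ex', hm.ex, hm.inj, hm.fn,
      fun hl hl' => hm.box_right hl (hp hl hl'), fun hl hl' => hm.box_left hl (hp hl hl'),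
      fun hl hk hl' => (hm.box hl hk (hp hl hl')).symm⟩
  respects := by
    intro l l' hl
    refine (h.respects _ _ hl).symm.mono ?_ ?_
    · exact fun z z' hz => ENode.symm hz
    · rintro a a' ⟨k, k', hk, h1, h2⟩
      exact ⟨k', k, hk, h2, h1⟩
  root := by
    obtain ⟨l, l', hl, h1, h2⟩ := h.root
    exact ⟨l', l, hl, h2, h1⟩

theorem node_unique (h : Twins G K X Q) {z z' z''} (h1 : ENode Q z z') (h2 : ENode Q z z'') :
    z' = z'' := by
  rcases h1 with ⟨l, l', hl, hz, hz'⟩ | ⟨n, rfl, rfl⟩ <;>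
    rcases h2 with ⟨k, k', hk, hy, hy'⟩ | ⟨m, hm, rfl⟩
  · obtain rfl := h.tidy.eout hz hy
    obtain rfl := h.matching.fn hl hk
    exact Shape.eSources_unique hz' hy'
  · exact (h.tidy.names m l (hm ▸ hz)).elim
  · exact (h.tidy.names n k hy).elim
  · exact congrArg Sum.inl (Sum.inl.inj hm)

theorem mNode_unique (h : Twins G K X Q) {a a' a''} (h1 : MSrc Q a a') (h2 : MSrc Q a a'') :
    a' = a'' := by
  obtain ⟨l, l', hl, hz, hz'⟩ := h1
  obtain ⟨k, k', hk, hy, hy'⟩ := h2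
  obtain rfl := h.tidy.mout hz hy
  obtain rfl := h.matching.fn hl hk
  exact Shape.mSources_unique hz' hy'

theorem exists_source (h : Twins G K X Q) {l z} (hz : z ∈ (G.shape l).eSources) :
    ∃ l' z', Q l l' ∧ z' ∈ (K.shape l').eSources ∧ ENode Q z z' := by
  obtain ⟨l', hl⟩ := h.matching.ex l ⟨trivial, Shape.not_isWeak_of_eSource hz⟩
  obtain ⟨z', hz', hzz⟩ := (h.respects _ _ hl).eSource hz
  exact ⟨l', z', hl, hz', hzz⟩

/-- The links that are not weakenings determine the targets of the weakenings: these are the nodes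
that need an incoming link and have no other. -/
theorem exists_total (h : Twins G K X Q) (l : G.Link) : ∃ l', Total Q l l' := by
  by_cases hw : (G.shape l).IsWeak
  · obtain ⟨z, hz⟩ := hw
    have hzl : z ∈ (G.shape l).eTargets := by simp [hz, Shape.eTargets]
    obtain ⟨l', z', hzz, hl'⟩ : ∃ l' z', ENode Q z z' ∧ z' ∈ (K.shape l').eTargets := by
      rcases h.tidy.tgt_src hzl with ⟨k, hk⟩ | ⟨n, hn, rfl⟩
      · obtain ⟨k', z', hkk, hz', hzz⟩ := h.exists_source hk
        rcases h.tidy'.src_tgt hz' with rfl | ⟨l', hl'⟩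
        · obtain rfl := h.symm.node_unique hzz.symm (.inl h.symm.root)
          exact (h.tidy.root_target rfl hzl).elim
        · exact ⟨l', z', hzz, hl'⟩
      · obtain ⟨l', hl'⟩ := h.tidy'.name_tgt n hn
        exact ⟨l', _, .inr ⟨n, rfl, rfl⟩, hl'⟩
    refine ⟨l', .inr ⟨z, z', hz, ?_, hzz⟩⟩
    -- otherwise a link of `G` besides the weakening `l` would be on `z`
    have hw : (K.shape l').IsWeak := by
      by_contra hw
      obtain ⟨k, hk⟩ := h.matching.ex' l' ⟨trivial, hw⟩
      obtain ⟨y, hy, hyz⟩ := (h.symm.respects _ _ hk).eTarget hl'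
      obtain rfl := h.symm.node_unique hyz hzz.symm
      have hkl : l ≠ k := by
        rintro rfl
        exact (h.matching.left hk).2 ⟨_, hz⟩
      exact (h.tidy.ein hzl hy hkl).not_isWeak ⟨_, hz⟩
    obtain ⟨y, hy⟩ := hw
    obtain rfl : z' = y := by simpa [hy, Shape.eTargets] using hl'
    exact hy
  · exact (h.matching.ex l ⟨trivial, hw⟩).imp fun _ => .inl

theorem total_unique (h : Twins G K X Q) {l l' l''} (h1 : Total Q l l') (h2 : Total Q l l'') :
    l' = l'' := by
  rcases h1 with h1 | ⟨z, z', hz, hz', hzz⟩ <;> rcases h2 with h2 | ⟨y, y', hy, hy', hyy⟩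
  · exact h.matching.fn h1 h2
  · exact ((h.matching.left h1).2 ⟨_, hy⟩).elim
  · exact ((h.matching.left h2).2 ⟨_, hz⟩).elim
  · obtain rfl : z = y := by simpa [hz] using hy
    obtain rfl := h.node_unique hzz hyy
    by_contra hne
    have := h.tidy'.ein (z := z') (by simp [hz', Shape.eTargets])
      (by simp [hy', Shape.eTargets]) hne
    exact this.not_isWeak ⟨_, hz'⟩

theorem rel (h : Twins G K X Q) {l l'} (hl : Total Q l l') :
    (G.shape l).Rel (ENode Q) (MSrc Q) (K.shape l') := by
  rcases hl with hl | ⟨z, z', hz, hz', hzz⟩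
  · exact h.respects _ _ hl
  · rw [hz, hz']; exact hzz

theorem mem_box (h : Twins G K X Q) {p p' l l'} (hp : Total Q p p') (hl : Total Q l l')
    (hpar : (G.shape p).IsPar) (hlp : l ∈ G.box p) : l' ∈ K.box p' := by
  obtain ⟨a, x, b, hpa⟩ := id hpar
  rcases hp with hp | ⟨z, _, hz, _⟩
  swap
  · simp [hpa] at hz
  rcases hl with hl | ⟨z, z', hz, hz', hzz⟩
  · exact (h.matching.box hp hl hpar).1 hlp
  · obtain ⟨a', x', b', hpa'⟩ := (h.respects _ _ hp).isPar hpar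
    refine (h.tidy'.weak_box hpa' hz').2 ?_
    rcases (h.tidy.weak_box hpa hz).1 hlp with rfl | ⟨k, hk, hzk⟩
    · have hx : z ∈ (G.shape p).eSources := by simp [hpa, Shape.eSources]
      obtain ⟨y, hy, hzy⟩ := (h.respects _ _ hp).eSource hx
      obtain rfl := h.node_unique hzz hzy
      exact .inl (by simpa [hpa', Shape.eSources] using hy)
    · obtain ⟨k', y, hkk, hy, hzy⟩ := h.exists_source hzk
      obtain rfl := h.node_unique hzz hzy
      exact .inr ⟨k', (h.matching.box hp hkk hpar).1 hk, hy⟩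

/-- The total correspondence is a bijection on links, and the correspondences of nodes are injective
functions on the nodes. -/
theorem iso (h : Twins G K X Q) : G.Iso K := by
  classical
  choose f hf using h.exists_total
  choose g hg using h.symm.exists_total
  have hfg : ∀ l, f (g l) = l := fun l => h.total_unique (hf _) (hg l).symm
  have hgf : ∀ l, g (f l) = l := fun l => h.symm.total_unique (hg _) (hf l).symm
  -- the value of `μ` at elements of `G.M` that are not nodes
  obtain ⟨a₀⟩ : Nonempty K.M := by
    obtain ⟨l, l', hl, -, hr⟩ := h.root
    cases e : K.shape l' with
    | bang s a => exact ⟨a⟩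
    | der a z => exact ⟨a⟩
    | weak z => simp [e, Shape.eSources] at hr
    | par a x b => exact ⟨a⟩
    | tensor s a y => exact ⟨a⟩
  let ε : G.E → K.E := fun e =>
    if he : ∃ e', ENode Q (Sum.inr e) (Sum.inr e') then he.choose else K.root
  let μ : G.M → K.M := fun a => if ha : ∃ a', MSrc Q a a' then ha.choose else a₀
  have hε : ∀ z z', ENode Q z z' → z' = Sum.map id ε z := by
    rintro (n | e) z' hz
    · exact h.node_unique hz (.inr ⟨n, rfl, rfl⟩)
    · rcases z' with n | e'
      · rcases hz with ⟨l, l', -, -, hl⟩ | ⟨m, hm, -⟩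
        · exact (h.tidy'.names n l' hl).elim
        · cases hm
      · have he : ∃ e', ENode Q (Sum.inr e) (Sum.inr e') := ⟨e', hz⟩
        refine h.node_unique hz ?_
        simp only [Sum.map_inr, ε, dif_pos he]
        exact he.choose_spec
  have hμ : ∀ a a', MSrc Q a a' → a' = μ a := by
    intro a a' ha
    have he : ∃ a', MSrc Q a a' := ⟨a', ha⟩
    refine h.mNode_unique ha ?_
    simp only [μ, dif_pos he]
    exact he.choose_spec
  have hnode : ∀ z ∈ G.eNodes Set.univ, ENode Q z (Sum.map id ε z) := by
    rintro z ⟨l, -, hz | hz⟩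
    · obtain ⟨z', -, hzz⟩ := (h.rel (hf l)).eSource hz
      exact hε _ _ hzz ▸ hzz
    · obtain ⟨z', -, hzz⟩ := (h.rel (hf l)).eTarget hz
      exact hε _ _ hzz ▸ hzz
  have hmnode : ∀ a ∈ G.mNodes Set.univ, MSrc Q a (μ a) := by
    rintro a ⟨l, -, hz | hz⟩
    · obtain ⟨z', -, hzz⟩ := (h.rel (hf l)).mSource hz
      exact hμ _ _ hzz ▸ hzz
    · obtain ⟨z', -, hzz⟩ := (h.rel (hf l)).mTarget hz
      exact hμ _ _ hzz ▸ hzz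
  refine ⟨⟨f, g, hgf, hfg⟩, ε, μ, ?_, ?_, ?_, ?_, ?_⟩
  · intro e he e' he' hee
    have h1 := hnode _ he
    have h2 := hnode _ he'
    simp only [Sum.map_inr] at h1 h2
    rw [hee] at h1
    exact Sum.inr.inj (h.symm.node_unique h1.symm h2.symm)
  · intro a ha a' ha' hee
    have h1 := hmnode _ ha
    have h2 := hmnode _ ha'
    rw [hee] at h1
    obtain ⟨l, l', hl, hz, hz'⟩ := h1
    obtain ⟨k, k', hk, hy, hy'⟩ := h2
    exact h.symm.mNode_unique ⟨l', l, hl, hz', hz⟩ ⟨k', k, hk, hy', hy⟩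
  · exact fun l => (h.rel (hf l)).eq_map hε hμ
  · intro p hp
    ext l'
    constructor
    · intro hl
      exact ⟨g l', h.symm.mem_box (hf p).symm (hg l') ((h.rel (hf p)).isPar hp) hl, hfg l'⟩
    · rintro ⟨l, hl, rfl⟩
      exact h.mem_box (hf p) (hf l) hp hl
  · exact Sum.inr.inj (hε _ _ (.inl h.root))

end Twins

end

/-- Up to isomorphism, only one net represents a given term. -/
theorem Net.Denotes.iso {G K : Net} {t : Tm} {X : Set ℕ} (hG : G.Denotes t X)
    (hK : K.Denotes t X) : G.Iso K := by
  obtain ⟨Q, hm, hr, h⟩ := hG.rep.exists_matching hK.rep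
  exact Twins.iso ⟨hG.tidy, hK.tidy, hm, hr, h⟩

/-! ### The translation represents the term -/

/-- The maps `φ` on links and `f` and `g` on nodes embed a hypergraph, given by its links and boxes,
into the net `G`.  Only the links are embedded injectively, since nodes may become identified, and
boxes need to agree only up to weakenings. -/
structure Embeds {E M L : Type} (shape : L → Shape (ℕ ⊕ E) M) (box : L → Set L) (G : Net)
    (φ : L → G.Link) (f : ℕ ⊕ E → ℕ ⊕ G.E) (g : M → G.M) : Prop where
  inj : Function.Injective φ
  shape_eq : ∀ l, G.shape (φ l) = (shape l).map f g
  box_eq : ∀ l, (shape l).IsPar → G.nw (G.box (φ l)) = φ '' {k ∈ box l | ¬ (shape k).IsWeak}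

namespace Embeds

variable {E M L E' M' L' : Type} {shape : L → Shape (ℕ ⊕ E) M} {box : L → Set L} {G : Net}
  {φ : L → G.Link} {f : ℕ ⊕ E → ℕ ⊕ G.E} {g : M → G.M}

theorem comp (h : Embeds shape box G φ f g) {shape' : L' → Shape (ℕ ⊕ E') M'}
    {box' : L' → Set L'} {i : L' → L} {f' : ℕ ⊕ E' → ℕ ⊕ E} {g' : M' → M}
    (hi : Function.Injective i) (hsh : ∀ l, shape (i l) = (shape' l).map f' g')
    (hbox : ∀ l, box (i l) = i '' box' l) :
    Embeds shape' box' G (φ ∘ i) (f ∘ f') (g ∘ g') where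
  inj := h.inj.comp hi
  shape_eq l := by rw [Function.comp_apply, h.shape_eq, hsh, Shape.map_map]
  box_eq l hl := by
    rw [Function.comp_apply, h.box_eq (i l) (by rwa [hsh, Shape.isPar_map]), hbox, Set.image_comp]
    congr 1
    ext k
    constructor
    · rintro ⟨⟨k, hk, rfl⟩, hw⟩
      exact ⟨k, ⟨hk, by rwa [hsh, Shape.isWeak_map] at hw⟩, rfl⟩
    · rintro ⟨k, hk, rfl⟩
      exact ⟨⟨k, hk.1, rfl⟩, by rw [hsh, Shape.isWeak_map]; exact hk.2⟩

theorem of_addWeak {B : Net} {W : Set ℕ} {φ : B.Link ⊕ W → G.Link} {f : ℕ ⊕ B.E → ℕ ⊕ G.E}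
    {g : B.M → G.M} (h : Embeds (B.addWeak W).shape (B.addWeak W).box G φ f g) :
    Embeds B.shape B.box G (φ ∘ Sum.inl) f g :=
  h.comp (i := Sum.inl) (f' := id) (g' := id) Sum.inl_injective
    (fun l => (Shape.map_id (B.shape l)).symm) fun _ => rfl

end Embeds

theorem comp_bindNode {E E' F : Type} (f : ℕ ⊕ E' → F) (x : E') (i : E → E') :
    (f ∘ bindNode x i) ∘ Sum.inl = cons (f (Sum.inr x)) (f ∘ Sum.inl) := by
  funext n; cases n <;> rfl

section

variable {G : Net}

mutual
theorem Val.rep_of_embeds (v : Val) {φ : v.content.Link → G.Link} {f : ℕ ⊕ v.content.E → ℕ ⊕ G.E}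
    {g : Option v.content.M → G.M} (h : Embeds v.content.shape v.content.box G φ f g) :
    v.Rep G (f ∘ Sum.inl) (g none) (φ '' {l | ¬ (v.content.shape l).IsWeak}) := by
  match v, φ, f, g, h with
  | .var n, φ, f, g, h =>
    refine ⟨φ (), h.shape_eq (), ?_⟩
    ext k
    constructor
    · rintro ⟨_, _, rfl⟩; rfl
    · rintro rfl; exact ⟨(), (by rintro ⟨z, hz⟩; cases hz), rfl⟩
  | .lam t, φ, f, g, h =>
    have hp := h.shape_eq none
    have hb : G.nw (G.box (φ none)) = _ := h.box_eq none ⟨_, _, _, rfl⟩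
    have he : Embeds t.net.shape t.net.box G ((φ ∘ some) ∘ Sum.inl)
        (f ∘ bindNode none some) (g ∘ some) :=
      Embeds.of_addWeak (h.comp (i := some) (Option.some_injective _) (fun _ => rfl) fun _ => rfl)
    have hT : G.nw (G.box (φ none)) =
        ((φ ∘ some) ∘ Sum.inl) '' {l | ¬ (t.net.shape l).IsWeak} := by
      rw [hb]
      ext k
      constructor
      · rintro ⟨_, ⟨⟨l | n, rfl⟩, hw⟩, rfl⟩
        · exact ⟨l, fun h => hw ((Shape.isWeak_map _ _ _).2 h), rfl⟩
        · exact (hw ⟨_, rfl⟩).elim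
      · rintro ⟨l, hw, rfl⟩
        exact ⟨some (.inl l), ⟨⟨.inl l, rfl⟩, fun h => hw ((Shape.isWeak_map _ _ _).1 h)⟩, rfl⟩
    refine ⟨φ none, _, _, hp, fun hmem => ?_, ?_, ?_⟩
    · have : φ none ∈ G.nw (G.box (φ none)) := ⟨hmem, by rw [hp]; rintro ⟨z, hz⟩; cases hz⟩
      rw [hb] at this
      obtain ⟨_, ⟨⟨k, rfl⟩, _⟩, hk⟩ := this
      cases h.inj hk
    · rw [hb]
      ext k
      constructor
      · rintro ⟨_ | l, hw, rfl⟩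
        · exact .inl rfl
        · exact .inr ⟨some l, ⟨⟨l, rfl⟩, hw⟩, rfl⟩
      · rintro (rfl | ⟨l, ⟨_, hw⟩, rfl⟩)
        · exact ⟨none, (by rintro ⟨z, hz⟩; cases hz), rfl⟩
        · exact ⟨l, hw, rfl⟩
    · rw [hT]
      exact (congrArg (fun ρ => t.Rep G ρ _ _) (comp_bindNode f none some)).mp (t.rep_of_embeds he)
/-- Wherever the translation of a term is embedded, the links that are not weakenings represent
the term. -/
theorem Tm.rep_of_embeds (t : Tm) {φ : t.net.Link → G.Link} {f : ℕ ⊕ t.net.E → ℕ ⊕ G.E}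
    {g : t.net.M → G.M} (h : Embeds t.net.shape t.net.box G φ f g) :
    t.Rep G (f ∘ Sum.inl) (f (Sum.inr t.net.root)) (φ '' {l | ¬ (t.net.shape l).IsWeak}) := by
  match t, φ, f, g, h with
  | .val v, φ, f, g, h =>
    have he : Embeds v.content.shape v.content.box G (φ ∘ some) (f ∘ Sum.map id some) (g ∘ id) :=
      h.comp (i := some) (Option.some_injective _) (fun _ => rfl) fun _ => rfl
    refine ⟨φ none, g none, _, h.shape_eq none, ?_, ?_, v.rep_of_embeds he⟩
    · rintro ⟨l, -, hl⟩
      cases h.inj hl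
    · ext k
      constructor
      · rintro ⟨_ | l, hw, rfl⟩
        · exact .inl rfl
        · exact .inr ⟨l, fun h => hw ((Shape.isWeak_map _ _ _).2 h), rfl⟩
      · rintro (rfl | ⟨l, hw, rfl⟩)
        · exact ⟨none, (by rintro ⟨z, hz⟩; cases hz), rfl⟩
        · exact ⟨some l, fun h => hw ((Shape.isWeak_map _ _ _).1 h), rfl⟩
  | .app v s, φ, f, g, h =>
    have he : Embeds v.content.shape v.content.box G (φ ∘ some ∘ Sum.inl)
        (f ∘ Sum.map id (some ∘ Sum.inl)) (g ∘ Sum.inl) :=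
      h.comp (i := some ∘ Sum.inl) ((Option.some_injective _).comp Sum.inl_injective)
        (fun _ => rfl) fun _ => rfl
    have he' : Embeds s.net.shape s.net.box G (φ ∘ some ∘ Sum.inr)
        (f ∘ Sum.map id (some ∘ Sum.inr)) (g ∘ Sum.inr) :=
      h.comp (i := some ∘ Sum.inr) ((Option.some_injective _).comp Sum.inr_injective)
        (fun _ => rfl) fun _ => rfl
    refine ⟨φ none, g (.inl none), _, _, _, h.shape_eq none, ?_, ?_, ?_, ?_, v.rep_of_embeds he,
      s.rep_of_embeds he'⟩
    · rintro ⟨l, -, hl⟩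
      cases h.inj hl
    · rintro ⟨l, -, hl⟩
      cases h.inj hl
    · rw [Set.disjoint_left]
      rintro _ ⟨l, -, rfl⟩ ⟨k, -, hk⟩
      cases h.inj hk
    · ext k
      constructor
      · rintro ⟨_ | l | l, hw, rfl⟩
        · exact .inl rfl
        · exact .inr (.inl ⟨l, fun h => hw ((Shape.isWeak_map _ _ _).2 h), rfl⟩)
        · exact .inr (.inr ⟨l, fun h => hw ((Shape.isWeak_map _ _ _).2 h), rfl⟩)
      · rintro (rfl | ⟨l, hw, rfl⟩ | ⟨l, hw, rfl⟩)
        · exact ⟨none, (by rintro ⟨z, hz⟩; cases hz), rfl⟩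
        · exact ⟨some (.inl l), fun h => hw ((Shape.isWeak_map _ _ _).1 h), rfl⟩
        · exact ⟨some (.inr l), fun h => hw ((Shape.isWeak_map _ _ _).1 h), rfl⟩
  | .sub t u, φ, f, g, h =>
    have he : Embeds t.net.shape t.net.box G ((φ ∘ Sum.inl) ∘ Sum.inl)
        (f ∘ bindNode (Sum.inr u.net.root) Sum.inl) (g ∘ Sum.inl) :=
      Embeds.of_addWeak (h.comp (i := Sum.inl) Sum.inl_injective (fun _ => rfl) fun _ => rfl)
    have he' : Embeds u.net.shape u.net.box G (φ ∘ Sum.inr) (f ∘ Sum.map id Sum.inr)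
        (g ∘ Sum.inr) :=
      h.comp (i := Sum.inr) Sum.inr_injective (fun _ => rfl) fun _ => rfl
    refine ⟨f (Sum.inr (Sum.inr u.net.root)), _, _, ?_, ?_,
      (congrArg (fun ρ => t.Rep G ρ _ _) (comp_bindNode f (Sum.inr u.net.root) Sum.inl)).mp
        (t.rep_of_embeds he), u.rep_of_embeds he'⟩
    · rw [Set.disjoint_left]
      rintro _ ⟨l, -, rfl⟩ ⟨k, -, hk⟩
      cases h.inj hk
    · ext k
      constructor
      · rintro ⟨(l | n) | l, hw, rfl⟩
        · exact .inl ⟨l, fun h => hw ((Shape.isWeak_map _ _ _).2 h), rfl⟩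
        · exact (hw ⟨_, rfl⟩).elim
        · exact .inr ⟨l, fun h => hw ((Shape.isWeak_map _ _ _).2 h), rfl⟩
      · rintro (⟨l, hw, rfl⟩ | ⟨l, hw, rfl⟩)
        · exact ⟨.inl (.inl l), fun h => hw ((Shape.isWeak_map _ _ _).1 h), rfl⟩
        · exact ⟨.inr l, fun h => hw ((Shape.isWeak_map _ _ _).1 h), rfl⟩
end

theorem Tm.netOn_rep (t : Tm) (X : Set ℕ) :
    t.Rep (t.netOn X) Sum.inl (Sum.inr (t.netOn X).root) ((t.netOn X).nw Set.univ) := by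
  have he : Embeds (t.netOn X).shape (t.netOn X).box (t.netOn X) id id id := by
    refine ⟨Function.injective_id, fun l => (Shape.map_id _).symm, fun l _ => ?_⟩
    rw [Set.image_id]
    rfl
  have := t.rep_of_embeds (Embeds.of_addWeak he)
  have hS : (t.netOn X).nw Set.univ = (id ∘ Sum.inl) '' {l | ¬ (t.net.shape l).IsWeak} := by
    ext k
    constructor
    · rintro ⟨-, hw⟩
      rcases k with l | n
      · exact ⟨l, hw, rfl⟩
      · exact (hw ⟨_, rfl⟩).elim
    · rintro ⟨l, hw, rfl⟩
      exact ⟨trivial, hw⟩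
  rw [hS]
  exact this

theorem Tm.net_rep (t : Tm) :
    t.Rep t.net Sum.inl (Sum.inr t.net.root) (t.net.nw Set.univ) := by
  have he : Embeds t.net.shape t.net.box t.net id id id := by
    refine ⟨Function.injective_id, fun l => (Shape.map_id _).symm, fun l _ => ?_⟩
    rw [Set.image_id]
    rfl
  have := t.rep_of_embeds he
  rw [Set.image_id] at this
  have hS : t.net.nw Set.univ = {l | ¬ (t.net.shape l).IsWeak} := by
    ext k
    exact ⟨fun h => h.2, fun h => ⟨trivial, h⟩⟩
  rw [hS]
  exact this

end

/-! ### The translation is tidy -/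

theorem Shape.map_eq_par {E M E' M' : Type} {s : Shape E M} {f : E → E'} {g : M → M'} {a x b} :
    s.map f g = .par a x b ↔ ∃ a' x' b', s = .par a' x' b' ∧ g a' = a ∧ f x' = x ∧ f b' = b := by
  cases s <;> simp [map]

theorem Shape.map_eq_weak {E M E' M' : Type} {s : Shape E M} {f : E → E'} {g : M → M'} {z} :
    s.map f g = .weak z ↔ ∃ z', s = .weak z' ∧ f z' = z := by
  cases s <;> simp [map]

theorem exists_bindNode {E E' : Type} {S : Set (ℕ ⊕ E)} {x : E'} {f : E → E'} {z : ℕ ⊕ E'} :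
    (∃ y ∈ S, bindNode x f y = z) ↔ (Sum.inl 0 ∈ S ∧ Sum.inr x = z) ∨
      (∃ n, Sum.inl (n + 1) ∈ S ∧ Sum.inl n = z) ∨ ∃ e, Sum.inr e ∈ S ∧ Sum.inr (f e) = z := by
  constructor
  · rintro ⟨(_ | n) | e, h, rfl⟩
    exacts [.inl ⟨h, rfl⟩, .inr (.inl ⟨n, h, rfl⟩), .inr (.inr ⟨e, h, rfl⟩)]
  · rintro (⟨h, rfl⟩ | ⟨n, h, rfl⟩ | ⟨e, h, rfl⟩)
    exacts [⟨_, h, rfl⟩, ⟨_, h, rfl⟩, ⟨_, h, rfl⟩]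

theorem exists_sumMap {E E' : Type} {S : Set (ℕ ⊕ E)} {f : E → E'} {z : ℕ ⊕ E'} :
    (∃ y ∈ S, Sum.map id f y = z) ↔
      (∃ n, Sum.inl n ∈ S ∧ Sum.inl n = z) ∨ ∃ e, Sum.inr e ∈ S ∧ Sum.inr (f e) = z := by
  constructor
  · rintro ⟨n | e, h, rfl⟩
    exacts [.inl ⟨n, h, rfl⟩, .inr ⟨e, h, rfl⟩]
  · rintro (⟨n, h, rfl⟩ | ⟨e, h, rfl⟩)
    exacts [⟨_, h, rfl⟩, ⟨_, h, rfl⟩]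

theorem Net.IsTidy.addWeak {G : Net} {X W : Set ℕ} (hG : G.IsTidy X) (hW : Disjoint W X) :
    (G.addWeak W).IsTidy (X ∪ W) := by
  have key : Tidy (E := G.E) (M := G.M) (L := G.Link ⊕ W)
      (Sum.elim G.shape fun n => .weak (Sum.inl n.1))
      (Sum.elim (fun l => Sum.inl '' G.box l) fun _ => ∅) {Sum.inr G.root} (X ∪ W) := by
    have hn : ∀ {n l}, n ∈ W → Sum.inl n ∉ (G.shape l).eTargets := by
      intro n l hn hl
      rcases hG.tgt_src hl with ⟨l', h⟩ | ⟨m, hm, h⟩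
      · exact hG.names n l' h
      · cases h; exact Set.disjoint_left.1 hW hn hm
    constructor
    · rintro n (l | m)
      · exact hG.names n l
      · exact id
    · rintro z (l | m) (l' | m') h h'
      · exact congrArg Sum.inl (hG.eout h h')
      · exact h'.elim
      · exact h.elim
      · exact h.elim
    · rintro z (l | m) (l' | m') h h'
      · exact congrArg Sum.inl (hG.mout h h')
      · exact h'.elim
      · exact h.elim
      · exact h.elim
    · rintro z (l | m) (l' | m') h h'
      · exact congrArg Sum.inl (hG.min h h')
      · exact h'.elim
      · exact h.elim
      · exact h.elim
    · rintro z (l | m) (l' | m') h h' hne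
      · exact hG.ein h h' fun e => hne (congrArg Sum.inl e)
      · obtain rfl := Set.mem_singleton_iff.1 h'
        exact (hn m'.2 h).elim
      · obtain rfl := Set.mem_singleton_iff.1 h
        exact (hn m.2 h').elim
      · exact (hne (congrArg Sum.inr (Subtype.ext
          (Sum.inl.inj ((Set.mem_singleton_iff.1 h).symm.trans (Set.mem_singleton_iff.1 h')))))).elim
    · rintro z (l | m) hz h
      · exact hG.root_target hz h
      · cases hz; cases h
    · rintro z (l | m) h
      · exact (hG.src_tgt h).imp_right fun ⟨l', h⟩ => ⟨.inl l', h⟩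
      · exact h.elim
    · rintro n (h | h)
      · obtain ⟨l, hl⟩ := hG.name_tgt n h
        exact ⟨.inl l, hl⟩
      · exact ⟨.inr ⟨n, h⟩, rfl⟩
    · rintro z (l | m) h
      · exact (hG.tgt_src h).imp (fun ⟨l', h⟩ => ⟨.inl l', h⟩) fun ⟨n, h, e⟩ => ⟨n, .inl h, e⟩
      · exact .inr ⟨m.1, .inr m.2, h⟩
    · rintro (p | m) a x b (w | n) z hp hw
      · refine Sum.inl_injective.mem_set_image.trans ((hG.weak_box hp hw).trans (or_congr_right ?_))
        constructor
        · rintro ⟨l, hl, h⟩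
          exact ⟨.inl l, ⟨l, hl, rfl⟩, h⟩
        · rintro ⟨_, ⟨l, hl, rfl⟩, h⟩
          exact ⟨l, hl, h⟩
      · cases hw
        have hx : x ≠ Sum.inl n.1 := by
          rintro rfl
          exact hG.names n p (by simp [show G.shape p = _ from hp, Shape.eSources])
        constructor
        · rintro ⟨_, _, h⟩; cases h
        · rintro (h | ⟨_, ⟨l, -, rfl⟩, h⟩)
          · exact (hx h.symm).elim
          · exact (hG.names n l h).elim
      · cases hp
      · cases hp
  exact key

/-- The conditions on what lies below the root link in the translation of a value, for a hypergraph
given by its links and boxes. -/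
structure TidyBelow {E M L : Type} (shape : L → Shape (ℕ ⊕ E) (Option M)) (box : L → Set L)
    (X : Set ℕ) : Prop where
  tidy : Tidy shape box ∅ X
  entry : ∀ l, none ∉ (shape l).mTargets
  der : ∀ n l, Sum.inl n ∈ (shape l).eTargets → (shape l).IsDer

theorem tidyBelow_ofVar (n : ℕ) :
    TidyBelow (E := Empty) (M := Empty) (L := Unit) (fun _ => .der none (Sum.inl n)) (fun _ => ∅)
      {n} := by
  constructor
  · constructor <;> simp [Shape.eSources, Shape.eTargets, Shape.mTargets, Shape.IsDer]
  · exact fun _ => id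
  · exact fun _ _ _ => ⟨_, _, rfl⟩

/-- The links `sh` and boxes `bx` are those of `Content.ofBox B`. -/
theorem tidyBelow_ofBox {B : Net} {X : Set ℕ} (hB : B.IsTidy X) (h0 : 0 ∈ X)
    (hder : ∀ n l, Sum.inl (n + 1) ∈ (B.shape l).eTargets → (B.shape l).IsDer)
    (hr : ∃ l, Sum.inr B.root ∈ (B.shape l).eSources)
    {sh : Option B.Link → Shape (ℕ ⊕ Option B.E) (Option B.M)}
    {bx : Option B.Link → Set (Option B.Link)}
    (hs0 : sh none = .par none (Sum.inr none) (Sum.inr (some B.root)))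
    (hs1 : ∀ l, sh (some l) = (B.shape l).map (bindNode none some) some)
    (hb0 : bx none = Set.range some) (hb1 : ∀ l, bx (some l) = some '' B.box l) :
    TidyBelow sh bx {n | n + 1 ∈ X} := by
  have names := hB.names
  have es0 : ∀ {z}, z ∈ (sh none).eSources ↔ z = Sum.inr none := by rw [hs0]; exact Iff.rfl
  have et0 : ∀ {z}, z ∈ (sh none).eTargets ↔ z = Sum.inr (some B.root) := by
    rw [hs0]; exact Iff.rfl
  have ms0 : ∀ {a}, a ∈ (sh none).mSources ↔ a = none := by rw [hs0]; exact Iff.rfl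
  have mt0 : ∀ {a}, a ∈ (sh none).mTargets ↔ False := by rw [hs0]; exact Iff.rfl
  have es1 : ∀ {l z}, z ∈ (sh (some l)).eSources ↔
      ∃ e, Sum.inr e ∈ (B.shape l).eSources ∧ z = Sum.inr (some e) := by
    intro l z
    rw [hs1, Shape.mem_eSources_map, exists_bindNode]
    grind
  have et1 : ∀ {l z}, z ∈ (sh (some l)).eTargets ↔
      (Sum.inl 0 ∈ (B.shape l).eTargets ∧ z = Sum.inr none) ∨
      (∃ n, Sum.inl (n + 1) ∈ (B.shape l).eTargets ∧ z = Sum.inl n) ∨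
      ∃ e, Sum.inr e ∈ (B.shape l).eTargets ∧ z = Sum.inr (some e) := by
    intro l z
    rw [hs1, Shape.mem_eTargets_map, exists_bindNode]
    grind
  have ms1 : ∀ {l a}, a ∈ (sh (some l)).mSources ↔
      ∃ a' ∈ (B.shape l).mSources, a = some a' := by
    intro l a; rw [hs1, Shape.mem_mSources_map]; grind
  have mt1 : ∀ {l a}, a ∈ (sh (some l)).mTargets ↔
      ∃ a' ∈ (B.shape l).mTargets, a = some a' := by
    intro l a; rw [hs1, Shape.mem_mTargets_map]; grind
  have key : Tidy sh bx ∅ {n | n + 1 ∈ X} := by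
    constructor
    · rintro n (_ | l) h
      · cases es0.1 h
      · obtain ⟨e, -, h⟩ := es1.1 h
        cases h
    · rintro z (_ | l) (_ | l') <;> simp only [es0, es1] <;> grind [hB.eout]
    · rintro z (_ | l) (_ | l') <;> simp only [ms0, ms1] <;> grind [hB.mout]
    · rintro z (_ | l) (_ | l') <;> simp only [mt0, mt1] <;> grind [hB.min]
    · rintro z (_ | l) (_ | l') <;> grind [hB.ein, hB.root_target, Shape.isDer_map]
    · simp
    · rintro z (_ | l) h
      · obtain rfl := es0.1 h
        obtain ⟨l, hl⟩ := hB.name_tgt 0 h0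
        exact .inr ⟨some l, et1.2 (.inl ⟨hl, rfl⟩)⟩
      · obtain ⟨e, he, rfl⟩ := es1.1 h
        rcases hB.src_tgt he with h | ⟨l', h⟩
        · exact .inr ⟨none, et0.2 (by cases h; rfl)⟩
        · exact .inr ⟨some l', et1.2 (.inr (.inr ⟨e, h, rfl⟩))⟩
    · intro n hn
      obtain ⟨l, hl⟩ := hB.name_tgt _ hn
      exact ⟨some l, et1.2 (.inr (.inl ⟨n, hl, rfl⟩))⟩
    · rintro z (_ | l) h
      · obtain rfl := et0.1 h
        obtain ⟨l, hl⟩ := hr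
        exact .inl ⟨some l, es1.2 ⟨_, hl, rfl⟩⟩
      · rcases et1.1 h with ⟨h', rfl⟩ | ⟨n, h', rfl⟩ | ⟨e, h', rfl⟩
        · exact .inl ⟨none, es0.2 rfl⟩
        · rcases hB.tgt_src h' with ⟨l', h⟩ | ⟨m, hm, h⟩
          · exact (names _ _ h).elim
          · cases h; exact .inr ⟨n, hm, rfl⟩
        · rcases hB.tgt_src h' with ⟨l', h⟩ | ⟨m, hm, h⟩
          · exact .inl ⟨some l', es1.2 ⟨e, h, rfl⟩⟩
          · cases h
    · rintro (_ | p) a x b (_ | w) z hp hw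
      · simp [hs0] at hw
      · -- a weakening on a node other than the variable has a source in the box
        have hx : Sum.inr none ∈ (sh none).eSources := es0.2 rfl
        obtain rfl : x = Sum.inr none := by simpa [hp, Shape.eSources, eq_comm] using hx
        rw [hb0]
        refine iff_of_true ⟨w, rfl⟩ ?_
        have hz : z ∈ (sh (some w)).eTargets := by simp [hw, Shape.eTargets]
        rcases et1.1 hz with ⟨h, rfl⟩ | ⟨n, h, rfl⟩ | ⟨e, h, rfl⟩
        · exact .inl rfl
        · have := hder n w h
          rw [hs1] at hw
          obtain ⟨y, hy, -⟩ := Shape.map_eq_weak.1 hw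
          exact (this.not_isWeak ⟨_, hy⟩).elim
        · rcases hB.tgt_src h with ⟨l', h⟩ | ⟨m, hm, h⟩
          · exact .inr ⟨some l', ⟨l', rfl⟩, es1.2 ⟨e, h, rfl⟩⟩
          · cases h
      · simp [hs0] at hw
      · rw [hs1] at hp hw
        obtain ⟨a, x, b, hp', rfl, rfl, rfl⟩ := Shape.map_eq_par.1 hp
        obtain ⟨z, hw', rfl⟩ := Shape.map_eq_weak.1 hw
        rw [hb1, (Option.some_injective _).mem_set_image, hB.weak_box hp' hw']
        have hx : x ∈ (B.shape p).eSources := by simp [hp', Shape.eSources]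
        rcases x with n | e
        · exact (names _ _ hx).elim
        rcases z with (_ | n) | e' <;> simp [bindNode, es1, names]
  refine ⟨key, ?_, ?_⟩
  · rintro (_ | l) <;> simp [mt0, mt1]
  · rintro n (_ | l) h
    · cases et0.1 h
    · rcases et1.1 h with ⟨h', e⟩ | ⟨m, h', e⟩ | ⟨e', h', e⟩
      · cases e
      · rw [hs1, Shape.isDer_map]; exact hder _ _ h'
      · cases e

/-- The links `sh` and boxes `bx` are those of `Net.ofBang`. -/
theorem tidy_ofBang {E M L : Type} {shH : L → Shape (ℕ ⊕ E) (Option M)} {bxH : L → Set L}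
    {X : Set ℕ} (hH : TidyBelow shH bxH X) {sh : Option L → Shape (ℕ ⊕ Option E) (Option M)}
    {bx : Option L → Set (Option L)} (hs0 : sh none = .bang (Sum.inr none) none)
    (hs1 : ∀ l, sh (some l) = (shH l).map (Sum.map id some) id)
    (hb1 : ∀ l, bx (some l) = some '' bxH l) : Tidy sh bx {Sum.inr none} X := by
  have hT := hH.tidy
  have names := hT.names
  have es0 : ∀ {z}, z ∈ (sh none).eSources ↔ z = Sum.inr none := by rw [hs0]; exact Iff.rfl
  have et0 : ∀ {z}, z ∉ (sh none).eTargets := by rw [hs0]; exact id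
  have ms0 : ∀ {a}, a ∉ (sh none).mSources := by rw [hs0]; exact id
  have mt0 : ∀ {a}, a ∈ (sh none).mTargets ↔ a = none := by rw [hs0]; exact Iff.rfl
  have es1 : ∀ {l z}, z ∈ (sh (some l)).eSources ↔
      ∃ e, Sum.inr e ∈ (shH l).eSources ∧ z = Sum.inr (some e) := by
    intro l z
    rw [hs1, Shape.mem_eSources_map, exists_sumMap]
    grind
  have et1 : ∀ {l z}, z ∈ (sh (some l)).eTargets ↔
      (∃ n, Sum.inl n ∈ (shH l).eTargets ∧ z = Sum.inl n) ∨
      ∃ e, Sum.inr e ∈ (shH l).eTargets ∧ z = Sum.inr (some e) := by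
    intro l z
    rw [hs1, Shape.mem_eTargets_map, exists_sumMap]
    grind
  have ms1 : ∀ {l a}, a ∈ (sh (some l)).mSources ↔ a ∈ (shH l).mSources := by
    intro l a; rw [hs1, Shape.mem_mSources_map]; simp
  have mt1 : ∀ {l a}, a ∈ (sh (some l)).mTargets ↔ a ∈ (shH l).mTargets := by
    intro l a; rw [hs1, Shape.mem_mTargets_map]; simp
  constructor
  · rintro n (_ | l) h
    · cases es0.1 h
    · obtain ⟨e, -, h⟩ := es1.1 h
      cases h
  · rintro z (_ | l) (_ | l') <;> grind [hT.eout]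
  · rintro z (_ | l) (_ | l') <;> grind [hT.mout]
  · rintro z (_ | l) (_ | l') <;> grind [hT.min, hH.entry]
  · rintro z (_ | l) (_ | l') <;> grind [hT.ein, Shape.isDer_map]
  · rintro z (_ | l) rfl <;> grind
  · rintro z (_ | l) h
    · exact .inl (es0.1 h)
    · obtain ⟨e, he, rfl⟩ := es1.1 h
      rcases hT.src_tgt he with h' | ⟨l', h'⟩
      · exact h'.elim
      · exact .inr ⟨some l', et1.2 (.inr ⟨e, h', rfl⟩)⟩
  · intro n hn
    obtain ⟨l, hl⟩ := hT.name_tgt _ hn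
    exact ⟨some l, et1.2 (.inl ⟨n, hl, rfl⟩)⟩
  · rintro z (_ | l) h
    · exact (et0 h).elim
    · rcases et1.1 h with ⟨n, h', rfl⟩ | ⟨e, h', rfl⟩
      · rcases hT.tgt_src h' with ⟨l', h'⟩ | ⟨m, hm, h'⟩
        · exact (names _ _ h').elim
        · cases h'; exact .inr ⟨n, hm, rfl⟩
      · rcases hT.tgt_src h' with ⟨l', h'⟩ | ⟨m, hm, h'⟩
        · exact .inl ⟨some l', es1.2 ⟨e, h', rfl⟩⟩
        · cases h'
  · rintro (_ | p) a x b (_ | w) z hp hw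
    · simp [hs0] at hw
    · simp [hs0] at hp
    · simp [hs0] at hw
    · rw [hs1] at hp hw
      obtain ⟨a, x, b, hp', rfl, rfl, rfl⟩ := Shape.map_eq_par.1 hp
      obtain ⟨z, hw', rfl⟩ := Shape.map_eq_weak.1 hw
      rw [hb1, (Option.some_injective _).mem_set_image, hT.weak_box hp' hw']
      have hx : x ∈ (shH p).eSources := by simp [hp', Shape.eSources]
      rcases x with n | e
      · exact (names _ _ hx).elim
      rcases z with n | e' <;> simp [es1, names]

/-- The links `sh` and boxes `bx` are those of `Net.ofTensor`.  A name that is shared by both parts is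
a target of derelictions only. -/
theorem tidy_ofTensor {E M L E' M' L' : Type} {shH : L → Shape (ℕ ⊕ E) (Option M)}
    {bxH : L → Set L} {X : Set ℕ} (hH : TidyBelow shH bxH X) {shG : L' → Shape (ℕ ⊕ E') M'}
    {bxG : L' → Set L'} {Y : Set ℕ} {r : E'} (hG : Tidy shG bxG {Sum.inr r} Y)
    (hder : ∀ n l, Sum.inl n ∈ (shG l).eTargets → (shG l).IsDer)
    (hr : ∃ l, Sum.inr r ∈ (shG l).eSources)
    {sh : Option (L ⊕ L') → Shape (ℕ ⊕ Option (E ⊕ E')) (Option M ⊕ M')}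
    {bx : Option (L ⊕ L') → Set (Option (L ⊕ L'))}
    (hs0 : sh none = .tensor (Sum.inr none) (Sum.inl none) (Sum.inr (some (Sum.inr r))))
    (hs1 : ∀ l, sh (some (.inl l)) = (shH l).map (Sum.map id (some ∘ Sum.inl)) Sum.inl)
    (hs2 : ∀ l, sh (some (.inr l)) = (shG l).map (Sum.map id (some ∘ Sum.inr)) Sum.inr)
    (hb1 : ∀ l, bx (some (.inl l)) = (some ∘ Sum.inl) '' bxH l)
    (hb2 : ∀ l, bx (some (.inr l)) = (some ∘ Sum.inr) '' bxG l) :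
    Tidy sh bx {Sum.inr none} (X ∪ Y) := by
  have hT := hH.tidy
  have names := hT.names
  have names' := hG.names
  have es0 : ∀ {z}, z ∈ (sh none).eSources ↔ z = Sum.inr none := by rw [hs0]; exact Iff.rfl
  have et0 : ∀ {z}, z ∈ (sh none).eTargets ↔ z = Sum.inr (some (Sum.inr r)) := by
    rw [hs0]; exact Iff.rfl
  have ms0 : ∀ {a}, a ∉ (sh none).mSources := by rw [hs0]; exact id
  have mt0 : ∀ {a}, a ∈ (sh none).mTargets ↔ a = Sum.inl none := by rw [hs0]; exact Iff.rfl
  have es1 : ∀ {l z}, z ∈ (sh (some (.inl l))).eSources ↔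
      ∃ e, Sum.inr e ∈ (shH l).eSources ∧ z = Sum.inr (some (.inl e)) := by
    intro l z
    rw [hs1, Shape.mem_eSources_map, exists_sumMap]
    grind
  have et1 : ∀ {l z}, z ∈ (sh (some (.inl l))).eTargets ↔
      (∃ n, Sum.inl n ∈ (shH l).eTargets ∧ z = Sum.inl n) ∨
      ∃ e, Sum.inr e ∈ (shH l).eTargets ∧ z = Sum.inr (some (.inl e)) := by
    intro l z
    rw [hs1, Shape.mem_eTargets_map, exists_sumMap]
    grind
  have ms1 : ∀ {l a}, a ∈ (sh (some (.inl l))).mSources ↔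
      ∃ a' ∈ (shH l).mSources, a = Sum.inl a' := by
    intro l a; rw [hs1, Shape.mem_mSources_map]; grind
  have mt1 : ∀ {l a}, a ∈ (sh (some (.inl l))).mTargets ↔
      ∃ a' ∈ (shH l).mTargets, a = Sum.inl a' := by
    intro l a; rw [hs1, Shape.mem_mTargets_map]; grind
  have es2 : ∀ {l z}, z ∈ (sh (some (.inr l))).eSources ↔
      ∃ e, Sum.inr e ∈ (shG l).eSources ∧ z = Sum.inr (some (.inr e)) := by
    intro l z
    rw [hs2, Shape.mem_eSources_map, exists_sumMap]
    grind
  have et2 : ∀ {l z}, z ∈ (sh (some (.inr l))).eTargets ↔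
      (∃ n, Sum.inl n ∈ (shG l).eTargets ∧ z = Sum.inl n) ∨
      ∃ e, Sum.inr e ∈ (shG l).eTargets ∧ z = Sum.inr (some (.inr e)) := by
    intro l z
    rw [hs2, Shape.mem_eTargets_map, exists_sumMap]
    grind
  have ms2 : ∀ {l a}, a ∈ (sh (some (.inr l))).mSources ↔
      ∃ a' ∈ (shG l).mSources, a = Sum.inr a' := by
    intro l a; rw [hs2, Shape.mem_mSources_map]; grind
  have mt2 : ∀ {l a}, a ∈ (sh (some (.inr l))).mTargets ↔
      ∃ a' ∈ (shG l).mTargets, a = Sum.inr a' := by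
    intro l a; rw [hs2, Shape.mem_mTargets_map]; grind
  constructor
  · rintro n (_ | l | l) <;> grind
  · rintro z (_ | l | l) (_ | l' | l') <;> grind [hT.eout, hG.eout]
  · rintro z (_ | l | l) (_ | l' | l') <;> grind [hT.mout, hG.mout]
  · rintro z (_ | l | l) (_ | l' | l') <;> grind [hT.min, hG.min, hH.entry]
  · rintro z (_ | l | l) (_ | l' | l') <;>
      grind [hT.ein, hG.ein, hH.der, hG.root_target, Shape.isDer_map]
  · rintro z (_ | l | l) rfl <;> grind
  · rintro z (_ | l | l) h
    · exact .inl (es0.1 h)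
    · obtain ⟨e, he, rfl⟩ := es1.1 h
      rcases hT.src_tgt he with h' | ⟨l', h'⟩
      · exact h'.elim
      · exact .inr ⟨_, et1.2 (.inr ⟨e, h', rfl⟩)⟩
    · obtain ⟨e, he, rfl⟩ := es2.1 h
      rcases hG.src_tgt he with h' | ⟨l', h'⟩
      · cases h'; exact .inr ⟨none, et0.2 rfl⟩
      · exact .inr ⟨_, et2.2 (.inr ⟨e, h', rfl⟩)⟩
  · rintro n (hn | hn)
    · obtain ⟨l, hl⟩ := hT.name_tgt _ hn
      exact ⟨_, et1.2 (.inl ⟨n, hl, rfl⟩)⟩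
    · obtain ⟨l, hl⟩ := hG.name_tgt _ hn
      exact ⟨_, et2.2 (.inl ⟨n, hl, rfl⟩)⟩
  · rintro z (_ | l | l) h
    · obtain rfl := et0.1 h
      obtain ⟨l, hl⟩ := hr
      exact .inl ⟨_, es2.2 ⟨_, hl, rfl⟩⟩
    · rcases et1.1 h with ⟨n, h', rfl⟩ | ⟨e, h', rfl⟩
      · rcases hT.tgt_src h' with ⟨l', h'⟩ | ⟨m, hm, h'⟩
        · exact (names _ _ h').elim
        · cases h'; exact .inr ⟨n, .inl hm, rfl⟩
      · rcases hT.tgt_src h' with ⟨l', h'⟩ | ⟨m, hm, h'⟩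
        · exact .inl ⟨_, es1.2 ⟨e, h', rfl⟩⟩
        · cases h'
    · rcases et2.1 h with ⟨n, h', rfl⟩ | ⟨e, h', rfl⟩
      · rcases hG.tgt_src h' with ⟨l', h'⟩ | ⟨m, hm, h'⟩
        · exact (names' _ _ h').elim
        · cases h'; exact .inr ⟨n, .inr hm, rfl⟩
      · rcases hG.tgt_src h' with ⟨l', h'⟩ | ⟨m, hm, h'⟩
        · exact .inl ⟨_, es2.2 ⟨e, h', rfl⟩⟩
        · cases h'
  · have hw1 : ∀ {w z}, sh (some (.inl w)) = .weak z →
        ∃ e, shH w = .weak (Sum.inr e) ∧ z = Sum.inr (some (.inl e)) := by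
      intro w z hw
      rw [hs1] at hw
      obtain ⟨n | e, hw', rfl⟩ := Shape.map_eq_weak.1 hw
      · exact ((hH.der n w (by simp [hw', Shape.eTargets])).not_isWeak ⟨_, hw'⟩).elim
      · exact ⟨e, hw', rfl⟩
    have hw2 : ∀ {w z}, sh (some (.inr w)) = .weak z →
        ∃ e, shG w = .weak (Sum.inr e) ∧ z = Sum.inr (some (.inr e)) := by
      intro w z hw
      rw [hs2] at hw
      obtain ⟨n | e, hw', rfl⟩ := Shape.map_eq_weak.1 hw
      · exact ((hder n w (by simp [hw', Shape.eTargets])).not_isWeak ⟨_, hw'⟩).elim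
      · exact ⟨e, hw', rfl⟩
    have hp1 : ∀ {p a x b}, sh (some (.inl p)) = .par a x b →
        ∃ a' e b', shH p = .par a' (Sum.inr e) b' ∧ x = Sum.inr (some (.inl e)) := by
      intro p a x b hp
      rw [hs1] at hp
      obtain ⟨a, n | e, b, hp', rfl, rfl, rfl⟩ := Shape.map_eq_par.1 hp
      · exact (names n p (by simp [hp', Shape.eSources])).elim
      · exact ⟨a, e, b, hp', rfl⟩
    have hp2 : ∀ {p a x b}, sh (some (.inr p)) = .par a x b →
        ∃ a' e b', shG p = .par a' (Sum.inr e) b' ∧ x = Sum.inr (some (.inr e)) := by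
      intro p a x b hp
      rw [hs2] at hp
      obtain ⟨a, n | e, b, hp', rfl, rfl, rfl⟩ := Shape.map_eq_par.1 hp
      · exact (names' n p (by simp [hp', Shape.eSources])).elim
      · exact ⟨a, e, b, hp', rfl⟩
    rintro (_ | p | p) a x b (_ | w | w) z hp hw
    · simp [hs0] at hp
    · simp [hs0] at hp
    · simp [hs0] at hp
    · simp [hs0] at hw
    · obtain ⟨e, hw', rfl⟩ := hw1 hw
      obtain ⟨a, e', b, hp', rfl⟩ := hp1 hp
      have := hT.weak_box hp' hw'
      rw [hb1]
      simp [es1, this]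
    · obtain ⟨e, hw', rfl⟩ := hw2 hw
      obtain ⟨a, e', b, hp', rfl⟩ := hp1 hp
      rw [hb1]
      simp [es1]
    · simp [hs0] at hw
    · obtain ⟨e, hw', rfl⟩ := hw1 hw
      obtain ⟨a, e', b, hp', rfl⟩ := hp2 hp
      rw [hb2]
      simp [es2]
    · obtain ⟨e, hw', rfl⟩ := hw2 hw
      obtain ⟨a, e', b, hp', rfl⟩ := hp2 hp
      have := hG.weak_box hp' hw'
      rw [hb2]
      simp [es2, this]

/-- The links `sh` and boxes `bx` are those of `Net.ofSub`.  The hypothesis `hrb` on the root `r'` of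
the argument is needed since `r'` receives the weakening that the bound variable may have, and this
weakening is in no box of the argument. -/
theorem tidy_ofSub {E M L E' M' L' : Type} {shG : L → Shape (ℕ ⊕ E) M}
    {bxG : L → Set L} {X : Set ℕ} {r : E} (hG : Tidy shG bxG {Sum.inr r} X) (h0 : 0 ∈ X)
    (hder : ∀ n l, Sum.inl (n + 1) ∈ (shG l).eTargets → (shG l).IsDer)
    {shK : L' → Shape (ℕ ⊕ E') M'}
    {bxK : L' → Set L'} {Y : Set ℕ} {r' : E'} (hK : Tidy shK bxK {Sum.inr r'} Y)
    (hder' : ∀ n l, Sum.inl n ∈ (shK l).eTargets → (shK l).IsDer)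
    (hr : ∃ l, Sum.inr r' ∈ (shK l).eSources)
    (hrb : ∀ p a x b, shK p = .par a x b →
      x ≠ Sum.inr r' ∧ ∀ l ∈ bxK p, Sum.inr r' ∉ (shK l).eSources)
    {sh : L ⊕ L' → Shape (ℕ ⊕ (E ⊕ E')) (M ⊕ M')} {bx : L ⊕ L' → Set (L ⊕ L')}
    (hs1 : ∀ l, sh (.inl l) = (shG l).map (bindNode (Sum.inr r') Sum.inl) Sum.inl)
    (hs2 : ∀ l, sh (.inr l) = (shK l).map (Sum.map id Sum.inr) Sum.inr)
    (hb1 : ∀ l, bx (.inl l) = Sum.inl '' bxG l) (hb2 : ∀ l, bx (.inr l) = Sum.inr '' bxK l) :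
    Tidy sh bx {Sum.inr (Sum.inl r)} ({n | n + 1 ∈ X} ∪ Y) := by
  have names := hG.names
  have names' := hK.names
  have es1 : ∀ {l z}, z ∈ (sh (.inl l)).eSources ↔
      ∃ e, Sum.inr e ∈ (shG l).eSources ∧ z = Sum.inr (.inl e) := by
    intro l z
    rw [hs1, Shape.mem_eSources_map, exists_bindNode]
    grind
  have et1 : ∀ {l z}, z ∈ (sh (.inl l)).eTargets ↔
      (Sum.inl 0 ∈ (shG l).eTargets ∧ z = Sum.inr (Sum.inr r')) ∨
      (∃ n, Sum.inl (n + 1) ∈ (shG l).eTargets ∧ z = Sum.inl n) ∨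
      ∃ e, Sum.inr e ∈ (shG l).eTargets ∧ z = Sum.inr (.inl e) := by
    intro l z
    rw [hs1, Shape.mem_eTargets_map, exists_bindNode]
    grind
  have ms1 : ∀ {l a}, a ∈ (sh (.inl l)).mSources ↔
      ∃ a' ∈ (shG l).mSources, a = Sum.inl a' := by
    intro l a; rw [hs1, Shape.mem_mSources_map]; grind
  have mt1 : ∀ {l a}, a ∈ (sh (.inl l)).mTargets ↔
      ∃ a' ∈ (shG l).mTargets, a = Sum.inl a' := by
    intro l a; rw [hs1, Shape.mem_mTargets_map]; grind
  have es2 : ∀ {l z}, z ∈ (sh (.inr l)).eSources ↔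
      ∃ e, Sum.inr e ∈ (shK l).eSources ∧ z = Sum.inr (.inr e) := by
    intro l z
    rw [hs2, Shape.mem_eSources_map, exists_sumMap]
    grind
  have et2 : ∀ {l z}, z ∈ (sh (.inr l)).eTargets ↔
      (∃ n, Sum.inl n ∈ (shK l).eTargets ∧ z = Sum.inl n) ∨
      ∃ e, Sum.inr e ∈ (shK l).eTargets ∧ z = Sum.inr (.inr e) := by
    intro l z
    rw [hs2, Shape.mem_eTargets_map, exists_sumMap]
    grind
  have ms2 : ∀ {l a}, a ∈ (sh (.inr l)).mSources ↔
      ∃ a' ∈ (shK l).mSources, a = Sum.inr a' := by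
    intro l a; rw [hs2, Shape.mem_mSources_map]; grind
  have mt2 : ∀ {l a}, a ∈ (sh (.inr l)).mTargets ↔
      ∃ a' ∈ (shK l).mTargets, a = Sum.inr a' := by
    intro l a; rw [hs2, Shape.mem_mTargets_map]; grind
  constructor
  · rintro n (l | l) <;> grind
  · rintro z (l | l) (l' | l') <;> grind [hG.eout, hK.eout]
  · rintro z (l | l) (l' | l') <;> grind [hG.mout, hK.mout]
  · rintro z (l | l) (l' | l') <;> grind [hG.min, hK.min]
  · rintro z (l | l) (l' | l') <;>
      grind [hG.ein, hK.ein, hK.root_target, Shape.isDer_map]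
  · rintro z (l | l) rfl <;> grind [hG.root_target]
  · rintro z (l | l) h
    · obtain ⟨e, he, rfl⟩ := es1.1 h
      rcases hG.src_tgt he with h' | ⟨l', h'⟩
      · cases h'; exact .inl rfl
      · exact .inr ⟨_, et1.2 (.inr (.inr ⟨e, h', rfl⟩))⟩
    · obtain ⟨e, he, rfl⟩ := es2.1 h
      rcases hK.src_tgt he with h' | ⟨l', h'⟩
      · cases h'
        obtain ⟨l', h'⟩ := hG.name_tgt 0 h0
        exact .inr ⟨_, et1.2 (.inl ⟨h', rfl⟩)⟩
      · exact .inr ⟨_, et2.2 (.inr ⟨e, h', rfl⟩)⟩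
  · rintro n (hn | hn)
    · obtain ⟨l, hl⟩ := hG.name_tgt _ hn
      exact ⟨_, et1.2 (.inr (.inl ⟨n, hl, rfl⟩))⟩
    · obtain ⟨l, hl⟩ := hK.name_tgt _ hn
      exact ⟨_, et2.2 (.inl ⟨n, hl, rfl⟩)⟩
  · rintro z (l | l) h
    · rcases et1.1 h with ⟨h', rfl⟩ | ⟨n, h', rfl⟩ | ⟨e, h', rfl⟩
      · obtain ⟨l, hl⟩ := hr
        exact .inl ⟨_, es2.2 ⟨_, hl, rfl⟩⟩
      · rcases hG.tgt_src h' with ⟨l', h'⟩ | ⟨m, hm, h'⟩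
        · exact (names _ _ h').elim
        · cases h'; exact .inr ⟨n, .inl hm, rfl⟩
      · rcases hG.tgt_src h' with ⟨l', h'⟩ | ⟨m, hm, h'⟩
        · exact .inl ⟨_, es1.2 ⟨e, h', rfl⟩⟩
        · cases h'
    · rcases et2.1 h with ⟨n, h', rfl⟩ | ⟨e, h', rfl⟩
      · rcases hK.tgt_src h' with ⟨l', h'⟩ | ⟨m, hm, h'⟩
        · exact (names' _ _ h').elim
        · cases h'; exact .inr ⟨n, .inr hm, rfl⟩
      · rcases hK.tgt_src h' with ⟨l', h'⟩ | ⟨m, hm, h'⟩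
        · exact .inl ⟨_, es2.2 ⟨e, h', rfl⟩⟩
        · cases h'
  · have hw1 : ∀ {w z}, sh (.inl w) = .weak z →
        (shG w = .weak (Sum.inl 0) ∧ z = Sum.inr (Sum.inr r')) ∨
        ∃ e, shG w = .weak (Sum.inr e) ∧ z = Sum.inr (.inl e) := by
      intro w z hw
      rw [hs1] at hw
      obtain ⟨(_ | n) | e, hw', rfl⟩ := Shape.map_eq_weak.1 hw
      · exact .inl ⟨hw', rfl⟩
      · exact ((hder n w (by simp [hw', Shape.eTargets])).not_isWeak ⟨_, hw'⟩).elim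
      · exact .inr ⟨e, hw', rfl⟩
    have hw2 : ∀ {w z}, sh (.inr w) = .weak z →
        ∃ e, shK w = .weak (Sum.inr e) ∧ z = Sum.inr (.inr e) := by
      intro w z hw
      rw [hs2] at hw
      obtain ⟨n | e, hw', rfl⟩ := Shape.map_eq_weak.1 hw
      · exact ((hder' n w (by simp [hw', Shape.eTargets])).not_isWeak ⟨_, hw'⟩).elim
      · exact ⟨e, hw', rfl⟩
    have hp1 : ∀ {p a x b}, sh (.inl p) = .par a x b →
        ∃ a' e b', shG p = .par a' (Sum.inr e) b' ∧ x = Sum.inr (.inl e) := by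
      intro p a x b hp
      rw [hs1] at hp
      obtain ⟨a, n | e, b, hp', rfl, rfl, rfl⟩ := Shape.map_eq_par.1 hp
      · exact (names n p (by simp [hp', Shape.eSources])).elim
      · exact ⟨a, e, b, hp', rfl⟩
    have hp2 : ∀ {p a x b}, sh (.inr p) = .par a x b →
        ∃ a' e b', shK p = .par a' (Sum.inr e) b' ∧ x = Sum.inr (.inr e) := by
      intro p a x b hp
      rw [hs2] at hp
      obtain ⟨a, n | e, b, hp', rfl, rfl, rfl⟩ := Shape.map_eq_par.1 hp
      · exact (names' n p (by simp [hp', Shape.eSources])).elim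
      · exact ⟨a, e, b, hp', rfl⟩
    rintro (p | p) a x b (w | w) z hp hw
    · obtain ⟨a, e', b, hp', rfl⟩ := hp1 hp
      rcases hw1 hw with ⟨hw', rfl⟩ | ⟨e, hw', rfl⟩
      · have := hG.weak_box hp' hw'
        rw [hb1]
        simp [es1, this, names]
      · have := hG.weak_box hp' hw'
        rw [hb1]
        simp [es1, this]
    · obtain ⟨e, hw', rfl⟩ := hw2 hw
      obtain ⟨a, e', b, hp', rfl⟩ := hp1 hp
      rw [hb1]
      simp [es1]
    · obtain ⟨a, e', b, hp', rfl⟩ := hp2 hp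
      rw [hb2]
      rcases hw1 hw with ⟨hw', rfl⟩ | ⟨e, hw', rfl⟩
      · -- no box of the argument contains the root of the argument
        obtain ⟨h1, h2⟩ := hrb _ _ _ _ hp'
        have h3 : r' ≠ e' := by rintro rfl; exact h1 rfl
        simpa [es2, h3] using h2
      · simp [es2]
    · obtain ⟨e, hw', rfl⟩ := hw2 hw
      obtain ⟨a, e', b, hp', rfl⟩ := hp2 hp
      have := hK.weak_box hp' hw'
      rw [hb2]
      simp [es2, this]

/-- If the names of the net are the free variables of the term, then each of them has a dereliction,
and therefore no weakening. -/
theorem Net.Denotes.isDer_of_name {G : Net} {t : Tm} (hG : G.Denotes t t.fv) {n l}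
    (h : Sum.inl n ∈ (G.shape l).eTargets) : (G.shape l).IsDer := by
  rcases hG.tidy.tgt_src h with ⟨l', h'⟩ | ⟨m, hm, h'⟩
  · exact (hG.tidy.names _ _ h').elim
  · cases h'
    obtain ⟨k, hk, hkn⟩ := hG.rep.fv_target hm
    by_cases hkl : l = k
    · subst hkl
      rcases hG.rep.target hk h with h' | ⟨l', -, h'⟩
      · exact h'.1
      · exact (hG.tidy.names _ _ h').elim
    · exact hG.tidy.ein h hkn hkl

/-- The root of the net is not in a box, and it is not the variable of a `⅋`-link. -/
theorem Net.Denotes.root_notMem_box {G : Net} {t : Tm} {X : Set ℕ} (hG : G.Denotes t X) {p a x b}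
    (hp : G.shape p = .par a x b) :
    x ≠ Sum.inr G.root ∧ ∀ l ∈ G.box p, Sum.inr G.root ∉ (G.shape l).eSources := by
  have hps : x ∈ (G.shape p).eSources := by simp [hp, Shape.eSources]
  obtain ⟨k, _, hk, hkp⟩ := hG.rep.root
  refine ⟨?_, fun l hl hr => ?_⟩
  · rintro rfl
    exact hkp (hG.tidy.eout hk hps ▸ ⟨_, _, _, hp⟩)
  · obtain ⟨-, -, s, ρ, hs⟩ := hG.box_occ hp
    have h := hs.outer _ (mem_src_nw hl hr) (.inl rfl)
    exact hG.tidy.root_target rfl (h ▸ (by simp [hp, Shape.eTargets] : b ∈ (G.shape p).eTargets))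

/-- The body of a binder, with a weakening on the bound variable if it does not occur. -/
theorem Tm.body_isTidy {t : Tm} (h : t.net.Denotes t t.fv) :
    (t.net.addWeak ({0} \ t.fv)).IsTidy (t.fv ∪ {0}) ∧
      (∀ n l, Sum.inl (n + 1) ∈ ((t.net.addWeak ({0} \ t.fv)).shape l).eTargets →
        ((t.net.addWeak ({0} \ t.fv)).shape l).IsDer) ∧
      ∃ l, Sum.inr (t.net.addWeak ({0} \ t.fv)).root ∈
        ((t.net.addWeak ({0} \ t.fv)).shape l).eSources := by
  refine ⟨?_, ?_, ?_⟩
  · rw [← Set.union_sdiff_self]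
    exact h.tidy.addWeak Set.disjoint_sdiff_left
  · rintro n (l | m) hl
    · exact h.isDer_of_name hl
    · have h1 := m.2.1
      have h2 : Sum.inl (n + 1) = (Sum.inl m.1 : ℕ ⊕ t.net.E) := hl
      cases h1.symm.trans (Sum.inl.inj h2).symm
  · obtain ⟨l, -, hl, -⟩ := h.rep.root
    exact ⟨.inl l, hl⟩

mutual
theorem Val.tidyBelow_content (v : Val) :
    TidyBelow v.content.shape v.content.box v.fv := by
  match v with
  | .var n => exact tidyBelow_ofVar n
  | .lam t =>
    obtain ⟨h1, h2, h3⟩ := Tm.body_isTidy t.denotes_net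
    have h := tidyBelow_ofBox h1 (.inr rfl) h2 h3 (sh := (Val.lam t).content.shape)
      (bx := (Val.lam t).content.box) rfl (fun _ => rfl) rfl fun _ => rfl
    have e : {n | n + 1 ∈ t.fv ∪ {0}} = (Val.lam t).fv := by
      ext n; simp [Val.fv]
    rwa [e] at h
theorem Tm.denotes_net (t : Tm) : t.net.Denotes t t.fv := by
  refine ⟨?_, t.net_rep⟩
  match t with
  | .val v =>
    exact tidy_ofBang v.tidyBelow_content rfl (fun _ => rfl) fun _ => rfl
  | .app v s =>
    have hs := s.denotes_net
    obtain ⟨l, -, hl, -⟩ := hs.rep.root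
    exact tidy_ofTensor v.tidyBelow_content hs.tidy (fun _ _ => hs.isDer_of_name) ⟨l, hl⟩ rfl
      (fun _ => rfl) (fun _ => rfl) (fun _ => rfl) fun _ => rfl
  | .sub t u =>
    obtain ⟨h1, h2, -⟩ := Tm.body_isTidy t.denotes_net
    have hu := u.denotes_net
    obtain ⟨l, -, hl, -⟩ := hu.rep.root
    have h := tidy_ofSub h1 (.inr rfl) h2 hu.tidy (fun _ _ => hu.isDer_of_name) ⟨l, hl⟩
      (fun _ _ _ _ => hu.root_notMem_box) (sh := (Tm.sub t u).net.shape)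
      (bx := (Tm.sub t u).net.box) (fun _ => rfl) (fun _ => rfl) (fun _ => rfl) fun _ => rfl
    have e : {n | n + 1 ∈ t.fv ∪ {0}} ∪ u.fv = (Tm.sub t u).fv := by
      ext n; simp [Tm.fv]
    rwa [e] at h
end

/-- The translation represents the term. -/
theorem Tm.denotes_netOn {t : Tm} {X : Set ℕ} (hX : t.fv ⊆ X) : (t.netOn X).Denotes t X := by
  refine ⟨?_, t.netOn_rep X⟩
  have := t.denotes_net.tidy.addWeak (W := X \ t.fv) Set.disjoint_sdiff_left
  rwa [Set.union_sdiff_cancel hX] at this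

end VKer

theorem mainTheorem2 (t : VKer.Tm) (X : Set ℕ) (hX : t.fv ⊆ X) :
    (t.netOn X).IsNet ∧
    ∀ a : VKer.Mode,
      (∀ t' : VKer.Tm, t.Step a t' → (t.netOn X).Step a (t'.netOn X)) ∧
      (∀ G : VKer.Net, (t.netOn X).Step a G →
        ∃ t' : VKer.Tm, t.Step a t' ∧ G.Iso (t'.netOn X)) := by
  have hD := VKer.Tm.denotes_netOn hX
  refine ⟨hD.isNet, fun a => ⟨fun t' ht => ?_, fun G ⟨K, K', hK, hr, hK'⟩ => ?_⟩⟩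
  · -- the reduct represents `t'`, hence it is the translation of `t'`
    obtain ⟨K', hr, hK'⟩ := hD.exists_rule ht
    exact ⟨_, K', hD.iso hD, hr, hK'.iso (VKer.Tm.denotes_netOn hK'.fv_subset)⟩
  · obtain ⟨t', ht, hD'⟩ := (hD.of_iso hK).exists_step hr
    have hG := hD'.of_iso hK'
    exact ⟨t', ht, hG.iso (VKer.Tm.denotes_netOn hG.fv_subset)⟩
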